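/- **Conventions.** A (not necessarily unital) *$C^*$-category* $V$ is a small category, possibly without identity morphisms, whose morphism spaces $V(X,Y)$ are complex Banach spaces, with bilinear composition satisfying $\|g\circ f\|\le\|g\|\|f\|$ and a conjugate linear involution $*:V(X,Y)\to V(Y,X)$, which is contravariant, such that $\|f^*\circ f\|=\|f\|^2$ and $f^*\circ f$ is positive in the $C^*$-algebra $V(X,X)$ for every $f\in V(X,Y)$. The *multiplier category* $MV$ is the unital $C^*$-category with the same objects, whose morphisms $X\to Y$ are pairs $(L,R)$ of uniformly bounded families of linear maps $L:V(Z,X)\to V(Z,Y)$, $R:V(Y,Z)\to V(X,Z)$ ($Z\in V$) with $L(h\circ g)=L(h)\circ g$, $R(f\circ h)=f\circ R(h)$ and $g\circ L(f)=R(g)\circ f$. A linear $*$-functor $f:V\to MW$ is *nondegenerate* if $[f(V(Y,Y))\circ W(f(X),f(Y))]=W(f(X),f(Y))=[W(f(X),f(Y))\circ f(V(X,X))]$ for all $X,Y\in V$, where $[\,\cdot\,]$ denotes the closed linear span; it then extends uniquely to a unital $*$-functor $MV\to MW$. A *multiplier natural transformation* between $*$-functors into $MW$ is a natural transformation with uniformly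 bounded components in $MW$. $V$ is *countably additive* if every projection $p\in MV(X,X)$ is of the form $p=\iota\circ\iota^*$ with $\iota\in MV(U,X)$, $\iota^*\circ\iota=\mathrm{id}_U$, and every countable family $(X_i)$ of objects has a direct sum: an object $S$ with $\iota_i\in MV(X_i,S)$ such that $\iota_k^*\circ\iota_l=\delta_{kl}\,\mathrm{id}$ and $\sum_i\iota_i\circ\iota_i^*=\mathrm{id}_S$ strictly. $C^*\mathrm{Lin}$ is the bicategory of countably additive $C^*$-categories, with nondegenerate linear $*$-functors $V\to MW$ as $1$-morphisms $V\to W$ (composed through their extensions to multipliers) and multiplier natural transformations as $2$-morphisms. $C^*\mathrm{Lin}(V,W)$ is the resulting unital $C^*$-category of $1$-morphisms $V\to W$. A *nondegenerate bilinear $*$-functor* $b:V_1\times V_2\to MW$ is a $*$-functor which is bilinear on morphism spaces and such that the induced functor on the algebraic tensor product $V_1\boxdot V_2$ is nondegenerate; $C^*\mathrm{Bilin}(V_1,V_2;W)$ is the unital $C^*$-category of these functors and their multiplier natural transformations. The $C^*$-category $V_1\boxdot_{\max}V_2$ has the pairs $(X_1,X_2)$ as objects and the completions of the algebraic tensor products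 $V_1(X_1,Y_1)\odot V_2(X_2,Y_2)$ for $\|t\|_{\max}=\sup_\pi\|\pi(t)\|$ as morphism spaces, where $\pi$ runs over all nondegenerate linear $*$-functors from $V_1\boxdot V_2$ to Hilbert spaces and bounded operators. Its subobject completion $V_1\boxtimes_{\max}V_2$ has as objects the pairs $(X,p)$ of an object $X$ and a projection $p$ in its multiplier category, and as morphisms $(X,p)\to(Y,q)$ all $h:X\to Y$ with $h\circ p=h=q\circ h$. The canonical bilinear $*$-functor $\boxtimes_{\max}:V_1\times V_2\to V_1\boxtimes_{\max}V_2$ sends $(X_1,X_2)$ to $((X_1,X_2),\mathrm{id})$ and $(f_1,f_2)$ to $f_1\otimes f_2$. **Proposition.** Let $V_1,V_2\in C^*\mathrm{Lin}$. Then $V_1\boxtimes_{\max}V_2\in C^*\mathrm{Lin}$, and for every $W\in C^*\mathrm{Lin}$ the functor $$F_W:\ C^*\mathrm{Lin}(V_1\boxtimes_{\max}V_2,W)\to C^*\mathrm{Bilin}(V_1,V_2;W),\qquad F_W(f)=f\circ\boxtimes_{\max},\quad F_W(\sigma)=\sigma*\boxtimes_{\max},$$ is an equivalence of $C^*$-categories: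 it is a unital linear $*$-functor, and there is a unital linear $*$-functor $G_W$ in the opposite direction with $G_W\circ F_W$ and $F_W\circ G_W$ unitarily naturally isomorphic to the identity functors. The equivalences are pseudonatural in $W$: the functors $F_W$ are the components of a pseudonatural transformation, with unitary structure $2$-morphisms, between the pseudofunctors $C^*\mathrm{Lin}(V_1\boxtimes_{\max}V_2,-)$ and $C^*\mathrm{Bilin}(V_1,V_2;-)$ from $C^*\mathrm{Lin}$ to the $2$-category of unital $C^*$-categories, unital linear $*$-functors and uniformly bounded natural transformations. -/

import Mathlib

universe u

open Filter Topology CategoryTheory Bicategory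
open scoped ENNReal TensorProduct

noncomputable section

/-! ## Small semicategories with involution, `C*`-categories -/

/-- A small semicategory (no identities required) with an involutive contravariant endofunctor
`adj` which is the identity on objects.  Composition is written in the order `comp g f = g ∘ f`. -/
structure StarSemicat where
  Obj : Type u
  Hom : Obj → Obj → Type u
  comp : ∀ {X Y Z : Obj}, Hom Y Z → Hom X Y → Hom X Z
  adj : ∀ {X Y : Obj}, Hom X Y → Hom Y X
  comp_assoc : ∀ {W X Y Z : Obj} (h : Hom Y Z) (g : Hom X Y) (f : Hom W X),
    comp (comp h g) f = comp h (comp g f)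
  adj_adj : ∀ {X Y : Obj} (f : Hom X Y), adj (adj f) = f
  adj_comp : ∀ {X Y Z : Obj} (g : Hom Y Z) (f : Hom X Y), adj (comp g f) = comp (adj f) (adj g)

/-- The product of two semicategories with involution. -/
def StarSemicat.prod (C D : StarSemicat.{u}) : StarSemicat.{u} where
  Obj := C.Obj × D.Obj
  Hom X Y := C.Hom X.1 Y.1 × D.Hom X.2 Y.2
  comp g f := (C.comp g.1 f.1, D.comp g.2 f.2)
  adj f := (C.adj f.1, D.adj f.2)
  comp_assoc _ _ _ := by simp only [C.comp_assoc, D.comp_assoc]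
  adj_adj _ := by simp only [C.adj_adj, D.adj_adj]
  adj_comp _ _ := by simp only [C.adj_comp, D.adj_comp]

/-- The data and axioms of a small (not necessarily unital) `C*`-category, except for positivity
of the elements `f* ∘ f`. -/
structure PreCStarCat extends StarSemicat.{u} where
  [normed : ∀ X Y : Obj, NormedAddCommGroup (Hom X Y)]
  [space : ∀ X Y : Obj, NormedSpace ℂ (Hom X Y)]
  [complete : ∀ X Y : Obj, CompleteSpace (Hom X Y)]
  add_comp : ∀ {X Y Z : Obj} (g g' : Hom Y Z) (f : Hom X Y),
    comp (g + g') f = comp g f + comp g' f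
  comp_add : ∀ {X Y Z : Obj} (g : Hom Y Z) (f f' : Hom X Y),
    comp g (f + f') = comp g f + comp g f'
  smul_comp : ∀ {X Y Z : Obj} (c : ℂ) (g : Hom Y Z) (f : Hom X Y),
    comp (c • g) f = c • comp g f
  comp_smul : ∀ {X Y Z : Obj} (c : ℂ) (g : Hom Y Z) (f : Hom X Y),
    comp g (c • f) = c • comp g f
  adj_add : ∀ {X Y : Obj} (f g : Hom X Y), adj (f + g) = adj f + adj g
  adj_smul : ∀ {X Y : Obj} (c : ℂ) (f : Hom X Y), adj (c • f) = star c • adj f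
  norm_comp_le : ∀ {X Y Z : Obj} (g : Hom Y Z) (f : Hom X Y), ‖comp g f‖ ≤ ‖g‖ * ‖f‖
  norm_adj_comp : ∀ {X Y : Obj} (f : Hom X Y), ‖comp (adj f) f‖ = ‖f‖ ^ 2

attribute [instance] PreCStarCat.normed PreCStarCat.space PreCStarCat.complete

/-- A small (not necessarily unital) `C*`-category: in addition, `f* ∘ f` is a positive element of
the `C*`-algebra of endomorphisms of the source of `f`, that is, of the form `g* ∘ g`. -/
structure CStarCat extends PreCStarCat.{u} where
  pos : ∀ {X Y : Obj} (f : Hom X Y), ∃ g : Hom X X, comp (adj f) f = comp (adj g) g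

/-- A unital `C*`-category. -/
structure UCStarCat extends CStarCat.{u} where
  id : ∀ X : Obj, Hom X X
  id_comp : ∀ {X Y : Obj} (f : Hom X Y), comp (id Y) f = f
  comp_id : ∀ {X Y : Obj} (f : Hom X Y), comp f (id X) = f

namespace PreCStarCat

variable (V : PreCStarCat.{u}) {X Y Z : V.Obj}

lemma norm_adj (f : V.Hom X Y) : ‖V.adj f‖ = ‖f‖ := by
  have key : ∀ {X Y : V.Obj} (f : V.Hom X Y), ‖f‖ ≤ ‖V.adj f‖ := by
    intro X Y f
    have h1 := V.norm_adj_comp f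
    have h2 := V.norm_comp_le (V.adj f) f
    by_contra h
    nlinarith [norm_nonneg (V.adj f), norm_nonneg f]
  refine le_antisymm ?_ (key f)
  simpa [V.adj_adj] using key (V.adj f)

lemma norm_comp_adj (f : V.Hom X Y) : ‖V.comp f (V.adj f)‖ = ‖f‖ ^ 2 := by
  have := V.norm_adj_comp (V.adj f)
  rwa [V.adj_adj, V.norm_adj] at this

/-- Composition as a bounded bilinear map. -/
def compL (X Y Z : V.Obj) : V.Hom Y Z →L[ℂ] V.Hom X Y →L[ℂ] V.Hom X Z :=
  LinearMap.mkContinuous₂ (LinearMap.mk₂ ℂ V.comp V.add_comp V.smul_comp V.comp_add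
    (fun c g f => V.comp_smul c g f)) 1 (fun g f => by simpa using V.norm_comp_le g f)

@[simp] lemma compL_apply (g : V.Hom Y Z) (f : V.Hom X Y) : V.compL X Y Z g f = V.comp g f := rfl

/-- The adjoint operation as a conjugate linear map. -/
def adjL (X Y : V.Obj) : V.Hom X Y →ₛₗ[starRingEnd ℂ] V.Hom Y X where
  toFun := V.adj
  map_add' := V.adj_add
  map_smul' c f := V.adj_smul c f

@[simp] lemma adjL_apply (f : V.Hom X Y) : V.adjL X Y f = V.adj f := rfl

lemma comp_zero (g : V.Hom Y Z) : V.comp g (0 : V.Hom X Y) = 0 := (V.compL X Y Z g).map_zero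

lemma zero_comp (f : V.Hom X Y) : V.comp (0 : V.Hom Y Z) f = 0 := by
  simpa using V.smul_comp 0 (0 : V.Hom Y Z) f

lemma comp_sub (g : V.Hom Y Z) (f f' : V.Hom X Y) :
    V.comp g (f - f') = V.comp g f - V.comp g f' := (V.compL X Y Z g).map_sub f f'

lemma sub_comp (g g' : V.Hom Y Z) (f : V.Hom X Y) :
    V.comp (g - g') f = V.comp g f - V.comp g' f := by
  rw [← compL_apply, map_sub]; rfl

lemma adj_zero : V.adj (0 : V.Hom X Y) = 0 := (V.adjL X Y).map_zero

lemma adj_neg (f : V.Hom X Y) : V.adj (-f) = -V.adj f := (V.adjL X Y).map_neg f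

lemma adj_sub (f g : V.Hom X Y) : V.adj (f - g) = V.adj f - V.adj g := (V.adjL X Y).map_sub f g

lemma continuous_comp : Continuous (fun p : V.Hom Y Z × V.Hom X Y => V.comp p.1 p.2) := by
  simpa using ((V.compL X Y Z).isBoundedBilinearMap).continuous

lemma continuous_adj : Continuous (V.adj : V.Hom X Y → V.Hom Y X) :=
  AddMonoidHomClass.continuous_of_bound (V.adjL X Y) 1 (fun f => by simp [V.norm_adj])

lemma eq_zero_of_adj_comp {f : V.Hom X Y} (h : V.comp (V.adj f) f = 0) : f = 0 := by
  have := V.norm_adj_comp f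
  rw [h, norm_zero] at this
  exact norm_eq_zero.1 (pow_eq_zero_iff two_ne_zero |>.1 this.symm)

lemma ext_left {f g : V.Hom X Y} (h : ∀ (Z : V.Obj) (k : V.Hom Y Z), V.comp k f = V.comp k g) :
    f = g := by
  rw [← sub_eq_zero]
  apply V.eq_zero_of_adj_comp
  rw [V.comp_sub, h, sub_self]

lemma ext_right {f g : V.Hom X Y} (h : ∀ (Z : V.Obj) (k : V.Hom Z X), V.comp f k = V.comp g k) :
    f = g := by
  have : V.adj f = V.adj g := V.ext_left fun Z k => by
    simpa [V.adj_comp, V.adj_adj] using congrArg V.adj (h Z (V.adj k))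
  simpa [V.adj_adj] using congrArg V.adj this

/-- The `C*`-algebra of endomorphisms of an object. -/
abbrev endAlgebra (X : V.Obj) : NonUnitalCStarAlgebra (V.Hom X X) :=
  { V.normed X X, V.space X X, V.complete X X with
    mul := fun a b => V.comp a b
    left_distrib := V.comp_add
    right_distrib := V.add_comp
    zero_mul := V.zero_comp
    mul_zero := V.comp_zero
    mul_assoc := V.comp_assoc
    norm_mul_le := V.norm_comp_le
    star := V.adj
    star_involutive := V.adj_adj
    star_mul := V.adj_comp
    star_add := V.adj_add
    norm_mul_self_le := fun a => by
      have := V.norm_adj_comp a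
      exact (by rw [this, sq] : ‖a‖ * ‖a‖ ≤ ‖V.comp (V.adj a) a‖)
    smul_assoc := V.smul_comp
    smul_comm := fun c a b => (V.comp_smul c a b).symm
    star_smul := V.adj_smul }

end PreCStarCat

/-! ## Positivity in `C*`-algebras -/

section Positivity

attribute [local instance] CStarAlgebra.spectralOrder CStarAlgebra.spectralOrderedRing

/-- A selfadjoint element whose images under a jointly injective family of `*`-homomorphisms are
positive is positive. -/
lemma exists_eq_star_mul_self_of_family {A : Type*} [NonUnitalCStarAlgebra A] {ι : Type*}
    {B : ι → Type*} [∀ i, NonUnitalCStarAlgebra (B i)] (φ : ∀ i, A →⋆ₙₐ[ℂ] B i)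
    (hφ : ∀ a, (∀ i, φ i a = 0) → a = 0) (a : A) (ha : star a = a)
    (h : ∀ i, ∃ b, φ i a = star b * b) : ∃ c, a = star c * c := by
  have hneg : a⁻ = 0 := by
    apply hφ
    intro i
    have hc : Continuous (φ i) := by fun_prop
    have h1 : φ i (a⁻) = (φ i a)⁻ := by
      rw [CFC.negPart_def, CFC.negPart_def]
      exact (φ i).map_cfcₙ (R := ℝ) (S := ℂ) (fun x => x⁻) a (by fun_prop) (by simp) hc ha
        (by rw [isSelfAdjoint_iff, ← map_star, ha])
    obtain ⟨b, hb⟩ := h i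
    rw [h1, CFC.negPart_eq_zero_iff _ (by rw [isSelfAdjoint_iff, ← map_star, ha]), hb]
    exact star_mul_self_nonneg b
  rw [CFC.negPart_eq_zero_iff _ ha] at hneg
  exact CStarAlgebra.nonneg_iff_eq_star_mul_self.1 hneg

/-- `star c * c = -(star d * d)` forces `d = 0`. -/
lemma eq_zero_of_star_mul_self_eq_neg {A : Type*} [NonUnitalCStarAlgebra A] {c d : A}
    (h : star c * c = -(star d * d)) : d = 0 := by
  have h1 : star d * d ≤ 0 := by
    have := star_mul_self_nonneg c
    rw [h] at this
    exact neg_nonneg.1 this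
  exact (CStarRing.star_mul_self_eq_zero_iff d).1 (le_antisymm h1 (star_mul_self_nonneg d))

/-- A selfadjoint `a` with `n * a * n = -(star s * s)`, where `n` is its negative part. -/
lemma exists_neg_cube {A : Type*} [NonUnitalCStarAlgebra A] (a : A) (ha : star a = a) :
    ∃ n s : A, star n = n ∧ n * a * n = -(star s * s) ∧ (s = 0 → ∃ c, a = star c * c) := by
  have hn : 0 ≤ a⁻ := CFC.negPart_nonneg a
  refine ⟨a⁻, CFC.sqrt a⁻ * a⁻, (IsSelfAdjoint.of_nonneg hn).star_eq, ?_, ?_⟩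
  · have h1 := CFC.posPart_sub_negPart a ha
    have hs : star (CFC.sqrt a⁻) = CFC.sqrt a⁻ :=
      (IsSelfAdjoint.of_nonneg (CFC.sqrt_nonneg _)).star_eq
    have h2 : CFC.sqrt a⁻ * CFC.sqrt a⁻ = a⁻ := CFC.sqrt_mul_sqrt_self _ hn
    calc a⁻ * a * a⁻ = a⁻ * (a⁺ - a⁻) * a⁻ := by rw [h1]
      _ = -(a⁻ * a⁻ * a⁻) := by rw [mul_sub, CFC.negPart_mul_posPart, zero_sub, neg_mul]
      _ = -(a⁻ * (CFC.sqrt a⁻ * CFC.sqrt a⁻) * a⁻) := by rw [h2]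
      _ = _ := by rw [star_mul, hs, (IsSelfAdjoint.of_nonneg hn).star_eq]; simp only [mul_assoc]
  · intro h
    have h2 : CFC.sqrt a⁻ * CFC.sqrt a⁻ = a⁻ := CFC.sqrt_mul_sqrt_self _ hn
    have h3 : a⁻ * a⁻ = 0 := by
      nth_rewrite 1 [← h2]
      rw [mul_assoc, h, mul_zero]
    have h4 : a⁻ = 0 := by
      have := (CStarRing.star_mul_self_eq_zero_iff a⁻).1
        (by rw [(IsSelfAdjoint.of_nonneg hn).star_eq, h3])
      exact this
    rw [CFC.negPart_eq_zero_iff _ ha] at h4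
    exact CStarAlgebra.nonneg_iff_eq_star_mul_self.1 h4

end Positivity
/-! ## Multiplier morphisms -/

namespace CStarCat

variable (V : CStarCat.{u})

/-- Uniformly bounded families of linear maps `V(Z, X) → V(Z, Y)` (supremum norm). -/
abbrev LeftFam (X Y : V.Obj) : Type u := lp (fun Z : V.Obj => V.Hom Z X →L[ℂ] V.Hom Z Y) ∞

/-- Uniformly bounded families of linear maps `V(Y, Z) → V(X, Z)` (supremum norm). -/
abbrev RightFam (X Y : V.Obj) : Type u := lp (fun Z : V.Obj => V.Hom Y Z →L[ℂ] V.Hom X Z) ∞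

variable {V} in
lemma leftFam_add {X Y : V.Obj} (L M : V.LeftFam X Y) (Z : V.Obj) (f : V.Hom Z X) :
    (L + M).1 Z f = L.1 Z f + M.1 Z f := rfl

/-- The space of multiplier morphisms `X → Y`: pairs `(L, R)` of a left multiplier morphism `L`
and a right multiplier morphism `R` with `g ∘ L(f) = R(g) ∘ f`. -/
def multSub (X Y : V.Obj) : Submodule ℂ (V.LeftFam X Y × V.RightFam X Y) where
  carrier := {F |
    (∀ (W Z : V.Obj) (h : V.Hom Z X) (g : V.Hom W Z),
      F.1.1 W (V.comp h g) = V.comp (F.1.1 Z h) g) ∧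
    (∀ (W Z : V.Obj) (f : V.Hom W Z) (h : V.Hom Y W),
      F.2.1 Z (V.comp f h) = V.comp f (F.2.1 W h)) ∧
    (∀ (W Z : V.Obj) (f : V.Hom W X) (g : V.Hom Y Z),
      V.comp g (F.1.1 W f) = V.comp (F.2.1 Z g) f)}
  add_mem' := by
    rintro F G ⟨h1, h2, h3⟩ ⟨k1, k2, k3⟩
    refine ⟨fun W Z h g => ?_, fun W Z f h => ?_, fun W Z f g => ?_⟩
    · change F.1.1 W _ + G.1.1 W _ = V.comp (F.1.1 Z h + G.1.1 Z h) g
      rw [h1, k1, V.add_comp]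
    · change F.2.1 Z _ + G.2.1 Z _ = V.comp f (F.2.1 W h + G.2.1 W h)
      rw [h2, k2, V.comp_add]
    · change V.comp g (F.1.1 W f + G.1.1 W f) = V.comp (F.2.1 Z g + G.2.1 Z g) f
      rw [V.comp_add, V.add_comp, h3, k3]
  zero_mem' := by
    refine ⟨fun W Z h g => ?_, fun W Z f h => ?_, fun W Z f g => ?_⟩
    · exact (V.zero_comp g).symm
    · exact (V.comp_zero f).symm
    · exact (V.comp_zero g).trans (V.zero_comp f).symm
  smul_mem' := by
    rintro c F ⟨h1, h2, h3⟩
    refine ⟨fun W Z h g => ?_, fun W Z f h => ?_, fun W Z f g => ?_⟩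
    · change c • F.1.1 W _ = V.comp (c • F.1.1 Z h) g
      rw [h1, V.smul_comp]
    · change c • F.2.1 Z _ = V.comp f (c • F.2.1 W h)
      rw [h2, V.comp_smul]
    · change V.comp g (c • F.1.1 W f) = V.comp (c • F.2.1 Z g) f
      rw [V.comp_smul, V.smul_comp, h3]

/-- Multiplier morphisms `X → Y` in `V`; the norm is the maximum of the two supremum norms. -/
def Mult (X Y : V.Obj) : Type u := V.multSub X Y

namespace Mult

variable {V} {X Y Z : V.Obj}

instance : NormedAddCommGroup (V.Mult X Y) := inferInstanceAs (NormedAddCommGroup (V.multSub X Y))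
instance : NormedSpace ℂ (V.Mult X Y) := inferInstanceAs (NormedSpace ℂ (V.multSub X Y))

/-- `F.act f = F ∘ f`, the left multiplier underlying `F`. -/
def act {W : V.Obj} (F : V.Mult X Y) (f : V.Hom W X) : V.Hom W Y := F.1.1.1 W f

/-- `F.coact g = g ∘ F`, the right multiplier underlying `F`. -/
def coact {W : V.Obj} (F : V.Mult X Y) (g : V.Hom Y W) : V.Hom X W := F.1.2.1 W g

section
variable {W W' : V.Obj} (F G : V.Mult X Y)

lemma act_comp (h : V.Hom W X) (g : V.Hom W' W) :
    F.act (V.comp h g) = V.comp (F.act h) g := F.2.1 _ _ h g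
lemma coact_comp (f : V.Hom W W') (h : V.Hom Y W) :
    F.coact (V.comp f h) = V.comp f (F.coact h) := F.2.2.1 _ _ f h
lemma comp_act (f : V.Hom W X) (g : V.Hom Y W') :
    V.comp g (F.act f) = V.comp (F.coact g) f := F.2.2.2 _ _ f g
lemma act_add (f g : V.Hom W X) : F.act (f + g) = F.act f + F.act g := map_add (F.1.1.1 W) f g
lemma act_smul (c : ℂ) (f : V.Hom W X) : F.act (c • f) = c • F.act f := map_smul (F.1.1.1 W) c f
lemma act_sub (f g : V.Hom W X) : F.act (f - g) = F.act f - F.act g := map_sub (F.1.1.1 W) f g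
lemma act_zero : F.act (0 : V.Hom W X) = 0 := map_zero (F.1.1.1 W)
lemma coact_add (f g : V.Hom Y W) : F.coact (f + g) = F.coact f + F.coact g :=
  map_add (F.1.2.1 W) f g
lemma coact_smul (c : ℂ) (f : V.Hom Y W) : F.coact (c • f) = c • F.coact f :=
  map_smul (F.1.2.1 W) c f
lemma add_act (f : V.Hom W X) : (F + G).act f = F.act f + G.act f := rfl
lemma sub_act (f : V.Hom W X) : (F - G).act f = F.act f - G.act f := rfl
lemma neg_act (f : V.Hom W X) : (-F).act f = -F.act f := rfl
lemma smul_act (c : ℂ) (f : V.Hom W X) : (c • F).act f = c • F.act f := rfl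
lemma zero_act (f : V.Hom W X) : (0 : V.Mult X Y).act f = 0 := rfl
lemma add_coact (f : V.Hom Y W) : (F + G).coact f = F.coact f + G.coact f := rfl
lemma smul_coact (c : ℂ) (f : V.Hom Y W) : (c • F).coact f = c • F.coact f := rfl
lemma continuous_act : Continuous (F.act : V.Hom W X → V.Hom W Y) := (F.1.1.1 W).continuous
lemma continuous_coact : Continuous (F.coact : V.Hom Y W → V.Hom X W) := (F.1.2.1 W).continuous

lemma norm_act_le (f : V.Hom W X) : ‖F.act f‖ ≤ ‖F‖ * ‖f‖ := by
  refine (ContinuousLinearMap.le_opNorm _ _).trans ?_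
  gcongr
  exact (lp.norm_apply_le_norm ENNReal.top_ne_zero F.1.1 W).trans (norm_fst_le F.1)

lemma norm_coact_le (f : V.Hom Y W) : ‖F.coact f‖ ≤ ‖F‖ * ‖f‖ := by
  refine (ContinuousLinearMap.le_opNorm _ _).trans ?_
  gcongr
  exact (lp.norm_apply_le_norm ENNReal.top_ne_zero F.1.2 W).trans (norm_snd_le F.1)

end

lemma norm_le (F : V.Mult X Y) {C : ℝ} (hC : 0 ≤ C)
    (h : ∀ (W : V.Obj) (f : V.Hom W X), ‖F.act f‖ ≤ C * ‖f‖) : ‖F‖ ≤ C := by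
  refine max_le ?_ ?_
  · exact lp.norm_le_of_forall_le hC fun W => ContinuousLinearMap.opNorm_le_bound _ hC (h W)
  · refine lp.norm_le_of_forall_le hC fun W => ContinuousLinearMap.opNorm_le_bound _ hC fun g => ?_
    change ‖F.coact g‖ ≤ C * ‖g‖
    have h1 := V.norm_comp_adj (F.coact g)
    rw [← F.comp_act] at h1
    have h2 := V.norm_comp_le g (F.act (V.adj (F.coact g)))
    have h3 := h _ (V.adj (F.coact g))
    rw [V.norm_adj] at h3
    by_contra hlt
    push Not at hlt
    have h4 : 0 < ‖F.coact g‖ := lt_of_le_of_lt (by positivity) hlt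
    nlinarith [norm_nonneg g]

lemma ext_act {F G : V.Mult X Y} (h : ∀ (W : V.Obj) (f : V.Hom W X), F.act f = G.act f) :
    F = G := by
  rw [← sub_eq_zero, ← norm_le_zero_iff]
  exact norm_le _ le_rfl fun W f => by simp [sub_act, h]

/-- Constructor for multiplier morphisms. -/
def mk (L : ∀ Z : V.Obj, V.Hom Z X →ₗ[ℂ] V.Hom Z Y) (R : ∀ Z : V.Obj, V.Hom Y Z →ₗ[ℂ] V.Hom X Z)
    (C : ℝ) (hL : ∀ Z f, ‖L Z f‖ ≤ C * ‖f‖) (hR : ∀ Z f, ‖R Z f‖ ≤ C * ‖f‖)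
    (h1 : ∀ (W Z : V.Obj) (h : V.Hom Z X) (g : V.Hom W Z), L W (V.comp h g) = V.comp (L Z h) g)
    (h2 : ∀ (W Z : V.Obj) (f : V.Hom W Z) (h : V.Hom Y W), R Z (V.comp f h) = V.comp f (R W h))
    (h3 : ∀ (W Z : V.Obj) (f : V.Hom W X) (g : V.Hom Y Z), V.comp g (L W f) = V.comp (R Z g) f) :
    V.Mult X Y :=
  ⟨(⟨fun Z => (L Z).mkContinuous (max C 0)
      fun f => (hL Z f).trans (by gcongr; exact le_max_left _ _),
      memℓp_infty ⟨max C 0, by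
        rintro _ ⟨Z, rfl⟩
        exact LinearMap.mkContinuous_norm_le _ (le_max_right _ _) _⟩⟩,
    ⟨fun Z => (R Z).mkContinuous (max C 0)
      fun f => (hR Z f).trans (by gcongr; exact le_max_left _ _),
      memℓp_infty ⟨max C 0, by
        rintro _ ⟨Z, rfl⟩
        exact LinearMap.mkContinuous_norm_le _ (le_max_right _ _) _⟩⟩), h1, h2, h3⟩

/-- The multiplier morphism defined by a morphism. -/
def of (f : V.Hom X Y) : V.Mult X Y :=
  mk (fun Z => (V.compL Z X Y f).toLinearMap) (fun Z => ((V.compL X Y Z).flip f).toLinearMap) ‖f‖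
    (fun Z h => V.norm_comp_le f h) (fun Z h => (V.norm_comp_le h f).trans_eq (mul_comm _ _))
    (fun _ _ h g => (V.comp_assoc f h g).symm) (fun _ _ h g => V.comp_assoc h g f)
    (fun _ _ h g => (V.comp_assoc g f h).symm)

/-- The identity multiplier morphism. -/
def id (X : V.Obj) : V.Mult X X :=
  mk (fun _ => LinearMap.id) (fun _ => LinearMap.id) 1 (by simp) (by simp)
    (fun _ _ _ _ => rfl) (fun _ _ _ _ => rfl) (fun _ _ _ _ => rfl)

/-- Composition `G ∘ F = (L_G ∘ L_F, R_F ∘ R_G)`. -/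
def comp (G : V.Mult Y Z) (F : V.Mult X Y) : V.Mult X Z :=
  mk (fun W => (G.1.1.1 W).toLinearMap ∘ₗ (F.1.1.1 W).toLinearMap)
    (fun W => (F.1.2.1 W).toLinearMap ∘ₗ (G.1.2.1 W).toLinearMap) (‖G‖ * ‖F‖)
    (fun W f => (G.norm_act_le (F.act f)).trans (by
      rw [mul_assoc]; gcongr; exact F.norm_act_le f))
    (fun W f => (F.norm_coact_le (G.coact f)).trans (by
      rw [mul_comm ‖G‖, mul_assoc]; gcongr; exact G.norm_coact_le f))
    (fun _ _ h g => (congrArg G.act (F.act_comp h g)).trans (G.act_comp _ g))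
    (fun _ _ f h => (congrArg F.coact (G.coact_comp f h)).trans (F.coact_comp f _))
    (fun _ _ f g => (G.comp_act (F.act f) g).trans (F.comp_act f (G.coact g)))

/-- The adjoint `F* = (L_{F*}, R_{F*})`, `L_{F*}(f) = R_F(f*)*`, `R_{F*}(f) = L_F(f*)*`. -/
def adj (F : V.Mult X Y) : V.Mult Y X :=
  mk (fun W => (V.adjL X W).comp ((F.1.2.1 W).toLinearMap.comp (V.adjL W Y)))
    (fun W => (V.adjL W Y).comp ((F.1.1.1 W).toLinearMap.comp (V.adjL X W))) ‖F‖
    (fun W f => by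
      change ‖V.adj (F.coact (V.adj f))‖ ≤ _
      rw [V.norm_adj, ← V.norm_adj f]
      exact F.norm_coact_le _)
    (fun W f => by
      change ‖V.adj (F.act (V.adj f))‖ ≤ _
      rw [V.norm_adj, ← V.norm_adj f]
      exact F.norm_act_le _)
    (fun W _ h g => by
      change V.adj (F.coact (V.adj (V.comp h g))) = V.comp (V.adj (F.coact (V.adj h))) g
      rw [V.adj_comp, F.coact_comp, V.adj_comp, V.adj_adj])
    (fun W _ f h => by
      change V.adj (F.act (V.adj (V.comp f h))) = V.comp f (V.adj (F.act (V.adj h)))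
      rw [V.adj_comp, F.act_comp, V.adj_comp, V.adj_adj])
    (fun W Z f g => by
      change V.comp g (V.adj (F.coact (V.adj f))) = V.comp (V.adj (F.act (V.adj g))) f
      have := congrArg V.adj (F.comp_act (V.adj g) (V.adj f))
      rw [V.adj_comp, V.adj_comp, V.adj_adj, V.adj_adj] at this
      exact this.symm)

section
variable {W : V.Obj}
@[simp] lemma of_act (f : V.Hom X Y) (h : V.Hom W X) : (of f).act h = V.comp f h := rfl
@[simp] lemma of_coact (f : V.Hom X Y) (h : V.Hom Y W) : (of f).coact h = V.comp h f := rfl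
@[simp] lemma id_act (h : V.Hom W X) : (id X).act h = h := rfl
@[simp] lemma id_coact (h : V.Hom X W) : (id X).coact h = h := rfl
@[simp] lemma comp_act' (G : V.Mult Y Z) (F : V.Mult X Y) (h : V.Hom W X) :
    (comp G F).act h = G.act (F.act h) := rfl
@[simp] lemma comp_coact' (G : V.Mult Y Z) (F : V.Mult X Y) (h : V.Hom Z W) :
    (comp G F).coact h = F.coact (G.coact h) := rfl
@[simp] lemma adj_act (F : V.Mult X Y) (h : V.Hom W Y) :
    (adj F).act h = V.adj (F.coact (V.adj h)) := rfl
@[simp] lemma adj_coact (F : V.Mult X Y) (h : V.Hom X W) :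
    (adj F).coact h = V.adj (F.act (V.adj h)) := rfl
end

lemma comp_assoc {W : V.Obj} (H : V.Mult Y Z) (G : V.Mult X Y) (F : V.Mult W X) :
    comp (comp H G) F = comp H (comp G F) := ext_act fun _ _ => by simp

@[simp] lemma id_comp (F : V.Mult X Y) : comp (id Y) F = F := ext_act fun _ _ => by simp
@[simp] lemma comp_id (F : V.Mult X Y) : comp F (id X) = F := ext_act fun _ _ => by simp

lemma adj_adj (F : V.Mult X Y) : adj (adj F) = F := ext_act fun W f => by simp [V.adj_adj]

lemma adj_comp (G : V.Mult Y Z) (F : V.Mult X Y) : adj (comp G F) = comp (adj F) (adj G) :=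
  ext_act fun W f => by simp [V.adj_adj]

lemma adj_id (X : V.Obj) : adj (id X) = id X := ext_act fun W f => by simp [V.adj_adj]

lemma comp_of (F : V.Mult Y Z) (f : V.Hom X Y) : comp F (of f) = of (F.act f) :=
  ext_act fun W g => by simp [act_comp]

lemma of_comp (f : V.Hom Y Z) (F : V.Mult X Y) : comp (of f) F = of (F.coact f) :=
  ext_act fun W g => by simp [comp_act]

lemma adj_of (f : V.Hom X Y) : adj (of f) = of (V.adj f) :=
  ext_act fun W g => by simp [V.adj_comp, V.adj_adj]

lemma of_inj {f g : V.Hom X Y} (h : of f = of g) : f = g :=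
  V.ext_right fun Z k => by simpa using congrArg (fun F => act F k) h

lemma norm_adj_le (F : V.Mult X Y) : ‖adj F‖ ≤ ‖F‖ :=
  norm_le _ (norm_nonneg _) fun W f => by
    rw [adj_act, V.norm_adj, ← V.norm_adj f]
    exact F.norm_coact_le _

lemma norm_comp_le (G : V.Mult Y Z) (F : V.Mult X Y) : ‖comp G F‖ ≤ ‖G‖ * ‖F‖ :=
  norm_le _ (by positivity) fun W f => by
    rw [comp_act', mul_assoc]
    exact (G.norm_act_le _).trans (by gcongr; exact F.norm_act_le f)

lemma norm_id_le (X : V.Obj) : ‖id X‖ ≤ 1 := norm_le _ zero_le_one fun W f => by simp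

lemma adj_comp_act {W : V.Obj} (F : V.Mult X Y) (f : V.Hom W X) :
    V.comp (V.adj f) ((comp (adj F) F).act f) = V.comp (V.adj (F.act f)) (F.act f) := by
  rw [comp_act', adj_act, ← V.adj_comp, ← F.comp_act, V.adj_comp, V.adj_adj]

lemma norm_adj_comp (F : V.Mult X Y) : ‖comp (adj F) F‖ = ‖F‖ ^ 2 := by
  apply le_antisymm
  · rw [sq]
    exact (norm_comp_le _ _).trans (by gcongr; exact norm_adj_le F)
  · have : ‖F‖ ≤ Real.sqrt ‖comp (adj F) F‖ := by
      refine norm_le _ (Real.sqrt_nonneg _) fun W f => ?_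
      refine Real.le_sqrt_of_sq_le ?_ |>.trans_eq ?_ (b := Real.sqrt (‖comp (adj F) F‖ * ‖f‖ ^ 2))
      · rw [← V.norm_adj_comp, ← adj_comp_act]
        refine (V.norm_comp_le _ _).trans ?_
        rw [V.norm_adj]
        have := (comp (adj F) F).norm_act_le f
        nlinarith [norm_nonneg f]
      · rw [Real.sqrt_mul (norm_nonneg _), Real.sqrt_sq (norm_nonneg _)]
    calc ‖F‖ ^ 2 ≤ (Real.sqrt ‖comp (adj F) F‖) ^ 2 := by gcongr
      _ = _ := Real.sq_sqrt (norm_nonneg _)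

lemma isClosed_multSub (X Y : V.Obj) : IsClosed (V.multSub X Y : Set (V.LeftFam X Y × V.RightFam X Y)) := by
  have e1 : ∀ W, Continuous fun F : V.LeftFam X Y × V.RightFam X Y => F.1.1 W := fun W =>
    (lp.lipschitzWith_one_eval ∞ W).continuous.comp continuous_fst
  have e2 : ∀ W, Continuous fun F : V.LeftFam X Y × V.RightFam X Y => F.2.1 W := fun W =>
    (lp.lipschitzWith_one_eval ∞ W).continuous.comp continuous_snd
  have l1 : ∀ W f, Continuous fun F : V.LeftFam X Y × V.RightFam X Y => F.1.1 W f := fun W f =>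
    (e1 W).clm_apply continuous_const
  have l2 : ∀ W f, Continuous fun F : V.LeftFam X Y × V.RightFam X Y => F.2.1 W f := fun W f =>
    (e2 W).clm_apply continuous_const
  refine IsClosed.inter (s₁ := {F | _}) (s₂ := {F | _ ∧ _}) ?_
    (IsClosed.inter (s₁ := {F | _}) (s₂ := {F | _}) ?_ ?_)
  all_goals
    simp only [Set.ofPred_forall]
    refine isClosed_iInter fun W => isClosed_iInter fun Z => isClosed_iInter fun f =>
      isClosed_iInter fun g => isClosed_eq ?_ ?_
  · exact l1 _ _
  · exact V.continuous_comp.comp ((l1 _ _).prodMk continuous_const)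
  · exact l2 _ _
  · exact V.continuous_comp.comp (continuous_const.prodMk (l2 _ _))
  · exact V.continuous_comp.comp (continuous_const.prodMk (l1 _ _))
  · exact V.continuous_comp.comp ((l2 _ _).prodMk continuous_const)

instance : CompleteSpace (V.Mult X Y) :=
  (isClosed_multSub X Y).completeSpace_coe

lemma add_comp (G G' : V.Mult Y Z) (F : V.Mult X Y) :
    comp (G + G') F = comp G F + comp G' F := ext_act fun _ _ => by simp [add_act]
lemma smul_comp (c : ℂ) (G : V.Mult Y Z) (F : V.Mult X Y) : comp (c • G) F = c • comp G F := ext_act fun _ _ => by simp [smul_act]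
lemma comp_add (G : V.Mult Y Z) (F F' : V.Mult X Y) : comp G (F + F') = comp G F + comp G F' :=
  ext_act fun W f => by simp [add_act, act_add]
lemma comp_smul (c : ℂ) (G : V.Mult Y Z) (F : V.Mult X Y) : comp G (c • F) = c • comp G F :=
  ext_act fun W f => by simp [smul_act, act_smul]
lemma adj_add (F G : V.Mult X Y) : adj (F + G) = adj F + adj G :=
  ext_act fun W f => by simp [add_act, add_coact, V.adj_add]
lemma adj_smul (c : ℂ) (F : V.Mult X Y) : adj (c • F) = star c • adj F :=
  ext_act fun W f => by simp [smul_act, smul_coact, V.adj_smul]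

/-- Multiplier morphisms form a category with the structure of a `C*`-category. -/
def pre (V : CStarCat.{u}) : PreCStarCat.{u} where
  Obj := V.Obj
  Hom := V.Mult
  comp := comp
  adj := adj
  comp_assoc := comp_assoc
  adj_adj := adj_adj
  adj_comp := adj_comp
  add_comp := add_comp
  comp_add := comp_add
  smul_comp := smul_comp
  comp_smul := comp_smul
  adj_add := adj_add
  adj_smul := adj_smul
  norm_comp_le := norm_comp_le
  norm_adj_comp := norm_adj_comp

lemma pos (F : V.Mult X Y) : ∃ G : V.Mult X X, comp (adj F) F = comp (adj G) G := by
  let _ : NonUnitalCStarAlgebra (V.Mult X X) := (pre V).endAlgebra X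
  obtain ⟨n, s, hn, hs, h⟩ := exists_neg_cube (comp (adj F) F) (by
    change adj (comp (adj F) F) = _
    rw [adj_comp, adj_adj])
  change adj n = n at hn
  change comp (comp n (comp (adj F) F)) n = -(comp (adj s) s) at hs
  apply h
  refine ext_act fun W f => ?_
  change s.act f = 0
  let _ := V.endAlgebra W
  obtain ⟨c, hc⟩ := V.pos (F.act (n.act f))
  obtain ⟨d, hd⟩ := V.pos (s.act f)
  have e1 : V.comp (V.adj f) ((comp (comp n (comp (adj F) F)) n).act f) =
      V.comp (V.adj c) c := by
    rw [← hc]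
    have e2 : V.comp (V.adj f) ((comp (comp n (comp (adj F) F)) n).act f) =
        V.comp (V.adj (n.act f)) ((comp (adj F) F).act (n.act f)) := by
      nth_rewrite 1 [← hn]
      simp only [comp_act', adj_act]
      rw [← V.adj_comp]
      simp only [← comp_act]
      rw [V.adj_comp, V.adj_adj]
    rw [e2, adj_comp_act]
  rw [hs] at e1
  change V.comp (V.adj f) (-((comp (adj s) s).act f)) = V.comp (V.adj c) c at e1
  have e3 : V.comp (V.adj c) c = -(V.comp (V.adj d) d) := by
    rw [← e1, ← hd, ← adj_comp_act]
    exact map_neg (V.compL W X W (V.adj f)) _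
  have hd0 : d = 0 := eq_zero_of_star_mul_self_eq_neg e3
  apply V.eq_zero_of_adj_comp
  rw [hd, hd0, V.comp_zero]

end Mult

end CStarCat

open CStarCat in
/-- The multiplier category of a `C*`-category. -/
def CStarCat.M (V : CStarCat.{u}) : UCStarCat.{u} where
  toPreCStarCat := Mult.pre V
  pos := Mult.pos
  id := Mult.id
  id_comp := Mult.id_comp
  comp_id := Mult.comp_id
/-! ## Subobject completion -/

namespace CStarCat

variable (V : CStarCat.{u})

/-- Projections in the multiplier category. -/
def IsProj {X : V.Obj} (p : V.Mult X X) : Prop := Mult.comp p p = p ∧ Mult.adj p = p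

/-- Objects of the subobject completion: pairs `(X, p)` with `p` a projection in `M V(X, X)`. -/
structure SplitObj : Type u where
  obj : V.Obj
  proj : V.Mult obj obj
  isProj : V.IsProj proj

/-- Morphisms `(X, p) → (Y, q)`: all `h ∈ V(X, Y)` with `h ∘ p = h = q ∘ h`. -/
def splitSub (X Y : V.SplitObj) : Submodule ℂ (V.Hom X.obj Y.obj) where
  carrier := {h | X.proj.coact h = h ∧ Y.proj.act h = h}
  add_mem' := by
    rintro f g ⟨h1, h2⟩ ⟨k1, k2⟩
    exact ⟨by rw [Mult.coact_add, h1, k1], by rw [Mult.act_add, h2, k2]⟩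
  zero_mem' := ⟨map_zero (X.proj.1.2.1 Y.obj), Mult.act_zero _⟩
  smul_mem' := by
    rintro c f ⟨h1, h2⟩
    exact ⟨by rw [Mult.coact_smul, h1], by rw [Mult.act_smul, h2]⟩

lemma isClosed_splitSub (X Y : V.SplitObj) :
    IsClosed (V.splitSub X Y : Set (V.Hom X.obj Y.obj)) :=
  IsClosed.inter (s₁ := {_h | _}) (s₂ := {_h | _})
    (isClosed_eq (Mult.continuous_coact _) continuous_id)
    (isClosed_eq (Mult.continuous_act _) continuous_id)

/-- The subobject completion, with the structure inherited from `V`. -/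
def preSplit : PreCStarCat.{u} where
  Obj := V.SplitObj
  Hom X Y := V.splitSub X Y
  comp g f := ⟨V.comp g.1 f.1, by
    refine ⟨?_, ?_⟩
    · rw [Mult.coact_comp, f.2.1]
    · rw [Mult.act_comp, g.2.2]⟩
  adj {X Y} f := ⟨V.adj f.1, by
    refine ⟨?_, ?_⟩
    · have := congrArg V.adj f.2.2
      rw [← Y.isProj.2, Mult.adj_act, V.adj_adj] at this
      nth_rewrite 1 [← Y.isProj.2]
      rw [Mult.adj_coact, V.adj_adj, f.2.2]
    · nth_rewrite 1 [← X.isProj.2]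
      rw [Mult.adj_act, V.adj_adj, f.2.1]⟩
  comp_assoc h g f := Subtype.ext (V.comp_assoc h.1 g.1 f.1)
  adj_adj f := Subtype.ext (V.adj_adj f.1)
  adj_comp g f := Subtype.ext (V.adj_comp g.1 f.1)
  normed X Y := inferInstanceAs (NormedAddCommGroup (V.splitSub X Y))
  space X Y := inferInstanceAs (NormedSpace ℂ (V.splitSub X Y))
  complete X Y := (V.isClosed_splitSub X Y).completeSpace_coe
  add_comp g g' f := Subtype.ext (V.add_comp g.1 g'.1 f.1)
  comp_add g f f' := Subtype.ext (V.comp_add g.1 f.1 f'.1)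
  smul_comp c g f := Subtype.ext (V.smul_comp c g.1 f.1)
  comp_smul c g f := Subtype.ext (V.comp_smul c g.1 f.1)
  adj_add f g := Subtype.ext (V.adj_add f.1 g.1)
  adj_smul c f := Subtype.ext (V.adj_smul c f.1)
  norm_comp_le g f := V.norm_comp_le g.1 f.1
  norm_adj_comp f := V.norm_adj_comp f.1

/-- The subobject completion `Split(V)` of a `C*`-category. -/
def split : CStarCat.{u} where
  toPreCStarCat := V.preSplit
  pos {X Y} f := by
    let _ : NonUnitalCStarAlgebra (V.preSplit.Hom X X) := V.preSplit.endAlgebra X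
    let _ : NonUnitalCStarAlgebra (V.Hom X.obj X.obj) := V.endAlgebra X.obj
    let φ : V.preSplit.Hom X X →⋆ₙₐ[ℂ] V.Hom X.obj X.obj :=
      { toFun := fun a => a.1
        map_smul' := fun _ _ => rfl
        map_zero' := rfl
        map_add' := fun _ _ => rfl
        map_mul' := fun _ _ => rfl
        map_star' := fun _ => rfl }
    refine exists_eq_star_mul_self_of_family (fun _ : Unit => φ)
      (fun a ha => Subtype.ext (ha ())) _ ?_ fun _ => V.pos f.1
    exact (V.preSplit.adj_comp _ _).trans (by rw [V.preSplit.adj_adj])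

/-! ## Direct sums, subobjects and countable additivity -/

/-- `S` together with the multiplier morphisms `ι i` is a direct sum of the family `X`:
`ι k* ∘ ι l = δ_{kl} id` and `∑ ι j ∘ ι j* = id`, with convergence in the strict topology. -/
def IsDirectSum {I : Type*} (X : I → V.Obj) (S : V.Obj) (ι : ∀ i, V.Mult (X i) S) : Prop :=
  (∀ k, Mult.comp (Mult.adj (ι k)) (ι k) = Mult.id (X k)) ∧
  (∀ k l, k ≠ l → Mult.comp (Mult.adj (ι k)) (ι l) = 0) ∧
  (∀ (Z : V.Obj) (f : V.Hom Z S),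
    HasSum (fun j => (Mult.comp (ι j) (Mult.adj (ι j))).act f) f) ∧
  (∀ (Z : V.Obj) (g : V.Hom S Z),
    HasSum (fun j => (Mult.comp (ι j) (Mult.adj (ι j))).coact g) g)

/-- Every projection in the multiplier category splits. -/
def IsSubobjectComplete : Prop :=
  ∀ (X : V.Obj) (p : V.Mult X X), V.IsProj p →
    ∃ (U : V.Obj) (ι : V.Mult U X),
      Mult.comp (Mult.adj ι) ι = Mult.id U ∧ Mult.comp ι (Mult.adj ι) = p

/-- Countably additive `C*`-categories: subobject complete, with all countable direct sums. -/
def IsCountablyAdditive : Prop :=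
  V.IsSubobjectComplete ∧
  ∀ (I : Type) [Countable I] (X : I → V.Obj),
    ∃ (S : V.Obj) (ι : ∀ i, V.Mult (X i) S), V.IsDirectSum X S ι

end CStarCat
/-! ## Boundedness of representations of algebraic tensor products -/

section TensorBound

attribute [local instance] CStarAlgebra.spectralOrder CStarAlgebra.spectralOrderedRing

variable {A B C : Type*} [NonUnitalCStarAlgebra A] [NonUnitalCStarAlgebra B]
  [NonUnitalCStarAlgebra C]

lemma exists_bound_left (π : A →ₗ[ℂ] B →ₗ[ℂ] C)
    (hm : ∀ a a' b b', π (a * a') (b * b') = π a b * π a' b')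
    (hs : ∀ a b, π (star a) (star b) = star (π a b)) (b : B) :
    ∃ K : ℝ, 0 ≤ K ∧ ∀ a, ‖π a b‖ ≤ K * ‖a‖ := by
  let φ : A →ₚ[ℂ] C := PositiveLinearMap.mk₀ (π.flip (star b * b)) (by
    intro a ha
    obtain ⟨c, rfl⟩ := CStarAlgebra.nonneg_iff_eq_star_mul_self.1 ha
    rw [LinearMap.flip_apply, hm, hs]
    exact star_mul_self_nonneg _)
  obtain ⟨K, hK⟩ := PositiveLinearMap.exists_norm_apply_le φ
  refine ⟨Real.sqrt K, Real.sqrt_nonneg _, fun a => ?_⟩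
  have h1 : ‖π a b‖ ^ 2 ≤ K * ‖a‖ ^ 2 := by
    have := hK (star a * a)
    change ‖π (star a * a) (star b * b)‖ ≤ _ at this
    rw [hm, hs, CStarRing.norm_star_mul_self, CStarRing.norm_star_mul_self] at this
    simpa [sq] using this
  calc ‖π a b‖ = Real.sqrt (‖π a b‖ ^ 2) := (Real.sqrt_sq (norm_nonneg _)).symm
    _ ≤ Real.sqrt (K * ‖a‖ ^ 2) := Real.sqrt_le_sqrt h1
    _ = _ := by rw [Real.sqrt_mul (NNReal.coe_nonneg K), Real.sqrt_sq (norm_nonneg _)]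

lemma exists_bound (π : A →ₗ[ℂ] B →ₗ[ℂ] C)
    (hm : ∀ a a' b b', π (a * a') (b * b') = π a b * π a' b')
    (hs : ∀ a b, π (star a) (star b) = star (π a b)) :
    ∃ K : ℝ, 0 ≤ K ∧ ∀ a b, ‖π a b‖ ≤ K * (‖a‖ * ‖b‖) := by
  choose K hK0 hK using exists_bound_left π hm hs
  choose K' hK0' hK' using exists_bound_left π.flip (fun b b' a a' => hm a a' b b')
    (fun b a => hs a b)
  let g : B → A →L[ℂ] C := fun b => (π.flip b).mkContinuous (K b) (hK b)
  obtain ⟨M, hM⟩ := banach_steinhaus (g := fun b : Metric.closedBall (0 : B) 1 => g b.1)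
    (fun a => ⟨K' a, fun b => (hK' a b.1).trans (by
      have := mem_closedBall_zero_iff.1 b.2
      nlinarith [hK0' a])⟩)
  refine ⟨max M 0, le_max_right _ _, fun a b => ?_⟩
  rcases eq_or_ne b 0 with rfl | hb
  · simp
  have hb' : 0 < ‖b‖ := norm_pos_iff.2 hb
  have h1 := hM ⟨((‖b‖⁻¹ : ℝ) : ℂ) • b, by
    rw [mem_closedBall_zero_iff, norm_smul, Complex.norm_real, norm_inv, norm_norm,
      inv_mul_cancel₀ hb'.ne']⟩
  have h2 := (g (((‖b‖⁻¹ : ℝ) : ℂ) • b)).le_opNorm a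
  change ‖π a (((‖b‖⁻¹ : ℝ) : ℂ) • b)‖ ≤ _ at h2
  rw [map_smul, norm_smul, Complex.norm_real, norm_inv, norm_norm] at h2
  have h3 : ‖b‖⁻¹ * ‖π a b‖ ≤ max M 0 * ‖a‖ :=
    h2.trans (by gcongr; exact h1.trans (le_max_left _ _))
  rw [inv_mul_le_iff₀ hb'] at h3
  linarith

lemma norm_bilin_le (π : A →ₗ[ℂ] B →ₗ[ℂ] C)
    (hm : ∀ a a' b b', π (a * a') (b * b') = π a b * π a' b')
    (hs : ∀ a b, π (star a) (star b) = star (π a b)) (a : A) (b : B) :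
    ‖π a b‖ ≤ ‖a‖ * ‖b‖ := by
  obtain ⟨K, hK0, hK⟩ := exists_bound π hm hs
  have key : ∀ (n : ℕ) (a : A) (b : B), ‖π a b‖ ^ (2 ^ (n + 1)) ≤
      K * (‖a‖ * ‖b‖) ^ (2 ^ (n + 1)) := by
    intro n
    induction n with
    | zero =>
      intro a b
      have := hK (star a * a) (star b * b)
      rw [hm, hs, CStarRing.norm_star_mul_self, CStarRing.norm_star_mul_self,
        CStarRing.norm_star_mul_self] at this
      simp only [zero_add, pow_one]
      nlinarith
    | succ n ih =>
      intro a b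
      have := ih (star a * a) (star b * b)
      rw [hm, hs, CStarRing.norm_star_mul_self, CStarRing.norm_star_mul_self,
        CStarRing.norm_star_mul_self] at this
      have e : (2 : ℕ) ^ (n + 1 + 1) = 2 * 2 ^ (n + 1) := by ring
      rw [e, pow_mul, pow_mul]
      convert this using 2
      · rw [sq]
      · congr 1; ring
  by_contra hlt
  push Not at hlt
  set r := ‖π a b‖
  set s := ‖a‖ * ‖b‖
  have hs0 : 0 ≤ s := by positivity
  have hr : 0 < r := lt_of_le_of_lt hs0 hlt
  have hq : s / r < 1 := (div_lt_one hr).2 hlt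
  have hq0 : 0 ≤ s / r := by positivity
  have hb : ∀ n : ℕ, 1 ≤ K * (s / r) ^ (2 ^ (n + 1)) := fun n => by
    rw [div_pow, ← mul_div_assoc, le_div_iff₀ (by positivity), one_mul]
    exact key n a b
  have ht : Tendsto (fun n : ℕ => K * (s / r) ^ (2 ^ (n + 1))) atTop (𝓝 (K * 0)) := by
    refine Tendsto.const_mul K ((tendsto_pow_atTop_nhds_zero_of_lt_one hq0 hq).comp ?_)
    exact (tendsto_pow_atTop_atTop_of_one_lt one_lt_two).comp (tendsto_add_atTop_nat 1)
  have := ge_of_tendsto' ht hb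
  linarith

end TensorBound

/-! ## The maximal tensor product -/

namespace CStarCat

/-- A nondegenerate linear `*`-functor from the algebraic tensor product of `V₁` and `V₂` to the
category of Hilbert spaces and bounded operators, given by its values on elementary tensors. -/
structure TensorRep (V₁ V₂ : CStarCat.{u}) where
  space : V₁.Obj × V₂.Obj → Type u
  [normed : ∀ X, NormedAddCommGroup (space X)]
  [inner : ∀ X, InnerProductSpace ℂ (space X)]
  [complete : ∀ X, CompleteSpace (space X)]
  map : ∀ {X Y : V₁.Obj × V₂.Obj},
    V₁.Hom X.1 Y.1 →ₗ[ℂ] V₂.Hom X.2 Y.2 →ₗ[ℂ] (space X →L[ℂ] space Y)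
  map_comp : ∀ {X Y Z : V₁.Obj × V₂.Obj} (g₁ : V₁.Hom Y.1 Z.1) (g₂ : V₂.Hom Y.2 Z.2)
    (f₁ : V₁.Hom X.1 Y.1) (f₂ : V₂.Hom X.2 Y.2),
    (map (V₁.comp g₁ f₁) (V₂.comp g₂ f₂) : space X →L[ℂ] space Z) = (map g₁ g₂).comp (map f₁ f₂)
  map_adj : ∀ {X Y : V₁.Obj × V₂.Obj} (f₁ : V₁.Hom X.1 Y.1) (f₂ : V₂.Hom X.2 Y.2),
    (map (V₁.adj f₁) (V₂.adj f₂) : space Y →L[ℂ] space X) =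
      ContinuousLinearMap.adjoint (map f₁ f₂)
  nondeg : ∀ X : V₁.Obj × V₂.Obj, Dense (Submodule.span ℂ
    {v : space X | ∃ (f₁ : V₁.Hom X.1 X.1) (f₂ : V₂.Hom X.2 X.2) (w : space X),
      v = (map f₁ f₂ : space X →L[ℂ] space X) w} : Set (space X))

attribute [instance] TensorRep.normed TensorRep.inner TensorRep.complete

variable {V₁ V₂ : CStarCat.{u}}

namespace TensorRep

variable (π : TensorRep V₁ V₂) {X Y Z : V₁.Obj × V₂.Obj}

lemma norm_map_le (f₁ : V₁.Hom X.1 Y.1) (f₂ : V₂.Hom X.2 Y.2) :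
    ‖(π.map f₁ f₂ : π.space X →L[ℂ] π.space Y)‖ ≤ ‖f₁‖ * ‖f₂‖ := by
  let _ := V₁.endAlgebra X.1
  let _ := V₂.endAlgebra X.2
  have h := norm_bilin_le (π.map (X := X) (Y := X)) (fun a a' b b' => π.map_comp a b a' b')
    (fun a b => π.map_adj a b) (V₁.comp (V₁.adj f₁) f₁) (V₂.comp (V₂.adj f₂) f₂)
  rw [π.map_comp (Y := Y), π.map_adj, V₁.norm_adj_comp, V₂.norm_adj_comp,
    ContinuousLinearMap.norm_adjoint_comp_self, ← sq, ← mul_pow] at h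
  exact (pow_le_pow_iff_left₀ (norm_nonneg _) (by positivity) two_ne_zero).1 h

end TensorRep

/-- Morphism spaces of the algebraic tensor product. -/
def AlgHom (V₁ V₂ : CStarCat.{u}) (X Y : V₁.Obj × V₂.Obj) : Type u :=
  V₁.Hom X.1 Y.1 ⊗[ℂ] V₂.Hom X.2 Y.2

namespace AlgHom

variable {X Y Z : V₁.Obj × V₂.Obj}

instance : AddCommGroup (AlgHom V₁ V₂ X Y) :=
  inferInstanceAs (AddCommGroup (V₁.Hom X.1 Y.1 ⊗[ℂ] V₂.Hom X.2 Y.2))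
instance : Module ℂ (AlgHom V₁ V₂ X Y) :=
  inferInstanceAs (Module ℂ (V₁.Hom X.1 Y.1 ⊗[ℂ] V₂.Hom X.2 Y.2))

/-- Elementary tensors. -/
def tmul (f₁ : V₁.Hom X.1 Y.1) (f₂ : V₂.Hom X.2 Y.2) : AlgHom V₁ V₂ X Y := f₁ ⊗ₜ[ℂ] f₂

@[elab_as_elim]
lemma induction {p : AlgHom V₁ V₂ X Y → Prop} (t : AlgHom V₁ V₂ X Y) (h0 : p 0)
    (h1 : ∀ f₁ f₂, p (tmul f₁ f₂)) (h2 : ∀ s t, p s → p t → p (s + t)) : p t :=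
  TensorProduct.induction_on t h0 h1 h2

/-- Composition, `(g₁ ⊗ g₂) ∘ (f₁ ⊗ f₂) = (g₁ ∘ f₁) ⊗ (g₂ ∘ f₂)`. -/
def comp : AlgHom V₁ V₂ Y Z →ₗ[ℂ] AlgHom V₁ V₂ X Y →ₗ[ℂ] AlgHom V₁ V₂ X Z :=
  TensorProduct.map₂
    (LinearMap.mk₂ ℂ V₁.comp V₁.add_comp V₁.smul_comp V₁.comp_add fun c g f => V₁.comp_smul c g f)
    (LinearMap.mk₂ ℂ V₂.comp V₂.add_comp V₂.smul_comp V₂.comp_add fun c g f => V₂.comp_smul c g f)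

/-- The involution, `(f₁ ⊗ f₂)* = f₁* ⊗ f₂*`. -/
def adj : AlgHom V₁ V₂ X Y →ₛₗ[starRingEnd ℂ] AlgHom V₁ V₂ Y X :=
  TensorProduct.map (V₁.adjL X.1 Y.1) (V₂.adjL X.2 Y.2)

/-- The linear `*`-functor defined by a representation. -/
def rep (π : TensorRep V₁ V₂) : AlgHom V₁ V₂ X Y →ₗ[ℂ] (π.space X →L[ℂ] π.space Y) :=
  TensorProduct.lift π.map

@[simp] lemma comp_tmul (g₁ : V₁.Hom Y.1 Z.1) (g₂ : V₂.Hom Y.2 Z.2) (f₁ : V₁.Hom X.1 Y.1)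
    (f₂ : V₂.Hom X.2 Y.2) :
    comp (tmul g₁ g₂) (tmul f₁ f₂) = tmul (V₁.comp g₁ f₁) (V₂.comp g₂ f₂) := rfl
@[simp] lemma adj_tmul (f₁ : V₁.Hom X.1 Y.1) (f₂ : V₂.Hom X.2 Y.2) :
    adj (tmul f₁ f₂) = tmul (V₁.adj f₁) (V₂.adj f₂) := rfl
@[simp] lemma rep_tmul (π : TensorRep V₁ V₂) (f₁ : V₁.Hom X.1 Y.1) (f₂ : V₂.Hom X.2 Y.2) :
    rep π (tmul f₁ f₂) = π.map f₁ f₂ := rfl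

lemma comp_assoc {W : V₁.Obj × V₂.Obj} (h : AlgHom V₁ V₂ Y Z) (g : AlgHom V₁ V₂ X Y)
    (f : AlgHom V₁ V₂ W X) : comp (comp h g) f = comp h (comp g f) := by
  induction h using induction with
  | h0 => simp
  | h2 s t hs ht => simp [hs, ht]
  | h1 h₁ h₂ =>
    induction g using induction with
    | h0 => simp
    | h2 s t hs ht => simp [hs, ht]
    | h1 g₁ g₂ =>
      induction f using induction with
      | h0 => simp
      | h2 s t hs ht => rw [map_add, map_add, map_add, hs, ht]
      | h1 f₁ f₂ => simp [V₁.comp_assoc, V₂.comp_assoc]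

lemma adj_adj (f : AlgHom V₁ V₂ X Y) : adj (adj f) = f := by
  induction f using induction with
  | h0 => simp
  | h2 s t hs ht => simp [hs, ht]
  | h1 f₁ f₂ => simp [V₁.adj_adj, V₂.adj_adj]

lemma adj_comp (g : AlgHom V₁ V₂ Y Z) (f : AlgHom V₁ V₂ X Y) :
    adj (comp g f) = comp (adj f) (adj g) := by
  induction g using induction with
  | h0 => simp
  | h2 s t hs ht => simp [hs, ht]
  | h1 g₁ g₂ =>
    induction f using induction with
    | h0 => simp
    | h2 s t hs ht => simp [hs, ht]
    | h1 f₁ f₂ => simp [V₁.adj_comp, V₂.adj_comp]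

variable (π : TensorRep V₁ V₂)

lemma rep_comp (g : AlgHom V₁ V₂ Y Z) (f : AlgHom V₁ V₂ X Y) :
    rep π (comp g f) = (rep π g).comp (rep π f) := by
  induction g using induction with
  | h0 => simp
  | h2 s t hs ht => simp [hs, ht]
  | h1 g₁ g₂ =>
    induction f using induction with
    | h0 => simp
    | h2 s t hs ht => simp [hs, ht]
    | h1 f₁ f₂ => simp [π.map_comp]

lemma rep_adj (f : AlgHom V₁ V₂ X Y) :
    rep π (adj f) = ContinuousLinearMap.adjoint (rep π f) := by
  induction f using induction with
  | h0 => simp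
  | h2 s t hs ht => simp [hs, ht]
  | h1 f₁ f₂ => simp [π.map_adj]

/-- The maximal norm: the supremum of `‖π(t)‖` over all nondegenerate linear `*`-functors `π` to
Hilbert spaces. -/
def maxNorm (t : AlgHom V₁ V₂ X Y) : ℝ := ⨆ π : TensorRep V₁ V₂, ‖rep π t‖

lemma bddAbove (t : AlgHom V₁ V₂ X Y) :
    BddAbove (Set.range fun π : TensorRep V₁ V₂ => ‖rep π t‖) := by
  suffices h : ∃ C, ∀ π : TensorRep V₁ V₂, ‖rep π t‖ ≤ C by
    obtain ⟨C, hC⟩ := h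
    exact ⟨C, by rintro _ ⟨π, rfl⟩; exact hC π⟩
  induction t using induction with
  | h0 => exact ⟨0, fun π => by simp⟩
  | h1 f₁ f₂ => exact ⟨‖f₁‖ * ‖f₂‖, fun π => by simpa using π.norm_map_le f₁ f₂⟩
  | h2 s t hs ht =>
    obtain ⟨C, hC⟩ := hs
    obtain ⟨D, hD⟩ := ht
    exact ⟨C + D, fun π => by
      rw [map_add]; exact (norm_add_le _ _).trans (add_le_add (hC π) (hD π))⟩

lemma norm_rep_le (t : AlgHom V₁ V₂ X Y) : ‖rep π t‖ ≤ maxNorm t := le_ciSup (bddAbove t) π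

lemma maxNorm_nonneg (t : AlgHom V₁ V₂ X Y) : 0 ≤ maxNorm t :=
  Real.iSup_nonneg fun _ => norm_nonneg _

lemma maxNorm_le {t : AlgHom V₁ V₂ X Y} {C : ℝ} (hC : 0 ≤ C)
    (h : ∀ π : TensorRep V₁ V₂, ‖rep π t‖ ≤ C) : maxNorm t ≤ C := Real.iSup_le h hC

instance : SeminormedAddCommGroup (AlgHom V₁ V₂ X Y) :=
  { AddGroupSeminorm.toSeminormedAddCommGroup
      { toFun := maxNorm (X := X) (Y := Y)
        map_zero' := le_antisymm (maxNorm_le le_rfl fun π => by simp) (maxNorm_nonneg _)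
        add_le' := fun s t => maxNorm_le (add_nonneg (maxNorm_nonneg _) (maxNorm_nonneg _))
          fun π => by
            rw [map_add]
            exact (norm_add_le _ _).trans (add_le_add (norm_rep_le π s) (norm_rep_le π t))
        neg' := fun t => by simp [maxNorm] } with }

lemma norm_def (t : AlgHom V₁ V₂ X Y) : ‖t‖ = maxNorm t := rfl

instance : NormedSpace ℂ (AlgHom V₁ V₂ X Y) where
  norm_smul_le c t := maxNorm_le (mul_nonneg (norm_nonneg _) (maxNorm_nonneg _)) fun π => by
    rw [map_smul, norm_smul]
    exact mul_le_mul_of_nonneg_left (norm_rep_le π t) (norm_nonneg _)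

lemma norm_comp_le (g : AlgHom V₁ V₂ Y Z) (f : AlgHom V₁ V₂ X Y) : ‖comp g f‖ ≤ ‖g‖ * ‖f‖ :=
  maxNorm_le (mul_nonneg (norm_nonneg _) (norm_nonneg _)) fun π => by
    rw [rep_comp]
    exact (ContinuousLinearMap.opNorm_comp_le _ _).trans
      (mul_le_mul (norm_rep_le π g) (norm_rep_le π f) (norm_nonneg _) (norm_nonneg _))

lemma norm_adj (f : AlgHom V₁ V₂ X Y) : ‖adj f‖ = ‖f‖ := by
  change maxNorm _ = maxNorm _
  simp [maxNorm, rep_adj]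

lemma norm_adj_comp (f : AlgHom V₁ V₂ X Y) : ‖comp (adj f) f‖ = ‖f‖ ^ 2 := by
  apply le_antisymm
  · rw [sq]
    exact (norm_comp_le _ _).trans_eq (by rw [norm_adj])
  · have : ‖f‖ ≤ Real.sqrt ‖comp (adj f) f‖ := by
      refine maxNorm_le (Real.sqrt_nonneg _) fun π => Real.le_sqrt_of_sq_le ?_
      rw [sq, ← ContinuousLinearMap.norm_adjoint_comp_self, ← rep_adj, ← rep_comp]
      exact norm_rep_le π _
    calc ‖f‖ ^ 2 ≤ (Real.sqrt ‖comp (adj f) f‖) ^ 2 := by gcongr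
      _ = _ := Real.sq_sqrt (norm_nonneg _)

end AlgHom

/-- Morphism spaces of the maximal tensor product: completions for the maximal norm. -/
abbrev MaxHom (V₁ V₂ : CStarCat.{u}) (X Y : V₁.Obj × V₂.Obj) : Type u :=
  UniformSpace.Completion (AlgHom V₁ V₂ X Y)

namespace MaxHom

open UniformSpace

variable {X Y Z : V₁.Obj × V₂.Obj}

/-- The canonical map to the completion. -/
def ofAlg : AlgHom V₁ V₂ X Y →ₗ[ℂ] MaxHom V₁ V₂ X Y := (Completion.toComplₗᵢ (𝕜 := ℂ)).toLinearMap

lemma norm_ofAlg (t : AlgHom V₁ V₂ X Y) : ‖ofAlg t‖ = ‖t‖ := Completion.norm_coe t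

lemma dense_ofAlg : DenseRange (ofAlg : AlgHom V₁ V₂ X Y → MaxHom V₁ V₂ X Y) :=
  Completion.denseRange_coe

@[elab_as_elim]
lemma induction {p : MaxHom V₁ V₂ X Y → Prop} (a : MaxHom V₁ V₂ X Y) (hp : IsClosed {a | p a})
    (h : ∀ t, p (ofAlg t)) : p a := Completion.induction_on a hp h

lemma exists_bound_comp (g : AlgHom V₁ V₂ Y Z) :
    ∃ C, ∀ f : AlgHom V₁ V₂ X Y, ‖(ofAlg ∘ₗ AlgHom.comp g) f‖ ≤ C * ‖ofAlg f‖ :=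
  ⟨‖g‖, fun f => by
    rw [LinearMap.comp_apply, norm_ofAlg, norm_ofAlg]; exact AlgHom.norm_comp_le g f⟩

/-- Left composition with a morphism of the algebraic tensor product, extended by continuity. -/
def compExt (g : AlgHom V₁ V₂ Y Z) : MaxHom V₁ V₂ X Y →L[ℂ] MaxHom V₁ V₂ X Z :=
  LinearMap.extendOfNorm (ofAlg ∘ₗ AlgHom.comp g) ofAlg

lemma compExt_ofAlg (g : AlgHom V₁ V₂ Y Z) (f : AlgHom V₁ V₂ X Y) :
    compExt g (ofAlg f) = ofAlg (AlgHom.comp g f) :=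
  LinearMap.extendOfNorm_eq dense_ofAlg (exists_bound_comp _) f

lemma norm_compExt_le (g : AlgHom V₁ V₂ Y Z) :
    ‖(compExt g : MaxHom V₁ V₂ X Y →L[ℂ] MaxHom V₁ V₂ X Z)‖ ≤ 1 * ‖ofAlg g‖ := by
  refine LinearMap.opNorm_extendOfNorm_le dense_ofAlg (by positivity) fun f => ?_
  rw [one_mul, LinearMap.comp_apply, norm_ofAlg, norm_ofAlg, norm_ofAlg]
  exact AlgHom.norm_comp_le g f

lemma clm_ext {E : Type*} [NormedAddCommGroup E] [NormedSpace ℂ E]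
    {S T : MaxHom V₁ V₂ X Y →L[ℂ] E} (h : ∀ f, S (ofAlg f) = T (ofAlg f)) : S = T :=
  ContinuousLinearMap.ext fun a =>
    induction a (isClosed_eq S.continuous T.continuous) h

/-- `compExt` as a linear map. -/
def compAlg : AlgHom V₁ V₂ Y Z →ₗ[ℂ] MaxHom V₁ V₂ X Y →L[ℂ] MaxHom V₁ V₂ X Z where
  toFun := compExt
  map_add' g g' := clm_ext fun f => by
    rw [add_apply, compExt_ofAlg, compExt_ofAlg, compExt_ofAlg, map_add, LinearMap.add_apply,
      map_add]
  map_smul' c g := clm_ext fun f => by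
    rw [RingHom.id_apply, smul_apply, compExt_ofAlg, compExt_ofAlg, map_smul,
      LinearMap.smul_apply, map_smul]

/-- Composition, extended by continuity. -/
def compL : MaxHom V₁ V₂ Y Z →L[ℂ] MaxHom V₁ V₂ X Y →L[ℂ] MaxHom V₁ V₂ X Z :=
  LinearMap.extendOfNorm compAlg ofAlg

lemma compL_ofAlg (g : AlgHom V₁ V₂ Y Z) (f : AlgHom V₁ V₂ X Y) :
    compL (ofAlg g) (ofAlg f) = ofAlg (AlgHom.comp g f) := by
  rw [compL, LinearMap.extendOfNorm_eq dense_ofAlg ⟨1, norm_compExt_le⟩]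
  exact compExt_ofAlg g f

lemma exists_bound_adj :
    ∃ C, ∀ f : AlgHom V₁ V₂ X Y, ‖(ofAlg.comp AlgHom.adj) f‖ ≤ C * ‖ofAlg f‖ :=
  ⟨1, fun f => by rw [LinearMap.comp_apply, norm_ofAlg, norm_ofAlg, AlgHom.norm_adj, one_mul]⟩

/-- The involution, extended by continuity. -/
def adjL : MaxHom V₁ V₂ X Y →SL[starRingEnd ℂ] MaxHom V₁ V₂ Y X :=
  LinearMap.extendOfNorm (ofAlg.comp AlgHom.adj) ofAlg

lemma adjL_ofAlg (f : AlgHom V₁ V₂ X Y) : adjL (ofAlg f) = ofAlg (AlgHom.adj f) :=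
  LinearMap.extendOfNorm_eq dense_ofAlg exists_bound_adj f

/-- The extension of a representation to the completion. -/
def rep (π : TensorRep V₁ V₂) : MaxHom V₁ V₂ X Y →L[ℂ] (π.space X →L[ℂ] π.space Y) :=
  LinearMap.extendOfNorm (AlgHom.rep π) ofAlg

variable (π : TensorRep V₁ V₂)

lemma rep_ofAlg (f : AlgHom V₁ V₂ X Y) : rep π (ofAlg f) = AlgHom.rep π f :=
  LinearMap.extendOfNorm_eq dense_ofAlg ⟨1, fun f => by
    rw [one_mul, norm_ofAlg]; exact AlgHom.norm_rep_le π f⟩ f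

lemma rep_zero : rep π (0 : MaxHom V₁ V₂ X Y) = 0 := map_zero (rep π)

lemma norm_rep_le (a : MaxHom V₁ V₂ X Y) : ‖rep π a‖ ≤ ‖a‖ := by
  have := LinearMap.norm_extendOfNorm_apply_le (f := AlgHom.rep π) dense_ofAlg 1 (fun f => by
    rw [one_mul, norm_ofAlg]; exact AlgHom.norm_rep_le π f) a
  rwa [one_mul] at this

lemma rep_comp (g : MaxHom V₁ V₂ Y Z) (f : MaxHom V₁ V₂ X Y) :
    rep π (compL g f) = (rep π g).comp (rep π f) := by
  induction g using induction with
  | hp =>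
    exact isClosed_eq ((rep π).continuous.comp (compL.continuous.clm_apply continuous_const))
      ((rep π).continuous.clm_comp continuous_const)
  | h g =>
    induction f using induction with
    | hp =>
      exact isClosed_eq ((rep π).continuous.comp (compL (ofAlg g)).continuous)
        (continuous_const.clm_comp (rep π).continuous)
    | h f => rw [compL_ofAlg, rep_ofAlg, rep_ofAlg, rep_ofAlg, AlgHom.rep_comp]

lemma rep_adj (f : MaxHom V₁ V₂ X Y) :
    rep π (adjL f) = ContinuousLinearMap.adjoint (rep π f) := by
  induction f using induction with
  | hp =>
    exact isClosed_eq ((rep π).continuous.comp adjL.continuous)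
      (ContinuousLinearMap.adjoint.continuous.comp (rep π).continuous)
  | h f => rw [adjL_ofAlg, rep_ofAlg, rep_ofAlg, AlgHom.rep_adj]

lemma norm_le {f : MaxHom V₁ V₂ X Y} {C : ℝ} (hC : 0 ≤ C)
    (h : ∀ π : TensorRep V₁ V₂, ‖rep π f‖ ≤ C) : ‖f‖ ≤ C := by
  refine le_of_forall_pos_le_add fun r hr => ?_
  obtain ⟨t, ht⟩ := Metric.denseRange_iff.1 dense_ofAlg f (r / 2) (by positivity)
  rw [dist_eq_norm] at ht
  have h1 : ‖ofAlg t‖ ≤ C + r / 2 := by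
    rw [norm_ofAlg]
    refine AlgHom.maxNorm_le (by positivity) fun π => ?_
    have h2 : ‖rep π (f - ofAlg t)‖ ≤ r / 2 := (norm_rep_le π _).trans ht.le
    rw [map_sub, rep_ofAlg] at h2
    have h3 := norm_sub_norm_le (AlgHom.rep π t) (rep π f)
    rw [norm_sub_rev] at h3
    linarith [h π]
  have h4 := norm_sub_norm_le f (ofAlg t)
  linarith

lemma eq_of_rep {f g : MaxHom V₁ V₂ X Y} (h : ∀ π : TensorRep V₁ V₂, rep π f = rep π g) :
    f = g := by
  rw [← sub_eq_zero, ← norm_le_zero_iff]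
  exact norm_le le_rfl fun π => by simp [h]

lemma norm_comp_le (g : MaxHom V₁ V₂ Y Z) (f : MaxHom V₁ V₂ X Y) :
    ‖compL g f‖ ≤ ‖g‖ * ‖f‖ :=
  norm_le (by positivity) fun π => by
    rw [rep_comp]
    exact (ContinuousLinearMap.opNorm_comp_le _ _).trans
      (mul_le_mul (norm_rep_le π g) (norm_rep_le π f) (norm_nonneg _) (norm_nonneg _))

lemma norm_adj_le (f : MaxHom V₁ V₂ X Y) : ‖adjL f‖ ≤ ‖f‖ :=
  norm_le (by positivity) fun π => by
    rw [rep_adj, LinearIsometryEquiv.norm_map]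
    exact norm_rep_le π f

lemma norm_adj_comp (f : MaxHom V₁ V₂ X Y) : ‖compL (adjL f) f‖ = ‖f‖ ^ 2 := by
  apply le_antisymm
  · rw [sq]
    exact (norm_comp_le _ _).trans (by gcongr; exact norm_adj_le f)
  · have : ‖f‖ ≤ Real.sqrt ‖compL (adjL f) f‖ := by
      refine norm_le (Real.sqrt_nonneg _) fun π => Real.le_sqrt_of_sq_le ?_
      rw [sq, ← ContinuousLinearMap.norm_adjoint_comp_self, ← rep_adj, ← rep_comp]
      exact norm_rep_le π _
    calc ‖f‖ ^ 2 ≤ (Real.sqrt ‖compL (adjL f) f‖) ^ 2 := by gcongr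
      _ = _ := Real.sq_sqrt (norm_nonneg _)

end MaxHom

/-- The maximal tensor product, without positivity. -/
def preMaxTensor (V₁ V₂ : CStarCat.{u}) : PreCStarCat.{u} where
  Obj := V₁.Obj × V₂.Obj
  Hom := MaxHom V₁ V₂
  comp g f := MaxHom.compL g f
  adj f := MaxHom.adjL f
  comp_assoc h g f := MaxHom.eq_of_rep fun π => by
    simp only [MaxHom.rep_comp, ContinuousLinearMap.comp_assoc]
  adj_adj f := MaxHom.eq_of_rep fun π => by
    simp only [MaxHom.rep_adj, ContinuousLinearMap.adjoint_adjoint]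
  adj_comp g f := MaxHom.eq_of_rep fun π => by
    simp only [MaxHom.rep_adj, MaxHom.rep_comp, ContinuousLinearMap.adjoint_comp]
  add_comp g g' f := by rw [map_add, add_apply]
  comp_add g f f' := map_add _ _ _
  smul_comp c g f := by rw [map_smul, smul_apply]
  comp_smul c g f := map_smul _ _ _
  adj_add f g := map_add _ _ _
  adj_smul c f := map_smulₛₗ _ _ _
  norm_comp_le := MaxHom.norm_comp_le
  norm_adj_comp := MaxHom.norm_adj_comp

lemma MaxHom.pos {X Y : V₁.Obj × V₂.Obj} (f : MaxHom V₁ V₂ X Y) : ∃ g : MaxHom V₁ V₂ X X,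
    MaxHom.compL (MaxHom.adjL f) f = MaxHom.compL (MaxHom.adjL g) g := by
  let _ : NonUnitalCStarAlgebra (MaxHom V₁ V₂ X X) := (preMaxTensor V₁ V₂).endAlgebra X
  let φ : ∀ π : TensorRep V₁ V₂, MaxHom V₁ V₂ X X →⋆ₙₐ[ℂ] (π.space X →L[ℂ] π.space X) := fun π =>
    { toFun := fun a => MaxHom.rep π a
      map_smul' := fun c a => map_smul (MaxHom.rep π) c a
      map_zero' := MaxHom.rep_zero π
      map_add' := map_add (MaxHom.rep π)
      map_mul' := fun a b => MaxHom.rep_comp π a b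
      map_star' := fun a => MaxHom.rep_adj π a }
  refine exists_eq_star_mul_self_of_family φ (fun a ha => MaxHom.eq_of_rep fun π => ?_) _ ?_
    fun π => ?_
  · exact (ha π).trans (MaxHom.rep_zero π).symm
  · exact ((preMaxTensor V₁ V₂).adj_comp (X := X) (Y := Y) (Z := X) (MaxHom.adjL f) f).trans
      (congrArg (fun h => MaxHom.compL (MaxHom.adjL f) h) ((preMaxTensor V₁ V₂).adj_adj f))
  · change ∃ b, MaxHom.rep π (MaxHom.compL (MaxHom.adjL f) f) = star b * b
    rw [MaxHom.rep_comp, MaxHom.rep_adj]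
    refine CStarAlgebra.nonneg_iff_eq_star_mul_self.1 ?_
    rw [ContinuousLinearMap.nonneg_iff_isPositive]
    exact ContinuousLinearMap.isPositive_adjoint_comp_self _

/-- The maximal tensor product `V₁ ⊡_max V₂` of `C*`-categories: pairs of objects, and the
completions of the algebraic tensor products of morphism spaces for the maximal norm. -/
def maxTensor (V₁ V₂ : CStarCat.{u}) : CStarCat.{u} where
  toPreCStarCat := preMaxTensor V₁ V₂
  pos f := MaxHom.pos f

/-- The maximal tensor product `V₁ ⊠_max V₂` of countably additive `C*`-categories: the subobject
completion of `V₁ ⊡_max V₂`. -/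
def boxMax (V₁ V₂ : CStarCat.{u}) : CStarCat.{u} := (maxTensor V₁ V₂).split

end CStarCat
/-! ## `*`-functors with values in multiplier categories -/

/-- A `*`-functor between semicategories with involution. -/
structure StarSemiFunctor (C D : StarSemicat.{u}) where
  obj : C.Obj → D.Obj
  map : ∀ {X Y : C.Obj}, C.Hom X Y → D.Hom (obj X) (obj Y)
  map_comp : ∀ {X Y Z : C.Obj} (g : C.Hom Y Z) (f : C.Hom X Y),
    map (C.comp g f) = D.comp (map g) (map f)
  map_adj : ∀ {X Y : C.Obj} (f : C.Hom X Y), map (C.adj f) = D.adj (map f)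

open CStarCat

/-- A `*`-functor `D → M W` into the multiplier category of `W`. -/
structure StarFunctor (D : StarSemicat.{u}) (W : CStarCat.{u}) where
  obj : D.Obj → W.Obj
  map : ∀ {X Y : D.Obj}, D.Hom X Y → W.Mult (obj X) (obj Y)
  map_comp : ∀ {X Y Z : D.Obj} (g : D.Hom Y Z) (f : D.Hom X Y),
    map (D.comp g f) = Mult.comp (map g) (map f)
  map_adj : ∀ {X Y : D.Obj} (f : D.Hom X Y), map (D.adj f) = Mult.adj (map f)

namespace StarFunctor

variable {D : StarSemicat.{u}} {V W : CStarCat.{u}}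

/-- Nondegeneracy: `[F(D(Y, Y)) ∘ W(F X, F Y)] = W(F X, F Y) = [W(F X, F Y) ∘ F(D(X, X))]`, with
closed linear spans. -/
def Nondegenerate (F : StarFunctor D W) : Prop :=
  ∀ X Y : D.Obj,
    Dense (Submodule.span ℂ {w : W.Hom (F.obj X) (F.obj Y) |
      ∃ (f : D.Hom Y Y) (v : W.Hom (F.obj X) (F.obj Y)), w = (F.map f).act v} :
        Set (W.Hom (F.obj X) (F.obj Y))) ∧
    Dense (Submodule.span ℂ {w : W.Hom (F.obj X) (F.obj Y) |
      ∃ (v : W.Hom (F.obj X) (F.obj Y)) (f : D.Hom X X), w = (F.map f).coact v} :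
        Set (W.Hom (F.obj X) (F.obj Y)))

/-- Linearity on morphism spaces. -/
def IsLinear (F : StarFunctor V.toStarSemicat W) : Prop :=
  (∀ {X Y : V.Obj} (f g : V.Hom X Y), F.map (f + g) = F.map f + F.map g) ∧
  (∀ {X Y : V.Obj} (c : ℂ) (f : V.Hom X Y), F.map (c • f) = c • F.map f)

/-- Bilinearity on morphism spaces. -/
def IsBilinear {V₁ V₂ : CStarCat.{u}}
    (F : StarFunctor (V₁.toStarSemicat.prod V₂.toStarSemicat) W) : Prop :=
  ∀ {X Y : V₁.Obj × V₂.Obj},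
    (∀ (f f' : V₁.Hom X.1 Y.1) (g : V₂.Hom X.2 Y.2),
      F.map (X := X) (Y := Y) (f + f', g) = F.map (X := X) (Y := Y) (f, g) + F.map (f', g)) ∧
    (∀ (c : ℂ) (f : V₁.Hom X.1 Y.1) (g : V₂.Hom X.2 Y.2),
      F.map (X := X) (Y := Y) (c • f, g) = c • F.map (X := X) (Y := Y) (f, g)) ∧
    (∀ (f : V₁.Hom X.1 Y.1) (g g' : V₂.Hom X.2 Y.2),
      F.map (X := X) (Y := Y) (f, g + g') = F.map (X := X) (Y := Y) (f, g) + F.map (f, g')) ∧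
    (∀ (c : ℂ) (f : V₁.Hom X.1 Y.1) (g : V₂.Hom X.2 Y.2),
      F.map (X := X) (Y := Y) (f, c • g) = c • F.map (X := X) (Y := Y) (f, g))

end StarFunctor

/-- Nondegenerate linear `*`-functors `V → M W`: the `1`-morphisms from `V` to `W`. -/
abbrev LinFunctor (V W : CStarCat.{u}) : Type u :=
  {F : StarFunctor V.toStarSemicat W // F.IsLinear ∧ F.Nondegenerate}

section ApproximateUnits

attribute [local instance] CStarAlgebra.spectralOrder CStarAlgebra.spectralOrderedRing

lemma PreCStarCat.exists_approx_unit (V : PreCStarCat.{u}) (X : V.Obj) :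
    ∃ l : Filter (V.Hom X X), l.NeBot ∧ (∀ᶠ e in l, ‖e‖ ≤ 1) ∧
      ∀ (Z : V.Obj) (w : V.Hom Z X), Tendsto (fun e => V.comp e w) l (𝓝 w) := by
  let _ : NonUnitalCStarAlgebra (V.Hom X X) := V.endAlgebra X
  have h := CStarAlgebra.increasingApproximateUnit (V.Hom X X)
  refine ⟨CStarAlgebra.approximateUnit (V.Hom X X), h.neBot, ?_, fun Z w => ?_⟩
  · filter_upwards [h.eventually_nnnorm] with e he using he
  rw [tendsto_iff_norm_sub_tendsto_zero]
  have h1 : Tendsto (fun e : V.Hom X X => ‖V.comp e (V.comp w (V.adj w)) - V.comp w (V.adj w)‖)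
      (CStarAlgebra.approximateUnit (V.Hom X X)) (𝓝 0) :=
    tendsto_iff_norm_sub_tendsto_zero.1 (h.tendsto_mul_right (V.comp w (V.adj w)))
  have h2 := Real.continuous_sqrt.continuousAt.tendsto.comp (h1.const_mul 2)
  rw [mul_zero, Real.sqrt_zero] at h2
  refine squeeze_zero' (Eventually.of_forall fun _ => norm_nonneg _) ?_ h2
  filter_upwards [h.eventually_nnnorm] with e he
  have he' : ‖e‖ ≤ 1 := he
  refine Real.le_sqrt_of_sq_le ?_
  rw [← V.norm_comp_adj, V.adj_sub, V.adj_comp, V.comp_sub]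
  have e1 : V.comp (V.comp e w - w) (V.comp (V.adj w) (V.adj e)) =
      V.comp (V.comp e (V.comp w (V.adj w)) - V.comp w (V.adj w)) (V.adj e) := by
    rw [← V.comp_assoc, V.sub_comp, V.comp_assoc]
  have e2 : V.comp (V.comp e w - w) (V.adj w) =
      V.comp e (V.comp w (V.adj w)) - V.comp w (V.adj w) := by
    rw [V.sub_comp, V.comp_assoc]
  rw [e1, e2]
  refine (norm_sub_le _ _).trans ?_
  have e3 := V.norm_comp_le (V.comp e (V.comp w (V.adj w)) - V.comp w (V.adj w)) (V.adj e)
  rw [V.norm_adj] at e3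
  nlinarith [norm_nonneg (V.comp e (V.comp w (V.adj w)) - V.comp w (V.adj w))]

end ApproximateUnits

namespace StarFunctor

variable {D : StarSemicat.{u}} {W : CStarCat.{u}}

lemma Nondegenerate.dense_act {F : StarFunctor D W} (hF : F.Nondegenerate) (X : D.Obj)
    (Z : W.Obj) :
    Dense (Submodule.span ℂ {w : W.Hom Z (F.obj X) |
      ∃ (f : D.Hom X X) (v : W.Hom Z (F.obj X)), w = (F.map f).act v} :
        Set (W.Hom Z (F.obj X))) := by
  set K := Submodule.span ℂ {w : W.Hom Z (F.obj X) |
      ∃ (f : D.Hom X X) (v : W.Hom Z (F.obj X)), w = (F.map f).act v} with hK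
  obtain ⟨l, hl, -, hl'⟩ := W.exists_approx_unit (F.obj X)
  intro w
  have key : ∀ a : W.Hom (F.obj X) (F.obj X), W.comp a w ∈ closure (K : Set _) := by
    intro a
    have hc : Continuous fun a : W.Hom (F.obj X) (F.obj X) => W.comp a w :=
      W.continuous_comp.comp (continuous_id.prodMk continuous_const)
    refine map_mem_closure (f := fun a => W.comp a w) hc ((hF X X).1 a) (fun b hb => ?_)
    refine Submodule.span_induction (p := fun b _ => W.comp b w ∈ K) ?_ ?_ ?_ ?_ hb
    · rintro _ ⟨f, v, rfl⟩
      rw [← Mult.act_comp]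
      exact Submodule.subset_span ⟨f, _, rfl⟩
    · rw [W.zero_comp]; exact K.zero_mem
    · intro x y _ _ hx hy
      rw [W.add_comp]; exact K.add_mem hx hy
    · intro c x _ hx
      rw [W.smul_comp]; exact K.smul_mem c hx
  exact isClosed_closure.mem_of_tendsto (hl' Z w) (Eventually.of_forall key)

/-- Multipliers out of `F X` are determined by their composites with the image of `F`. -/
lemma Nondegenerate.hom_ext {F : StarFunctor D W} (hF : F.Nondegenerate) {X : D.Obj} {Y : W.Obj}
    {a b : W.Mult (F.obj X) Y}
    (h : ∀ f : D.Hom X X, Mult.comp a (F.map f) = Mult.comp b (F.map f)) : a = b := by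
  refine Mult.ext_act fun Z w => ?_
  have : a.1.1.1 Z = b.1.1.1 Z := by
    refine ContinuousLinearMap.ext_on (hF.dense_act X Z) ?_
    rintro _ ⟨f, v, rfl⟩
    exact congrArg (fun m => Mult.act m v) (h f)
  exact congrArg (fun T => T w) this

/-- Multipliers into `F X` are determined by their composites with the image of `F`. -/
lemma Nondegenerate.hom_ext' {F : StarFunctor D W} (hF : F.Nondegenerate) {X : D.Obj} {Y : W.Obj}
    {a b : W.Mult Y (F.obj X)}
    (h : ∀ f : D.Hom X X, Mult.comp (F.map f) a = Mult.comp (F.map f) b) : a = b := by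
  have : Mult.adj a = Mult.adj b := hF.hom_ext fun f => by
    have := congrArg Mult.adj (h (D.adj f))
    simpa only [Mult.adj_comp, F.map_adj, Mult.adj_adj] using this
  simpa only [Mult.adj_adj] using congrArg Mult.adj this

end StarFunctor

namespace LinFunctor

variable {V W : CStarCat.{u}} (F : LinFunctor V W) {X Y Z : V.Obj}

lemma map_zero (X Y : V.Obj) : F.1.map (0 : V.Hom X Y) = 0 := by
  simpa using F.2.1.2 0 (0 : V.Hom X Y)

lemma norm_map_le (f : V.Hom X Y) : ‖F.1.map f‖ ≤ ‖f‖ := by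
  have h : ‖F.1.map (V.comp (V.adj f) f)‖ ≤ ‖V.comp (V.adj f) f‖ := by
    let _ : NonUnitalCStarAlgebra (V.Hom X X) := V.endAlgebra X
    let _ : NonUnitalCStarAlgebra (W.Mult (F.1.obj X) (F.1.obj X)) :=
      (Mult.pre W).endAlgebra (F.1.obj X)
    let φ : V.Hom X X →⋆ₙₐ[ℂ] W.Mult (F.1.obj X) (F.1.obj X) :=
      { toFun := fun a => F.1.map a
        map_smul' := fun c a => F.2.1.2 c a
        map_zero' := F.map_zero X X
        map_add' := fun a b => F.2.1.1 a b
        map_mul' := fun a b => F.1.map_comp a b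
        map_star' := fun a => F.1.map_adj a }
    exact NonUnitalStarAlgHom.norm_apply_le φ _
  rw [F.1.map_comp, F.1.map_adj, Mult.norm_adj_comp, V.norm_adj_comp] at h
  exact (pow_le_pow_iff_left₀ (norm_nonneg _) (norm_nonneg _) two_ne_zero).1 h

/-- `F` on morphism spaces as a bounded linear map. -/
def mapL (X Y : V.Obj) : V.Hom X Y →L[ℂ] W.Mult (F.1.obj X) (F.1.obj Y) :=
  LinearMap.mkContinuous
    { toFun := F.1.map, map_add' := F.2.1.1, map_smul' := F.2.1.2 } 1
    (fun f => by rw [one_mul]; exact F.norm_map_le f)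

@[simp] lemma mapL_apply (f : V.Hom X Y) : F.mapL X Y f = F.1.map f := rfl

/-- `f ⊗ w ↦ F(m ∘ f) ∘ w`. -/
def preExt (m : V.Mult X Y) (Z : W.Obj) :
    V.Hom X X ⊗[ℂ] W.Hom Z (F.1.obj X) →ₗ[ℂ] W.Hom Z (F.1.obj Y) :=
  TensorProduct.lift (LinearMap.mk₂ ℂ (fun f w => (F.1.map (m.act f)).act w)
    (fun f f' w => by rw [m.act_add, F.2.1.1, Mult.add_act])
    (fun c f w => by rw [m.act_smul, F.2.1.2, Mult.smul_act])
    (fun f w w' => by rw [Mult.act_add])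
    (fun c f w => by rw [Mult.act_smul]))

@[simp] lemma preExt_tmul (m : V.Mult X Y) (Z : W.Obj) (f : V.Hom X X)
    (w : W.Hom Z (F.1.obj X)) :
    F.preExt m Z (f ⊗ₜ w) = (F.1.map (m.act f)).act w := rfl

lemma dense_preExt_id (X : V.Obj) (Z : W.Obj) : DenseRange (F.preExt (Mult.id X) Z) := by
  refine (F.2.2.dense_act X Z).mono ?_
  have : Submodule.span ℂ {w : W.Hom Z (F.1.obj X) |
      ∃ (f : V.Hom X X) (v : W.Hom Z (F.1.obj X)), w = (F.1.map f).act v} ≤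
      LinearMap.range (F.preExt (Mult.id X) Z) := by
    rw [Submodule.span_le]
    rintro _ ⟨f, v, rfl⟩
    exact ⟨f ⊗ₜ v, rfl⟩
  exact this

lemma norm_preExt_le (m : V.Mult X Y) (Z : W.Obj) (t : V.Hom X X ⊗[ℂ] W.Hom Z (F.1.obj X)) :
    ‖F.preExt m Z t‖ ≤ ‖m‖ * ‖F.preExt (Mult.id X) Z t‖ := by
  obtain ⟨l, hl, hl1, hl2⟩ := V.exists_approx_unit X
  have key : Tendsto (fun e => (F.1.map (m.act e)).act (F.preExt (Mult.id X) Z t)) l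
      (𝓝 (F.preExt m Z t)) := by
    induction t using TensorProduct.induction_on with
    | zero => simp [Mult.act_zero]
    | add s t hs ht => simpa [Mult.act_add] using hs.add ht
    | tmul f w =>
      simp only [preExt_tmul, Mult.id_act]
      have h1 : Tendsto (fun e => F.mapL X Y (m.act (V.comp e f))) l
          (𝓝 (F.mapL X Y (m.act f))) :=
        ((F.mapL X Y).continuous.comp m.continuous_act).continuousAt.tendsto.comp (hl2 X f)
      have h2 : Continuous fun n : W.Mult (F.1.obj X) (F.1.obj Y) => n.act w := by
        refine continuous_of_linear_of_bound (𝕜 := ℂ) 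
          (f := fun n : W.Mult (F.1.obj X) (F.1.obj Y) => n.act w)
          (fun _ _ => rfl) (fun _ _ => rfl) (C := ‖w‖) fun n => ?_
        rw [mul_comm]; exact n.norm_act_le w
      have h3 := h2.continuousAt.tendsto.comp h1
      refine h3.congr fun e => ?_
      simp only [Function.comp, mapL_apply, Mult.act_comp, F.1.map_comp, Mult.comp_act']
  refine le_of_tendsto key.norm ?_
  filter_upwards [hl1] with e he
  refine (Mult.norm_act_le _ _).trans ?_
  gcongr
  calc ‖F.1.map (m.act e)‖ ≤ ‖m.act e‖ := F.norm_map_le _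
    _ ≤ ‖m‖ * ‖e‖ := m.norm_act_le e
    _ ≤ ‖m‖ := mul_le_of_le_one_right (norm_nonneg _) he

/-- The left multiplier with `F(f) ∘ w ↦ F(m ∘ f) ∘ w`. -/
def extL (m : V.Mult X Y) (Z : W.Obj) : W.Hom Z (F.1.obj X) →L[ℂ] W.Hom Z (F.1.obj Y) :=
  (F.preExt m Z).extendOfNorm (F.preExt (Mult.id X) Z)

lemma extL_map (m : V.Mult X Y) (Z : W.Obj) (f : V.Hom X X) (w : W.Hom Z (F.1.obj X)) :
    F.extL m Z ((F.1.map f).act w) = (F.1.map (m.act f)).act w :=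
  LinearMap.extendOfNorm_eq (F.dense_preExt_id X Z) ⟨‖m‖, F.norm_preExt_le m Z⟩ (f ⊗ₜ w)

lemma norm_extL_le (m : V.Mult X Y) (Z : W.Obj) (w : W.Hom Z (F.1.obj X)) :
    ‖F.extL m Z w‖ ≤ ‖m‖ * ‖w‖ :=
  LinearMap.norm_extendOfNorm_apply_le (F.dense_preExt_id X Z) ‖m‖ (F.norm_preExt_le m Z) w

/-- The right multiplier, obtained by taking adjoints. -/
def extR (m : V.Mult X Y) (Z : W.Obj) : W.Hom (F.1.obj Y) Z →ₗ[ℂ] W.Hom (F.1.obj X) Z :=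
  (W.adjL Z (F.1.obj X)).comp ((F.extL (Mult.adj m) Z).toLinearMap.comp (W.adjL (F.1.obj Y) Z))

lemma extR_apply (m : V.Mult X Y) (Z : W.Obj) (w : W.Hom (F.1.obj Y) Z) :
    F.extR m Z w = W.adj (F.extL (Mult.adj m) Z (W.adj w)) := rfl

lemma extL_comp (m : V.Mult X Y) {Z Z' : W.Obj} (h : W.Hom Z (F.1.obj X)) (g : W.Hom Z' Z) :
    F.extL m Z' (W.comp h g) = W.comp (F.extL m Z h) g := by
  have : (F.extL m Z').comp ((W.compL Z' Z _).flip g) =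
      ((W.compL Z' Z _).flip g).comp (F.extL m Z) := by
    refine ContinuousLinearMap.ext_on (F.2.2.dense_act X Z) ?_
    rintro _ ⟨f, v, rfl⟩
    change F.extL m Z' (W.comp ((F.1.map f).act v) g) = W.comp (F.extL m Z ((F.1.map f).act v)) g
    rw [← Mult.act_comp, extL_map, extL_map, Mult.act_comp]
  exact congrArg (fun T => T h) this

lemma extL_compat (m : V.Mult X Y) {Z Z' : W.Obj} (w : W.Hom Z (F.1.obj X))
    (v : W.Hom Z' (F.1.obj Y)) :
    W.comp (W.adj v) (F.extL m Z w) = W.comp (W.adj (F.extL (Mult.adj m) Z' v)) w := by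
  have h1 : (W.compL Z (F.1.obj Y) Z' (W.adj v)).comp (F.extL m Z) =
      W.compL Z (F.1.obj X) Z' (W.adj (F.extL (Mult.adj m) Z' v)) := by
    refine ContinuousLinearMap.ext_on (F.2.2.dense_act X Z) ?_
    rintro _ ⟨f, w, rfl⟩
    change W.comp (W.adj v) (F.extL m Z ((F.1.map f).act w)) =
      W.comp (W.adj (F.extL (Mult.adj m) Z' v)) ((F.1.map f).act w)
    rw [extL_map]
    have h2 : (W.compL Z' (F.1.obj Y) Z (W.adj ((F.1.map (m.act f)).act w))) =
        (W.compL Z' (F.1.obj X) Z (W.adj ((F.1.map f).act w))).comp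
          (F.extL (Mult.adj m) Z') := by
      refine ContinuousLinearMap.ext_on (F.2.2.dense_act Y Z') ?_
      rintro _ ⟨g, v, rfl⟩
      change W.comp (W.adj ((F.1.map (m.act f)).act w)) ((F.1.map g).act v) =
        W.comp (W.adj ((F.1.map f).act w)) (F.extL (Mult.adj m) Z' ((F.1.map g).act v))
      rw [extL_map]
      have e1 : ∀ {P Q R : V.Obj} (a : V.Hom P Q) (b : V.Hom R Q) (w : W.Hom Z (F.1.obj P))
          (v : W.Hom Z' (F.1.obj R)), W.comp (W.adj ((F.1.map a).act w)) ((F.1.map b).act v) =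
            W.comp (W.adj w) ((F.1.map (V.comp (V.adj a) b)).act v) := by
        intro P Q R a b w v
        rw [F.1.map_comp, F.1.map_adj, Mult.comp_act', Mult.adj_act, ← W.adj_comp,
          ← Mult.comp_act, W.adj_comp, W.adj_adj]
      rw [e1, e1, Mult.adj_act, ← V.adj_comp, ← Mult.comp_act, V.adj_comp, V.adj_adj]
    have h3 := congrArg (fun T => W.adj (T v)) h2
    simpa [W.adj_comp, W.adj_adj] using h3
  exact congrArg (fun T => T w) h1

/-- The extension of a nondegenerate linear `*`-functor `F : V → M W` to the multiplier category
of `V`: the unique multiplier with `F(m) ∘ F(f) = F(m ∘ f)` for all morphisms `f`. -/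
def ext (m : V.Mult X Y) : W.Mult (F.1.obj X) (F.1.obj Y) :=
  Mult.mk (fun Z => (F.extL m Z).toLinearMap) (F.extR m) ‖m‖ (F.norm_extL_le m)
    (fun Z w => by
      rw [extR_apply, W.norm_adj, ← W.norm_adj w]
      exact (F.norm_extL_le _ _ _).trans (by gcongr; exact Mult.norm_adj_le m))
    (fun _ _ h g => F.extL_comp m h g)
    (fun _ _ f h => by
      rw [extR_apply, W.adj_comp, extL_comp, W.adj_comp, W.adj_adj, extR_apply])
    (fun _ _ w v => by
      have := F.extL_compat m w (W.adj v)
      rwa [W.adj_adj] at this)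

lemma ext_comp_map (m : V.Mult Y Z) (f : V.Hom X Y) :
    Mult.comp (F.ext m) (F.1.map f) = F.1.map (m.act f) := by
  refine F.2.2.hom_ext fun g => ?_
  refine Mult.ext_act fun T w => ?_
  have h1 : ∀ {a : V.Hom X Y}, F.extL m T ((F.1.map a).act w) = (F.1.map (m.act a)).act w := by
    intro a
    obtain ⟨l, hl, -, hl2⟩ := V.exists_approx_unit Y
    have hc : ∀ {P Q : V.Obj} (w : W.Hom T (F.1.obj P)),
        Continuous fun a : V.Hom P Q => (F.1.map a).act w := fun {P Q} w => by
      refine continuous_of_linear_of_bound (𝕜 := ℂ) (f := fun a : V.Hom P Q => (F.1.map a).act w)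
        (fun a b => by rw [F.2.1.1]; rfl) (fun c a => by rw [F.2.1.2]; rfl) (C := ‖w‖)
        fun n => ?_
      rw [mul_comm]
      exact (Mult.norm_act_le _ w).trans (by gcongr; exact F.norm_map_le n)
    have t1 := ((F.extL m T).continuous.comp (hc w)).continuousAt.tendsto.comp (hl2 X a)
    have t2 := ((hc w).comp (m.continuous_act)).continuousAt.tendsto.comp (hl2 X a)
    refine tendsto_nhds_unique t1 (t2.congr fun e => ?_)
    simp only [Function.comp, F.1.map_comp, Mult.comp_act', extL_map, Mult.act_comp]
  change F.extL m T ((F.1.map f).act ((F.1.map g).act w)) = _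
  rw [← Mult.comp_act', ← F.1.map_comp, h1, Mult.act_comp, F.1.map_comp]

lemma ext_unique {m : V.Mult X Y} {n : W.Mult (F.1.obj X) (F.1.obj Y)}
    (h : ∀ f : V.Hom X X, Mult.comp n (F.1.map f) = F.1.map (m.act f)) : F.ext m = n :=
  F.2.2.hom_ext fun f => by rw [h, ext_comp_map]

lemma ext_of (f : V.Hom X Y) : F.ext (Mult.of f) = F.1.map f :=
  F.ext_unique fun g => by rw [Mult.of_act, F.1.map_comp]

lemma ext_id (X : V.Obj) : F.ext (Mult.id X) = Mult.id (F.1.obj X) :=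
  F.ext_unique fun g => by rw [Mult.id_act, Mult.id_comp]

lemma ext_comp (n : V.Mult Y Z) (m : V.Mult X Y) :
    F.ext (Mult.comp n m) = Mult.comp (F.ext n) (F.ext m) :=
  F.ext_unique fun g => by
    rw [Mult.comp_act', Mult.comp_assoc, ext_comp_map, ext_comp_map]

lemma ext_add (m n : V.Mult X Y) : F.ext (m + n) = F.ext m + F.ext n :=
  F.ext_unique fun g => by
    rw [Mult.add_comp, ext_comp_map, ext_comp_map, Mult.add_act, F.2.1.1]

lemma ext_smul (c : ℂ) (m : V.Mult X Y) : F.ext (c • m) = c • F.ext m :=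
  F.ext_unique fun g => by
    rw [Mult.smul_comp, ext_comp_map, Mult.smul_act, F.2.1.2]

lemma map_comp_ext (f : V.Hom Y Z) (m : V.Mult X Y) :
    Mult.comp (F.1.map f) (F.ext m) = F.1.map (m.coact f) := by
  rw [← ext_of, ← ext_comp, Mult.of_comp, ext_of]

lemma ext_adj (m : V.Mult X Y) : F.ext (Mult.adj m) = Mult.adj (F.ext m) := by
  refine F.ext_unique fun f => F.2.2.hom_ext' fun g => ?_
  rw [← F.1.map_comp]
  have h1 : Mult.comp (F.1.map g) (Mult.comp (Mult.adj (F.ext m)) (F.1.map f)) =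
      Mult.adj (Mult.comp (F.1.map (V.adj f)) (Mult.comp (F.ext m) (F.1.map (V.adj g)))) := by
    simp only [Mult.adj_comp, F.1.map_adj, Mult.adj_adj, Mult.comp_assoc]
  rw [h1, ext_comp_map, ← F.1.map_comp, ← F.1.map_adj, Mult.adj_act, Mult.comp_act,
    V.adj_comp, V.adj_adj]

lemma norm_ext_le (m : V.Mult X Y) : ‖F.ext m‖ ≤ ‖m‖ :=
  Mult.norm_le _ (norm_nonneg _) fun Z w => F.norm_extL_le m Z w

end LinFunctor
/-! ## Multiplier natural transformations and functor categories -/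

lemma CStarCat.Mult.continuous_comp {W : CStarCat.{u}} {X Y Z : W.Obj} :
    Continuous (fun p : W.Mult Y Z × W.Mult X Y => Mult.comp p.1 p.2) :=
  @PreCStarCat.continuous_comp (Mult.pre W) X Y Z

namespace StarFunctor

variable {D : StarSemicat.{u}} {W : CStarCat.{u}}

/-- Multiplier natural transformations `F ⇒ G`: uniformly bounded families of multiplier
morphisms `τ X : F X → G X` with `τ Y ∘ F f = G f ∘ τ X`. -/
def natSub (F G : StarFunctor D W) :
    Submodule ℂ (lp (fun X : D.Obj => W.Mult (F.obj X) (G.obj X)) ∞) where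
  carrier := {τ | ∀ (X Y : D.Obj) (f : D.Hom X Y),
    Mult.comp (τ.1 Y) (F.map f) = Mult.comp (G.map f) (τ.1 X)}
  add_mem' := fun {σ τ} hσ hτ X Y f => by
    change Mult.comp (σ.1 Y + τ.1 Y) _ = Mult.comp _ (σ.1 X + τ.1 X)
    rw [Mult.add_comp, Mult.comp_add, hσ, hτ]
  zero_mem' := fun X Y f => by
    change Mult.comp (0 : W.Mult (F.obj Y) (G.obj Y)) (F.map f) =
      Mult.comp (G.map f) (0 : W.Mult (F.obj X) (G.obj X))
    refine Mult.ext_act fun Z w => ?_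
    rw [Mult.comp_act', Mult.comp_act', Mult.zero_act, Mult.zero_act, Mult.act_zero]
  smul_mem' := fun c τ hτ X Y f => by
    change Mult.comp (c • τ.1 Y) _ = Mult.comp _ (c • τ.1 X)
    rw [Mult.smul_comp, Mult.comp_smul, hτ]

/-- The space of multiplier natural transformations, with the supremum norm. -/
def Nat (F G : StarFunctor D W) : Type u := F.natSub G

namespace Nat

variable {F G H K : StarFunctor D W}

instance : NormedAddCommGroup (F.Nat G) := inferInstanceAs (NormedAddCommGroup (F.natSub G))
instance : NormedSpace ℂ (F.Nat G) := inferInstanceAs (NormedSpace ℂ (F.natSub G))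

/-- The component of a multiplier natural transformation at an object. -/
def app (τ : F.Nat G) (X : D.Obj) : W.Mult (F.obj X) (G.obj X) := τ.1.1 X

lemma naturality (τ : F.Nat G) {X Y : D.Obj} (f : D.Hom X Y) :
    Mult.comp (τ.app Y) (F.map f) = Mult.comp (G.map f) (τ.app X) := τ.2 X Y f

lemma norm_app_le (τ : F.Nat G) (X : D.Obj) : ‖τ.app X‖ ≤ ‖τ‖ :=
  lp.norm_apply_le_norm ENNReal.top_ne_zero τ.1 X

lemma norm_le {τ : F.Nat G} {C : ℝ} (hC : 0 ≤ C) (h : ∀ X, ‖τ.app X‖ ≤ C) : ‖τ‖ ≤ C :=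
  lp.norm_le_of_forall_le hC h

@[ext] lemma ext {σ τ : F.Nat G} (h : ∀ X, σ.app X = τ.app X) : σ = τ :=
  Subtype.ext (Subtype.ext (funext h))

lemma add_app (σ τ : F.Nat G) (X : D.Obj) : (σ + τ).app X = σ.app X + τ.app X := rfl
lemma smul_app (c : ℂ) (τ : F.Nat G) (X : D.Obj) : (c • τ).app X = c • τ.app X := rfl
lemma zero_app (X : D.Obj) : (0 : F.Nat G).app X = 0 := rfl

/-- Constructor for multiplier natural transformations. -/
def mk (t : ∀ X, W.Mult (F.obj X) (G.obj X)) (C : ℝ) (hC : ∀ X, ‖t X‖ ≤ C)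
    (h : ∀ (X Y : D.Obj) (f : D.Hom X Y),
      Mult.comp (t Y) (F.map f) = Mult.comp (G.map f) (t X)) : F.Nat G :=
  ⟨⟨t, memℓp_infty ⟨C, by rintro _ ⟨X, rfl⟩; exact hC X⟩⟩, h⟩

@[simp] lemma mk_app (t : ∀ X, W.Mult (F.obj X) (G.obj X)) (C : ℝ) (hC : ∀ X, ‖t X‖ ≤ C)
    (h : ∀ (X Y : D.Obj) (f : D.Hom X Y),
      Mult.comp (t Y) (F.map f) = Mult.comp (G.map f) (t X)) (X : D.Obj) :
    (mk t C hC h).app X = t X := rfl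

/-- The identity transformation. -/
def id (F : StarFunctor D W) : F.Nat F :=
  mk (fun X => Mult.id (F.obj X)) 1 (fun X => Mult.norm_id_le _) fun X Y f => by
    rw [Mult.id_comp, Mult.comp_id]

/-- Vertical composition. -/
def comp (σ : G.Nat H) (τ : F.Nat G) : F.Nat H :=
  mk (fun X => Mult.comp (σ.app X) (τ.app X)) (‖σ‖ * ‖τ‖)
    (fun X => (Mult.norm_comp_le _ _).trans
      (mul_le_mul (σ.norm_app_le X) (τ.norm_app_le X) (norm_nonneg _) (norm_nonneg _)))
    fun X Y f => by
      rw [Mult.comp_assoc, τ.naturality, ← Mult.comp_assoc, σ.naturality, Mult.comp_assoc]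

/-- The pointwise adjoint. -/
def adj (τ : F.Nat G) : G.Nat F :=
  mk (fun X => Mult.adj (τ.app X)) ‖τ‖
    (fun X => (Mult.norm_adj_le _).trans (τ.norm_app_le X)) fun X Y f => by
      have := congrArg Mult.adj (τ.naturality (D.adj f))
      rw [Mult.adj_comp, Mult.adj_comp, F.map_adj, G.map_adj, Mult.adj_adj, Mult.adj_adj] at this
      exact this.symm

@[simp] lemma id_app (X : D.Obj) : (id F).app X = Mult.id (F.obj X) := rfl
@[simp] lemma comp_app (σ : G.Nat H) (τ : F.Nat G) (X : D.Obj) :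
    (comp σ τ).app X = Mult.comp (σ.app X) (τ.app X) := rfl
@[simp] lemma adj_app (τ : F.Nat G) (X : D.Obj) : (adj τ).app X = Mult.adj (τ.app X) := rfl

lemma isClosed_natSub (F G : StarFunctor D W) :
    IsClosed (F.natSub G : Set (lp (fun X : D.Obj => W.Mult (F.obj X) (G.obj X)) ∞)) := by
  have e1 : ∀ X, Continuous
      fun τ : lp (fun X : D.Obj => W.Mult (F.obj X) (G.obj X)) ∞ => τ.1 X := fun X =>
    (lp.lipschitzWith_one_eval ∞ X).continuous
  have : (F.natSub G : Set (lp (fun X : D.Obj => W.Mult (F.obj X) (G.obj X)) ∞)) =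
      ⋂ (X) (Y) (f : D.Hom X Y), {τ | Mult.comp (τ.1 Y) (F.map f) =
        Mult.comp (G.map f) (τ.1 X)} := by
    ext τ
    simp only [Set.mem_iInter]
    exact Iff.rfl
  rw [this]
  refine isClosed_iInter fun X => isClosed_iInter fun Y => isClosed_iInter fun f =>
    isClosed_eq ?_ ?_
  · exact Mult.continuous_comp.comp
      ((e1 Y).prodMk continuous_const)
  · exact Mult.continuous_comp.comp
      (continuous_const.prodMk (e1 X))

instance : CompleteSpace (F.Nat G) := (isClosed_natSub F G).completeSpace_coe

lemma norm_comp_le (σ : G.Nat H) (τ : F.Nat G) : ‖comp σ τ‖ ≤ ‖σ‖ * ‖τ‖ :=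
  norm_le (by positivity) fun X => (Mult.norm_comp_le _ _).trans
      (mul_le_mul (σ.norm_app_le X) (τ.norm_app_le X) (norm_nonneg _) (norm_nonneg _))

lemma norm_adj_comp (τ : F.Nat G) : ‖comp (adj τ) τ‖ = ‖τ‖ ^ 2 := by
  apply le_antisymm
  · rw [sq]
    refine (norm_comp_le _ _).trans ?_
    gcongr
    exact norm_le (norm_nonneg _) fun X => (Mult.norm_adj_le _).trans (τ.norm_app_le X)
  · have : ‖τ‖ ≤ Real.sqrt ‖comp (adj τ) τ‖ :=
      norm_le (Real.sqrt_nonneg _) fun X => Real.le_sqrt_of_sq_le (by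
        rw [← Mult.norm_adj_comp]
        exact (comp (adj τ) τ).norm_app_le X)
    calc ‖τ‖ ^ 2 ≤ (Real.sqrt ‖comp (adj τ) τ‖) ^ 2 := by gcongr
      _ = _ := Real.sq_sqrt (norm_nonneg _)

end Nat

/-- The category of all functors in a class `P`, with multiplier natural transformations. -/
def preFunCat (P : StarFunctor D W → Prop) : PreCStarCat.{u} where
  Obj := {F : StarFunctor D W // P F}
  Hom F G := F.1.Nat G.1
  comp σ τ := Nat.comp σ τ
  adj τ := Nat.adj τ
  comp_assoc _ _ _ := Nat.ext fun _ => Mult.comp_assoc _ _ _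
  adj_adj _ := Nat.ext fun _ => Mult.adj_adj _
  adj_comp _ _ := Nat.ext fun _ => Mult.adj_comp _ _
  add_comp _ _ _ := Nat.ext fun _ => Mult.add_comp _ _ _
  comp_add _ _ _ := Nat.ext fun _ => Mult.comp_add _ _ _
  smul_comp _ _ _ := Nat.ext fun _ => Mult.smul_comp _ _ _
  comp_smul _ _ _ := Nat.ext fun _ => Mult.comp_smul _ _ _
  adj_add _ _ := Nat.ext fun _ => Mult.adj_add _ _
  adj_smul _ _ := Nat.ext fun _ => Mult.adj_smul _ _
  norm_comp_le := Nat.norm_comp_le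
  norm_adj_comp := Nat.norm_adj_comp

/-- The unital `C*`-category of all functors in a class `P`, with multiplier natural
transformations as morphisms. -/
def funCat (P : StarFunctor D W → Prop) : UCStarCat.{u} where
  toPreCStarCat := preFunCat P
  pos {F G} τ := by
    let _ : NonUnitalCStarAlgebra ((preFunCat P).Hom F F) := (preFunCat P).endAlgebra F
    let _ : ∀ X : D.Obj, NonUnitalCStarAlgebra (W.Mult (F.1.obj X) (F.1.obj X)) :=
      fun X => (Mult.pre W).endAlgebra (F.1.obj X)
    let φ : ∀ X : D.Obj, (preFunCat P).Hom F F →⋆ₙₐ[ℂ] W.Mult (F.1.obj X) (F.1.obj X) :=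
      fun X =>
      { toFun := fun a => Nat.app a X
        map_smul' := fun _ _ => rfl
        map_zero' := rfl
        map_add' := fun _ _ => rfl
        map_mul' := fun _ _ => rfl
        map_star' := fun _ => rfl }
    refine exists_eq_star_mul_self_of_family φ (fun a ha => Nat.ext ha) _ ?_
      fun X => Mult.pos (Nat.app τ X)
    exact ((preFunCat P).adj_comp _ _).trans (by rw [(preFunCat P).adj_adj])
  id F := Nat.id F.1
  id_comp _ := Nat.ext fun _ => Mult.id_comp _
  comp_id _ := Nat.ext fun _ => Mult.comp_id _

end StarFunctor

namespace CStarCat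

/-- `C*Lin(V, W)`: nondegenerate linear `*`-functors `V → M W` and multiplier natural
transformations. -/
def Lin (V W : CStarCat.{u}) : UCStarCat.{u} :=
  StarFunctor.funCat (fun F : StarFunctor V.toStarSemicat W => F.IsLinear ∧ F.Nondegenerate)

/-- `C*Bilin(V₁, V₂; W)`: nondegenerate bilinear `*`-functors `V₁ × V₂ → M W` and multiplier
natural transformations. -/
def Bilin (V₁ V₂ W : CStarCat.{u}) : UCStarCat.{u} :=
  StarFunctor.funCat (fun F : StarFunctor (V₁.toStarSemicat.prod V₂.toStarSemicat) W =>
    F.IsBilinear ∧ F.Nondegenerate)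

end CStarCat

/-! ## Postcomposition -/

namespace StarFunctor

variable {D : StarSemicat.{u}} {V W W' W'' : CStarCat.{u}}

/-- The composite of `F : D → M W` with (the extension `M W → M W'` of) a nondegenerate linear
`*`-functor `h : W → M W'`. -/
def post (h : LinFunctor W W') (F : StarFunctor D W) : StarFunctor D W' where
  obj X := h.1.obj (F.obj X)
  map f := h.ext (F.map f)
  map_comp g f := by rw [F.map_comp, h.ext_comp]
  map_adj f := by rw [F.map_adj, h.ext_adj]

/-- It is enough to check the first half of nondegeneracy. -/
lemma Nondegenerate.of_act {F : StarFunctor D W} (key : ∀ (X : D.Obj) (Z : W.Obj),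
    Dense (Submodule.span ℂ {w : W.Hom Z (F.obj X) |
      ∃ (f : D.Hom X X) (v : W.Hom Z (F.obj X)), w = (F.map f).act v} :
        Set (W.Hom Z (F.obj X)))) : F.Nondegenerate := by
  intro X Y
  refine ⟨key Y _, ?_⟩
  have hc : Continuous (W.adj : W.Hom (F.obj Y) (F.obj X) → _) := W.continuous_adj
  intro w
  have := map_mem_closure hc (key X _ (W.adj w)) (t := (Submodule.span ℂ
    {w : W.Hom (F.obj X) (F.obj Y) |
      ∃ (v : W.Hom (F.obj X) (F.obj Y)) (f : D.Hom X X), w = (F.map f).coact v} :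
        Set (W.Hom (F.obj X) (F.obj Y)))) ?_
  · rwa [W.adj_adj] at this
  intro b hb
  refine Submodule.span_induction (p := fun b _ => W.adj b ∈ Submodule.span ℂ
    {w : W.Hom (F.obj X) (F.obj Y) |
      ∃ (v : W.Hom (F.obj X) (F.obj Y)) (f : D.Hom X X), w = (F.map f).coact v}) ?_ ?_ ?_ ?_ hb
  · rintro _ ⟨f, v, rfl⟩
    refine Submodule.subset_span ⟨W.adj v, D.adj f, ?_⟩
    rw [F.map_adj, Mult.adj_coact, W.adj_adj]
  · rw [W.adj_zero]; exact Submodule.zero_mem _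
  · intro x y _ _ hx hy
    rw [W.adj_add]; exact Submodule.add_mem _ hx hy
  · intro c x _ hx
    rw [W.adj_smul]; exact Submodule.smul_mem _ _ hx

lemma _root_.LinFunctor.continuous_map_act (h : LinFunctor W W') {X Y : W.Obj} {Z : W'.Obj}
    (v : W'.Hom Z (h.1.obj X)) : Continuous fun a : W.Hom X Y => (h.1.map a).act v := by
  refine continuous_of_linear_of_bound (𝕜 := ℂ)
    (f := fun a : W.Hom X Y => (h.1.map a).act v)
    (fun a b => by rw [h.2.1.1]; rfl) (fun c a => by rw [h.2.1.2]; rfl) (C := ‖v‖) fun n => ?_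
  rw [mul_comm]
  exact (Mult.norm_act_le _ v).trans (by gcongr; exact h.norm_map_le n)

lemma Nondegenerate.post (h : LinFunctor W W') {F : StarFunctor D W} (hF : F.Nondegenerate) :
    (F.post h).Nondegenerate := by
  have key : ∀ (X : D.Obj) (Z : W'.Obj),
      Dense (Submodule.span ℂ {w : W'.Hom Z ((F.post h).obj X) |
        ∃ (f : D.Hom X X) (v : W'.Hom Z ((F.post h).obj X)), w = ((F.post h).map f).act v} :
        Set (W'.Hom Z ((F.post h).obj X))) := by
    intro X Z
    set K := Submodule.span ℂ {w : W'.Hom Z ((F.post h).obj X) |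
        ∃ (f : D.Hom X X) (v : W'.Hom Z ((F.post h).obj X)), w = ((F.post h).map f).act v} with hK
    have h1 := h.2.2.dense_act (F.obj X) Z
    rw [← dense_closure]
    refine h1.mono ?_
    rw [← Submodule.topologicalClosure_coe]
    refine Submodule.span_le.2 ?_
    rintro _ ⟨a, v, rfl⟩
    refine map_mem_closure (f := fun a => (h.1.map a).act v) (h.continuous_map_act v) (hF.dense_act X _ a)
      (fun b hb => ?_)
    refine Submodule.span_induction (p := fun b _ => (h.1.map b).act v ∈ K) ?_ ?_ ?_ ?_ hb
    · rintro _ ⟨f, w, rfl⟩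
      rw [← h.ext_comp_map]
      exact Submodule.subset_span ⟨f, _, rfl⟩
    · rw [h.map_zero, Mult.zero_act]; exact K.zero_mem
    · intro x y _ _ hx hy
      rw [h.2.1.1, Mult.add_act]; exact K.add_mem hx hy
    · intro c x _ hx
      rw [h.2.1.2, Mult.smul_act]; exact K.smul_mem c hx
  exact .of_act key

lemma IsLinear.post (h : LinFunctor W W') {F : StarFunctor V.toStarSemicat W} (hF : F.IsLinear) :
    (F.post h).IsLinear :=
  ⟨fun f g => (congrArg h.ext (hF.1 f g)).trans (h.ext_add _ _),
    fun c f => (congrArg h.ext (hF.2 c f)).trans (h.ext_smul _ _)⟩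

lemma IsBilinear.post (h : LinFunctor W W') {V₁ V₂ : CStarCat.{u}}
    {F : StarFunctor (V₁.toStarSemicat.prod V₂.toStarSemicat) W} (hF : F.IsBilinear) :
    (F.post h).IsBilinear := fun {X Y} =>
  ⟨fun f f' g => (congrArg h.ext ((hF (X := X) (Y := Y)).1 f f' g)).trans (h.ext_add _ _),
    fun c f g => (congrArg h.ext ((hF (X := X) (Y := Y)).2.1 c f g)).trans (h.ext_smul _ _),
    fun f g g' => (congrArg h.ext ((hF (X := X) (Y := Y)).2.2.1 f g g')).trans (h.ext_add _ _),
    fun c f g => (congrArg h.ext ((hF (X := X) (Y := Y)).2.2.2 c f g)).trans (h.ext_smul _ _)⟩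

namespace Nat

variable {F G H : StarFunctor D W}

/-- Multiplier natural transformations between nondegenerate linear functors are natural for
multiplier morphisms. -/
lemma naturality_ext {h k : LinFunctor W W'} (η : h.1.Nat k.1) {X Y : W.Obj} (m : W.Mult X Y) :
    Mult.comp (η.app Y) (h.ext m) = Mult.comp (k.ext m) (η.app X) := by
  refine h.2.2.hom_ext fun f => ?_
  rw [Mult.comp_assoc, h.ext_comp_map, η.naturality, Mult.comp_assoc, η.naturality,
    ← Mult.comp_assoc, k.ext_comp_map]

/-- The horizontal composite `id_h * τ`, with components `h(τ X)`. -/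
def post (h : LinFunctor W W') (τ : F.Nat G) : (F.post h).Nat (G.post h) :=
  mk (fun X => h.ext (τ.app X)) ‖τ‖ (fun X => (h.norm_ext_le _).trans (τ.norm_app_le X))
    fun X Y f => by
      change Mult.comp (h.ext _) (h.ext _) = Mult.comp (h.ext _) (h.ext _)
      rw [← h.ext_comp, τ.naturality, h.ext_comp]

/-- The horizontal composite `η * id_F`, with components `η (F X)`. -/
def pre {h k : LinFunctor W W'} (η : h.1.Nat k.1) (F : StarFunctor D W) :
    (F.post h).Nat (F.post k) :=
  mk (fun X => η.app (F.obj X)) ‖η‖ (fun X => η.norm_app_le _)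
    fun X Y f => η.naturality_ext (F.map f)

@[simp] lemma post_app (h : LinFunctor W W') (τ : F.Nat G) (X : D.Obj) :
    (τ.post h).app X = h.ext (τ.app X) := rfl

@[simp] lemma pre_app {h k : LinFunctor W W'} (η : h.1.Nat k.1) (F : StarFunctor D W)
    (X : D.Obj) : (η.pre F).app X = η.app (F.obj X) := rfl

end Nat

end StarFunctor

namespace LinFunctor

variable {V W W' : CStarCat.{u}}

/-- The identity `1`-morphism: the inclusion `V → M V`. -/
def id (V : CStarCat.{u}) : LinFunctor V V :=
  ⟨{ obj := fun X => X
     map := fun f => Mult.of f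
     map_comp := fun g f => (Mult.comp_of (Mult.of g) f).symm
     map_adj := fun f => (Mult.adj_of f).symm },
   ⟨fun f g => Mult.ext_act fun _ _ => V.add_comp _ _ _,
     fun c f => Mult.ext_act fun _ _ => V.smul_comp _ _ _⟩, by
   intro X Y
   constructor
   · intro w
     obtain ⟨l, hl, -, hl'⟩ := V.exists_approx_unit Y
     exact mem_closure_of_tendsto (hl' X w)
       (Eventually.of_forall fun e => Submodule.subset_span ⟨e, w, rfl⟩)
   · intro w
     obtain ⟨l, hl, -, hl'⟩ := V.exists_approx_unit X
     have := (V.continuous_adj.tendsto (V.adj w)).comp (hl' Y (V.adj w))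
     rw [V.adj_adj] at this
     refine mem_closure_of_tendsto this
       (Eventually.of_forall fun e => Submodule.subset_span ⟨w, V.adj e, ?_⟩)
     change V.adj (V.comp e (V.adj w)) = V.comp w (V.adj e)
     rw [V.adj_comp, V.adj_adj]⟩

/-- Composition of `1`-morphisms, `k ∘ h`. -/
def comp (k : LinFunctor W W') (h : LinFunctor V W) : LinFunctor V W' :=
  ⟨h.1.post k, h.2.1.post k, h.2.2.post k⟩

lemma id_ext {X Y : V.Obj} (m : V.Mult X Y) : (id V).ext m = m :=
  (id V).ext_unique fun f => Mult.comp_of m f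

lemma comp_ext (k : LinFunctor W W') (h : LinFunctor V W) {X Y : V.Obj} (m : V.Mult X Y) :
    (comp k h).ext m = k.ext (h.ext m) :=
  (comp k h).ext_unique fun f => by
    change Mult.comp (k.ext (h.ext m)) (k.ext (h.1.map f)) = k.ext (h.1.map _)
    rw [← k.ext_comp, h.ext_comp_map]

end LinFunctor
/-! ## The bicategory of countably additive `C*`-categories -/

/-- A countably additive small `C*`-category: an object of `C*Lin`. -/
structure CStarLin extends CStarCat.{u} where
  additive : toCStarCat.IsCountablyAdditive

namespace StarFunctor

variable {D : StarSemicat.{u}} {V W W' W'' : CStarCat.{u}}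

/-- Unitary multiplier natural transformations. -/
def Nat.IsUnitary {F G : StarFunctor D W} (τ : F.Nat G) : Prop :=
  Nat.comp (Nat.adj τ) τ = Nat.id F ∧ Nat.comp τ (Nat.adj τ) = Nat.id G

lemma comp_adj_id (X : W.Obj) :
    Mult.comp (Mult.id X) (Mult.adj (Mult.id X)) = Mult.id X := by
  rw [Mult.adj_id, Mult.id_comp]

lemma adj_comp_id (X : W.Obj) :
    Mult.comp (Mult.adj (Mult.id X)) (Mult.id X) = Mult.id X := by
  rw [Mult.adj_id, Mult.id_comp]

lemma id_comp_eq {X Y : W.Obj} {m n : W.Mult X Y} (h : m = n) :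
    Mult.comp (Mult.id Y) m = Mult.comp n (Mult.id X) := by
  rw [h, Mult.id_comp, Mult.comp_id]

/-- The canonical transformation `id ∘ F ⇒ F`, with identity components. -/
def postId (F : StarFunctor D W) : (F.post (LinFunctor.id W)).Nat F :=
  Nat.mk (fun X => Mult.id (F.obj X)) 1 (fun _ => Mult.norm_id_le _) fun _ _ f =>
    id_comp_eq (LinFunctor.id_ext (F.map f))

lemma postId_isUnitary (F : StarFunctor D W) : (postId F).IsUnitary :=
  ⟨Nat.ext fun X => adj_comp_id (F.obj X), Nat.ext fun X => comp_adj_id (F.obj X)⟩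

/-- The canonical transformation `(k ∘ h) ∘ F ⇒ k ∘ (h ∘ F)`, with identity components. -/
def postComp (k : LinFunctor W' W'') (h : LinFunctor W W') (F : StarFunctor D W) :
    (F.post (k.comp h)).Nat ((F.post h).post k) :=
  Nat.mk (fun X => Mult.id (k.1.obj (h.1.obj (F.obj X)))) 1 (fun _ => Mult.norm_id_le _)
    fun _ _ f => id_comp_eq (LinFunctor.comp_ext k h (F.map f))

lemma postComp_isUnitary (k : LinFunctor W' W'') (h : LinFunctor W W') (F : StarFunctor D W) :
    (postComp k h F).IsUnitary :=
  ⟨Nat.ext fun X => adj_comp_id (k.1.obj (h.1.obj (F.obj X))),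
    Nat.ext fun X => comp_adj_id (k.1.obj (h.1.obj (F.obj X)))⟩

/-- The canonical transformation `F ∘ id ⇒ F`, with identity components. -/
def idPost (F : LinFunctor V W) : ((LinFunctor.id V).1.post F).Nat F.1 :=
  Nat.mk (fun X => Mult.id (F.1.obj X)) 1 (fun _ => Mult.norm_id_le _) fun _ _ f =>
    id_comp_eq (F.ext_of f)

lemma idPost_isUnitary (F : LinFunctor V W) : (idPost F).IsUnitary :=
  ⟨Nat.ext fun X => adj_comp_id (F.1.obj X), Nat.ext fun X => comp_adj_id (F.1.obj X)⟩

end StarFunctor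

namespace LinFunctor

open StarFunctor

instance (V W : CStarCat.{u}) : Category.{u} (LinFunctor V W) where
  Hom F G := F.1.Nat G.1
  id F := Nat.id F.1
  comp τ σ := Nat.comp σ τ
  id_comp _ := Nat.ext fun _ => Mult.comp_id _
  comp_id _ := Nat.ext fun _ => Mult.id_comp _
  assoc _ _ _ := Nat.ext fun _ => (Mult.comp_assoc _ _ _).symm

/-- The isomorphism of `1`-morphisms given by a unitary `2`-morphism. -/
def unitaryIso {V W : CStarCat.{u}} {F G : LinFunctor V W} (τ : F.1.Nat G.1)
    (h : τ.IsUnitary) : F ≅ G where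
  hom := τ
  inv := Nat.adj τ
  hom_inv_id := h.1
  inv_hom_id := h.2

variable {V W W' W'' : CStarCat.{u}}

/-- Associativity of the composition of `1`-morphisms. -/
def assocIso (k : LinFunctor W' W'') (h : LinFunctor W W') (f : LinFunctor V W) :
    (k.comp h).comp f ≅ k.comp (h.comp f) :=
  unitaryIso (F := (k.comp h).comp f) (G := k.comp (h.comp f)) (postComp k h f.1)
    (postComp_isUnitary k h f.1)

/-- The left unit law for `1`-morphisms. -/
def leftIdIso (f : LinFunctor V W) : (LinFunctor.id W).comp f ≅ f :=
  unitaryIso (F := (LinFunctor.id W).comp f) (G := f) (postId f.1) (postId_isUnitary f.1)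

/-- The right unit law for `1`-morphisms. -/
def rightIdIso (f : LinFunctor V W) : f.comp (LinFunctor.id V) ≅ f :=
  unitaryIso (F := f.comp (LinFunctor.id V)) (G := f) (idPost f) (idPost_isUnitary f)

end LinFunctor

namespace CStarLin

open StarFunctor

instance : CategoryStruct.{u, u+1} CStarLin.{u} where
  Hom V W := LinFunctor V.toCStarCat W.toCStarCat
  id V := LinFunctor.id V.toCStarCat
  comp f g := LinFunctor.comp g f

lemma conj_id {W : CStarCat.{u}} {X Y : W.Obj} (m : W.Mult X Y) :
    m = Mult.comp (Mult.comp (Mult.adj (Mult.id Y)) m) (Mult.id X) := by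
  rw [Mult.adj_id, Mult.comp_id, Mult.id_comp]

lemma conj_id' {W : CStarCat.{u}} {X Y : W.Obj} (m : W.Mult X Y) :
    m = Mult.comp (Mult.comp (Mult.id Y) m) (Mult.adj (Mult.id X)) := by
  rw [Mult.adj_id, Mult.comp_id, Mult.id_comp]

lemma pentagon_aux {W W' : CStarCat.{u}} (i : LinFunctor W W') (Y : W.Obj) :
    Mult.comp (Mult.comp (Mult.adj (Mult.id (i.1.obj Y))) (Mult.adj (Mult.id (i.1.obj Y))))
      (i.ext (Mult.adj (Mult.id Y))) =
    Mult.comp (Mult.adj (Mult.id (i.1.obj Y))) (Mult.adj (Mult.id (i.1.obj Y))) := by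
  rw [Mult.adj_id, Mult.adj_id, i.ext_id, Mult.id_comp]
  exact Mult.comp_id _

lemma triangle_aux {W W' : CStarCat.{u}} (g : LinFunctor W W') (Y : W.Obj) :
    Mult.comp (Mult.id (g.1.obj Y)) (Mult.adj (Mult.id (g.1.obj Y))) = g.ext (Mult.id Y) := by
  rw [Mult.adj_id, g.ext_id, Mult.id_comp]

lemma id_pre {V W : CStarCat.{u}} {f g : LinFunctor V W} (η : f.1.Nat g.1) :
    Nat.pre η (LinFunctor.id V).1 =
      Nat.comp (Nat.comp (Nat.adj (idPost g)) η) (idPost f) := by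
  ext X : 1
  exact (Nat.pre_app η (LinFunctor.id V).1 X).trans (conj_id (η.app X))

/-- The bicategory `C*Lin`: `1`-morphisms `V → W` are nondegenerate linear `*`-functors
`V → M W`, and `2`-morphisms are multiplier natural transformations. -/
instance : Bicategory.{u, u} CStarLin.{u} where
  homCategory V W := inferInstanceAs (Category (LinFunctor V.toCStarCat W.toCStarCat))
  whiskerLeft f _ _ η := Nat.pre η f.1
  whiskerRight η h := Nat.post h η
  associator f g h := (LinFunctor.assocIso h g f).symm
  leftUnitor f := LinFunctor.rightIdIso f
  rightUnitor f := LinFunctor.leftIdIso f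
  whiskerLeft_id _ _ := Nat.ext fun _ => rfl
  whiskerLeft_comp _ _ _ _ _ _ := Nat.ext fun _ => rfl
  id_whiskerLeft η := id_pre η
  comp_whiskerLeft f g _ _ η := Nat.ext fun X => conj_id' (Nat.app η (g.1.obj (f.1.obj X)))
  id_whiskerRight f g := Nat.ext fun X => LinFunctor.ext_id g (f.1.obj X)
  comp_whiskerRight η θ i := Nat.ext fun X => LinFunctor.ext_comp i (Nat.app θ X) (Nat.app η X)
  whiskerRight_id η := Nat.ext fun X =>
    (LinFunctor.id_ext (Nat.app η X)).trans (conj_id (Nat.app η X))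
  whiskerRight_comp η g h := Nat.ext fun X =>
    (LinFunctor.comp_ext h g (Nat.app η X)).trans
      (conj_id (LinFunctor.ext h (LinFunctor.ext g (Nat.app η X))))
  whisker_assoc f _ _ η h := Nat.ext fun X => conj_id' (LinFunctor.ext h (Nat.app η (f.1.obj X)))
  whisker_exchange η θ := Nat.ext fun X => (Nat.naturality_ext θ (Nat.app η X)).symm
  pentagon f g h i := Nat.ext fun X => pentagon_aux i (h.1.obj (g.1.obj (f.1.obj X)))
  triangle f g := Nat.ext fun X => triangle_aux g (f.1.obj X)

end CStarLin
/-! ## The bicategory of unital `C*`-categories -/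

/-- A unital linear `*`-functor between unital `C*`-categories. -/
structure UStarFunctor (A B : UCStarCat.{u}) extends
    StarSemiFunctor A.toStarSemicat B.toStarSemicat where
  map_add : ∀ {X Y : A.Obj} (f g : A.Hom X Y), map (f + g) = map f + map g
  map_smul : ∀ {X Y : A.Obj} (c : ℂ) (f : A.Hom X Y), map (c • f) = c • map f
  map_id : ∀ X : A.Obj, map (A.id X) = B.id (obj X)

namespace UStarFunctor

variable {A B C : UCStarCat.{u}}

/-- The identity functor. -/
def id (A : UCStarCat.{u}) : UStarFunctor A A where
  obj X := X
  map f := f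
  map_comp _ _ := rfl
  map_adj _ := rfl
  map_add _ _ := rfl
  map_smul _ _ := rfl
  map_id _ := rfl

/-- The composite functor `G ∘ F`. -/
def comp (G : UStarFunctor B C) (F : UStarFunctor A B) : UStarFunctor A C where
  obj X := G.obj (F.obj X)
  map f := G.map (F.map f)
  map_comp g f := by rw [F.map_comp, G.map_comp]
  map_adj f := by rw [F.map_adj, G.map_adj]
  map_add f g := by rw [F.map_add, G.map_add]
  map_smul c f := by rw [F.map_smul, G.map_smul]
  map_id X := by rw [F.map_id, G.map_id]

/-- Uniformly bounded natural transformations. -/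
@[ext] structure Trans (F G : UStarFunctor A B) where
  app : ∀ X : A.Obj, B.Hom (F.obj X) (G.obj X)
  bounded : ∃ C : ℝ, ∀ X : A.Obj, ‖app X‖ ≤ C
  naturality : ∀ {X Y : A.Obj} (f : A.Hom X Y),
    B.comp (app Y) (F.map f) = B.comp (G.map f) (app X)

lemma _root_.UCStarCat.norm_id_le (X : A.Obj) : ‖A.id X‖ ≤ 1 := by
  have h := A.norm_adj_comp (A.id X)
  rw [A.comp_id, A.norm_adj] at h
  nlinarith [norm_nonneg (A.id X)]

lemma norm_map_le (F : UStarFunctor A B) {X Y : A.Obj} (f : A.Hom X Y) : ‖F.map f‖ ≤ ‖f‖ := by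
  have h : ‖F.map (A.comp (A.adj f) f)‖ ≤ ‖A.comp (A.adj f) f‖ := by
    let _ : NonUnitalCStarAlgebra (A.Hom X X) := A.endAlgebra X
    let _ : NonUnitalCStarAlgebra (B.Hom (F.obj X) (F.obj X)) := B.endAlgebra (F.obj X)
    let φ : A.Hom X X →⋆ₙₐ[ℂ] B.Hom (F.obj X) (F.obj X) :=
      { toFun := fun a => F.map a
        map_smul' := fun c a => F.map_smul c a
        map_zero' := by simpa using F.map_smul 0 (0 : A.Hom X X)
        map_add' := fun a b => F.map_add a b
        map_mul' := fun a b => F.map_comp a b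
        map_star' := fun a => F.map_adj a }
    exact NonUnitalStarAlgHom.norm_apply_le φ _
  rw [F.map_comp, F.map_adj, B.norm_adj_comp, A.norm_adj_comp] at h
  exact (pow_le_pow_iff_left₀ (norm_nonneg _) (norm_nonneg _) two_ne_zero).1 h

namespace Trans

variable {F G H : UStarFunctor A B}

/-- Vertical composition. -/
def comp (σ : Trans G H) (τ : Trans F G) : Trans F H where
  app X := B.comp (σ.app X) (τ.app X)
  bounded := by
    obtain ⟨C, hC⟩ := σ.bounded
    obtain ⟨D, hD⟩ := τ.bounded
    exact ⟨C * D, fun X => (B.norm_comp_le _ _).trans (mul_le_mul (hC X) (hD X) (norm_nonneg _)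
      ((norm_nonneg _).trans (hC X)))⟩
  naturality f := by
    rw [B.comp_assoc, τ.naturality, ← B.comp_assoc, σ.naturality, B.comp_assoc]

/-- The identity transformation. -/
def id (F : UStarFunctor A B) : Trans F F where
  app X := B.id (F.obj X)
  bounded := ⟨1, fun X => B.norm_id_le (F.obj X)⟩
  naturality f := by rw [B.id_comp, B.comp_id]

/-- Whiskering with a functor on the source side. -/
def pre {K L : UStarFunctor B C} (τ : Trans K L) (F : UStarFunctor A B) :
    Trans (K.comp F) (L.comp F) where
  app X := τ.app (F.obj X)
  bounded := by
    obtain ⟨C, hC⟩ := τ.bounded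
    exact ⟨C, fun X => hC _⟩
  naturality f := τ.naturality (F.map f)

/-- Whiskering with a functor on the target side. -/
def post (K : UStarFunctor B C) (τ : Trans F G) : Trans (K.comp F) (K.comp G) where
  app X := K.map (τ.app X)
  bounded := by
    obtain ⟨C, hC⟩ := τ.bounded
    exact ⟨C, fun X => (K.norm_map_le _).trans (hC X)⟩
  naturality f := by
    exact ((K.map_comp _ _).symm.trans (congrArg K.map (τ.naturality f))).trans (K.map_comp _ _)

/-- The pointwise adjoint. -/
def adj (τ : Trans F G) : Trans G F where
  app X := B.adj (τ.app X)
  bounded := by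
    obtain ⟨C, hC⟩ := τ.bounded
    exact ⟨C, fun X => (B.norm_adj _).trans_le (hC X)⟩
  naturality f := by
    have := congrArg B.adj (τ.naturality (A.adj f))
    rw [B.adj_comp, B.adj_comp, F.map_adj, G.map_adj, B.adj_adj, B.adj_adj] at this
    exact this.symm

/-- Unitary natural transformations. -/
def IsUnitary (τ : Trans F G) : Prop := ∀ X : A.Obj,
  B.comp (B.adj (τ.app X)) (τ.app X) = B.id (F.obj X) ∧
  B.comp (τ.app X) (B.adj (τ.app X)) = B.id (G.obj X)

end Trans

instance (A B : UCStarCat.{u}) : Category.{u} (UStarFunctor A B) where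
  Hom F G := Trans F G
  id F := Trans.id F
  comp τ σ := Trans.comp σ τ
  id_comp _ := Trans.ext (funext fun _ => B.comp_id _)
  comp_id _ := Trans.ext (funext fun _ => B.id_comp _)
  assoc _ _ _ := Trans.ext (funext fun _ => (B.comp_assoc _ _ _).symm)

/-- The isomorphism given by a unitary natural transformation. -/
def unitaryIso {F G : UStarFunctor A B} (τ : Trans F G) (h : τ.IsUnitary) : F ≅ G where
  hom := τ
  inv := Trans.adj τ
  hom_inv_id := Trans.ext (funext fun X => (h X).1)
  inv_hom_id := Trans.ext (funext fun X => (h X).2)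

/-- An equivalence of (unital) `C*`-categories: a unital linear `*`-functor `F` for which there
are a unital linear `*`-functor `G` in the opposite direction and unitary natural isomorphisms
`G ∘ F ≅ id` and `F ∘ G ≅ id`. -/
def IsEquivalence (F : UStarFunctor A B) : Prop :=
  ∃ G : UStarFunctor B A,
    (∃ τ : Trans (G.comp F) (UStarFunctor.id A), τ.IsUnitary) ∧
    (∃ τ : Trans (F.comp G) (UStarFunctor.id B), τ.IsUnitary)

end UStarFunctor

namespace UCStarCat

open UStarFunctor

lemma id_comp_id_comp {A : UCStarCat.{u}} {X Y : A.Obj} (m : A.Hom X Y) :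
    m = A.comp (A.comp (A.id Y) m) (A.id X) := by
  rw [A.comp_id, A.id_comp]

/-- The (strict) bicategory of small unital `C*`-categories, unital linear `*`-functors and
uniformly bounded natural transformations. -/
instance : Bicategory.{u, u} UCStarCat.{u} where
  Hom A B := UStarFunctor A B
  id A := UStarFunctor.id A
  comp F G := UStarFunctor.comp G F
  homCategory A B := inferInstanceAs (Category (UStarFunctor A B))
  whiskerLeft F _ _ τ := Trans.pre τ F
  whiskerRight τ G := Trans.post G τ
  associator F G H := Iso.refl (H.comp (G.comp F))
  leftUnitor F := Iso.refl F
  rightUnitor F := Iso.refl F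
  whiskerLeft_id _ _ := rfl
  whiskerLeft_comp _ _ _ _ _ _ := rfl
  id_whiskerLeft {A B F G} τ := Trans.ext (funext fun X => id_comp_id_comp (Trans.app τ X))
  comp_whiskerLeft F G _ _ τ :=
    Trans.ext (funext fun X => id_comp_id_comp (Trans.app τ (G.obj (F.obj X))))
  id_whiskerRight F G := Trans.ext (funext fun X => G.map_id (F.obj X))
  comp_whiskerRight σ τ G :=
    Trans.ext (funext fun X => G.map_comp (Trans.app τ X) (Trans.app σ X))
  whiskerRight_id τ := Trans.ext (funext fun X => id_comp_id_comp (Trans.app τ X))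
  whiskerRight_comp τ G H :=
    Trans.ext (funext fun X => id_comp_id_comp (H.map (G.map (Trans.app τ X))))
  whisker_assoc F _ _ τ H :=
    Trans.ext (funext fun X => id_comp_id_comp (H.map (Trans.app τ (F.obj X))))
  whisker_exchange σ τ := Trans.ext (funext fun X => (Trans.naturality τ (Trans.app σ X)).symm)
  pentagon {_ _ _ _ E} F G H K := Trans.ext (funext fun X =>
    (congrArg (fun m => E.comp (E.comp (E.id _) (E.id _)) m) (K.map_id _)).trans
      (E.comp_id _))
  triangle {_ _ C} F G := Trans.ext (funext fun X => (C.comp_id _).trans (G.map_id _).symm)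

end UCStarCat
/-! ## The pseudofunctors `C*Lin(V, -)` and `C*Bilin(V₁, V₂; -)` -/

/-- A class of functors `D → M W`, for varying `W`, which is closed under composition with
nondegenerate linear `*`-functors `W → M W'`. -/
structure FunctorClass (D : StarSemicat.{u}) where
  mem : ∀ W : CStarCat.{u}, StarFunctor D W → Prop
  post : ∀ {W W' : CStarCat.{u}} (h : LinFunctor W W') {F : StarFunctor D W},
    mem W F → mem W' (F.post h)

namespace FunctorClass

open StarFunctor

variable {D : StarSemicat.{u}} (P : FunctorClass D) {W W' W'' : CStarCat.{u}}

/-- The unital `C*`-category of functors `D → M W` in the class. -/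
abbrev cat (W : CStarCat.{u}) : UCStarCat.{u} := funCat (P.mem W)

/-- Composition with `h : W → M W'`. -/
def postFunctor (h : LinFunctor W W') : UStarFunctor (P.cat W) (P.cat W') where
  obj F := ⟨F.1.post h, P.post h F.2⟩
  map τ := Nat.post h τ
  map_comp σ τ := Nat.ext fun X => h.ext_comp (Nat.app σ X) (Nat.app τ X)
  map_adj τ := Nat.ext fun X => h.ext_adj (Nat.app τ X)
  map_add σ τ := Nat.ext fun X => h.ext_add (Nat.app σ X) (Nat.app τ X)
  map_smul c τ := Nat.ext fun X => h.ext_smul c (Nat.app τ X)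
  map_id F := Nat.ext fun X => h.ext_id (F.1.obj X)

/-- The transformation induced by a `2`-morphism. -/
def postTrans {h k : LinFunctor W W'} (η : h.1.Nat k.1) :
    UStarFunctor.Trans (P.postFunctor h) (P.postFunctor k) where
  app F := Nat.pre η F.1
  bounded := ⟨‖η‖, fun F => Nat.norm_le (norm_nonneg _) fun X => η.norm_app_le (F.1.obj X)⟩
  naturality τ := Nat.ext fun X => Nat.naturality_ext η (Nat.app τ X)

/-- The unit constraint, with identity components. -/
def postIdTrans (W : CStarCat.{u}) :
    UStarFunctor.Trans (P.postFunctor (LinFunctor.id W)) (UStarFunctor.id (P.cat W)) where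
  app F := postId F.1
  bounded := ⟨1, fun F => Nat.norm_le zero_le_one fun X => Mult.norm_id_le (F.1.obj X)⟩
  naturality τ := Nat.ext fun X => id_comp_eq (LinFunctor.id_ext (Nat.app τ X))

lemma postIdTrans_isUnitary (W : CStarCat.{u}) : (P.postIdTrans W).IsUnitary :=
  fun F => postId_isUnitary F.1

/-- The composition constraint, with identity components. -/
def postCompTrans (k : LinFunctor W' W'') (h : LinFunctor W W') :
    UStarFunctor.Trans (P.postFunctor (k.comp h)) ((P.postFunctor k).comp (P.postFunctor h)) where
  app F := postComp k h F.1
  bounded := ⟨1, fun F => Nat.norm_le zero_le_one fun X =>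
    Mult.norm_id_le (k.1.obj (h.1.obj (F.1.obj X)))⟩
  naturality τ := Nat.ext fun X => id_comp_eq (LinFunctor.comp_ext k h (Nat.app τ X))

lemma postCompTrans_isUnitary (k : LinFunctor W' W'') (h : LinFunctor W W') :
    (P.postCompTrans k h).IsUnitary :=
  fun F => postComp_isUnitary k h F.1

lemma assoc_aux (h : LinFunctor W W') (Y : W.Obj) :
    Mult.adj (Mult.id (h.1.obj Y)) =
      Mult.comp (Mult.comp (Mult.comp (Mult.comp (Mult.adj (Mult.id (h.1.obj Y)))
        (Mult.adj (Mult.id (h.1.obj Y)))) (Mult.id (h.1.obj Y))) (h.ext (Mult.id Y)))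
          (Mult.id (h.1.obj Y)) := by
  rw [Mult.adj_id, h.ext_id]
  simp only [Mult.comp_id]

lemma unitor_aux (h : LinFunctor W W') (Y : W.Obj) :
    Mult.id (h.1.obj Y) = Mult.comp (Mult.comp (Mult.id (h.1.obj Y)) (h.ext (Mult.id Y)))
      (Mult.id (h.1.obj Y)) := by
  rw [h.ext_id]
  simp only [Mult.comp_id]

lemma unitor_aux' (Y : W.Obj) :
    Mult.id Y = Mult.comp (Mult.comp (Mult.id Y) (Mult.id Y)) (Mult.id Y) := by
  simp only [Mult.comp_id]

/-- The pseudofunctor `W ↦ P.cat W` from `C*Lin` to unital `C*`-categories, given by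
composition. -/
def pseudofunctor : CStarLin.{u} ⥤ᵖ UCStarCat.{u} where
  obj W := P.cat W.toCStarCat
  map h := P.postFunctor h
  map₂ η := P.postTrans η
  mapId W := UStarFunctor.unitaryIso (P.postIdTrans W.toCStarCat) (P.postIdTrans_isUnitary _)
  mapComp h k := UStarFunctor.unitaryIso (P.postCompTrans k h) (P.postCompTrans_isUnitary k h)
  map₂_id _ := UStarFunctor.Trans.ext (funext fun _ => Nat.ext fun _ => rfl)
  map₂_comp _ _ := UStarFunctor.Trans.ext (funext fun _ => Nat.ext fun _ => rfl)
  map₂_whisker_left f _ _ η := UStarFunctor.Trans.ext (funext fun F => Nat.ext fun X =>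
    CStarLin.conj_id (Nat.app η (f.1.obj (F.1.obj X))))
  map₂_whisker_right η k := UStarFunctor.Trans.ext (funext fun F => Nat.ext fun X =>
    CStarLin.conj_id (LinFunctor.ext k (Nat.app η (F.1.obj X))))
  map₂_associator f g h := UStarFunctor.Trans.ext (funext fun F => Nat.ext fun X =>
    assoc_aux h (g.1.obj (f.1.obj (F.1.obj X))))
  map₂_left_unitor f := UStarFunctor.Trans.ext (funext fun F => Nat.ext fun X =>
    unitor_aux f (F.1.obj X))
  map₂_right_unitor f := UStarFunctor.Trans.ext (funext fun F => Nat.ext fun X =>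
    unitor_aux' (f.1.obj (F.1.obj X)))

end FunctorClass

namespace CStarCat

open StarFunctor

/-- The pseudofunctor `C*Lin(V, -)`. -/
def linFrom (V : CStarCat.{u}) : CStarLin.{u} ⥤ᵖ UCStarCat.{u} :=
  FunctorClass.pseudofunctor (D := V.toStarSemicat)
    { mem := fun _ F => F.IsLinear ∧ F.Nondegenerate
      post := fun h _ hF => ⟨hF.1.post h, hF.2.post h⟩ }

/-- The pseudofunctor `C*Bilin(V₁, V₂; -)`. -/
def bilinFrom (V₁ V₂ : CStarCat.{u}) : CStarLin.{u} ⥤ᵖ UCStarCat.{u} :=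
  FunctorClass.pseudofunctor (D := V₁.toStarSemicat.prod V₂.toStarSemicat)
    { mem := fun _ F => F.IsBilinear ∧ F.Nondegenerate
      post := fun h _ hF => ⟨IsBilinear.post h hF.1, hF.2.post h⟩ }

/-- The canonical bilinear `*`-functor `V₁ × V₂ → V₁ ⊠_max V₂`, sending `(X₁, X₂)` to the object
`((X₁, X₂), id)` of the subobject completion and `(f₁, f₂)` to `f₁ ⊗ f₂`. -/
def boxFunctor (V₁ V₂ : CStarCat.{u}) :
    StarSemiFunctor (V₁.toStarSemicat.prod V₂.toStarSemicat) (boxMax V₁ V₂).toStarSemicat where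
  obj X := ⟨X, Mult.id (V := maxTensor V₁ V₂) X, Mult.id_comp _, Mult.adj_id _⟩
  map f := ⟨MaxHom.ofAlg (AlgHom.tmul f.1 f.2), rfl, rfl⟩
  map_comp g f := Subtype.ext (by
    exact (MaxHom.compL_ofAlg (AlgHom.tmul g.1 g.2) (AlgHom.tmul f.1 f.2)).symm)
  map_adj f := Subtype.ext (by exact (MaxHom.adjL_ofAlg (AlgHom.tmul f.1 f.2)).symm)

end CStarCat
/-! ## Composition with the canonical bilinear functor -/

namespace StarFunctor

variable {C D : StarSemicat.{u}} {W : CStarCat.{u}}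

/-- The composite of `F : D → M W` with a `*`-functor `b : C → D`. -/
def precomp (F : StarFunctor D W) (b : StarSemiFunctor C D) : StarFunctor C W where
  obj X := F.obj (b.obj X)
  map f := F.map (b.map f)
  map_comp g f := (congrArg F.map (b.map_comp g f)).trans (F.map_comp _ _)
  map_adj f := (congrArg F.map (b.map_adj f)).trans (F.map_adj _)

/-- The horizontal composite `τ * id_b`. -/
def Nat.precomp {F G : StarFunctor D W} (τ : F.Nat G) (b : StarSemiFunctor C D) :
    (F.precomp b).Nat (G.precomp b) :=
  Nat.mk (fun X => τ.app (b.obj X)) ‖τ‖ (fun X => τ.norm_app_le (b.obj X))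
    fun _ _ f => τ.naturality (b.map f)

end StarFunctor

namespace CStarCat

open StarFunctor

variable {V₁ V₂ W : CStarCat.{u}}

lemma isBilinear_precomp (F : LinFunctor (boxMax V₁ V₂) W) :
    (F.1.precomp (boxFunctor V₁ V₂)).IsBilinear := fun {X Y} => by
  have add : ∀ s t r : AlgHom V₁ V₂ X Y, r = s + t →
      F.1.map (X := (boxFunctor V₁ V₂).obj X) (Y := (boxFunctor V₁ V₂).obj Y)
        ⟨MaxHom.ofAlg r, rfl, rfl⟩ =
      F.1.map (X := (boxFunctor V₁ V₂).obj X) (Y := (boxFunctor V₁ V₂).obj Y)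
        ⟨MaxHom.ofAlg s, rfl, rfl⟩ +
      F.1.map (X := (boxFunctor V₁ V₂).obj X) (Y := (boxFunctor V₁ V₂).obj Y)
        ⟨MaxHom.ofAlg t, rfl, rfl⟩ := by
    rintro s t r rfl
    refine (congrArg F.1.map (Subtype.ext ?_)).trans (F.2.1.1 _ _)
    exact map_add MaxHom.ofAlg s t
  have smul : ∀ (c : ℂ) (s r : AlgHom V₁ V₂ X Y), r = c • s →
      F.1.map (X := (boxFunctor V₁ V₂).obj X) (Y := (boxFunctor V₁ V₂).obj Y)
        ⟨MaxHom.ofAlg r, rfl, rfl⟩ =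
      c • F.1.map (X := (boxFunctor V₁ V₂).obj X) (Y := (boxFunctor V₁ V₂).obj Y)
        ⟨MaxHom.ofAlg s, rfl, rfl⟩ := by
    rintro c s r rfl
    refine (congrArg F.1.map (Subtype.ext ?_)).trans (F.2.1.2 _ _)
    exact map_smul MaxHom.ofAlg c s
  exact ⟨fun f f' g => add _ _ _ (TensorProduct.add_tmul f f' g),
    fun c f g => smul c _ _ (TensorProduct.smul_tmul' c f g).symm,
    fun f g g' => add _ _ _ (TensorProduct.tmul_add f g g'),
    fun c f g => smul c _ _ (TensorProduct.tmul_smul c f g)⟩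

lemma nondegenerate_precomp (F : LinFunctor (boxMax V₁ V₂) W) :
    (F.1.precomp (boxFunctor V₁ V₂)).Nondegenerate := by
  set b := boxFunctor V₁ V₂ with hb
  suffices key : ∀ (X : V₁.Obj × V₂.Obj) (Z : W.Obj),
      Dense (Submodule.span ℂ {w : W.Hom Z (F.1.obj (b.obj X)) |
        ∃ (f : V₁.Hom X.1 X.1 × V₂.Hom X.2 X.2) (v : W.Hom Z (F.1.obj (b.obj X))),
          w = (F.1.map (b.map (X := X) (Y := X) f)).act v} :
            Set (W.Hom Z (F.1.obj (b.obj X)))) from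
    .of_act fun X Z => key X Z
  intro X Z
  set K := Submodule.span ℂ {w : W.Hom Z (F.1.obj (b.obj X)) |
    ∃ (f : V₁.Hom X.1 X.1 × V₂.Hom X.2 X.2) (v : W.Hom Z (F.1.obj (b.obj X))),
      w = (F.1.map (b.map (X := X) (Y := X) f)).act v} with hK
  rw [← dense_closure]
  refine (F.2.2.dense_act (b.obj X) Z).mono ?_
  rw [← Submodule.topologicalClosure_coe]
  refine Submodule.span_le.2 ?_
  rintro _ ⟨⟨a, ha⟩, v, rfl⟩
  have hc : Continuous fun a : MaxHom V₁ V₂ X X =>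
      (F.1.map (X := b.obj X) (Y := b.obj X) ⟨a, rfl, rfl⟩).act v :=
    (F.continuous_map_act (X := b.obj X) (Y := b.obj X) v).comp
      (Continuous.subtype_mk continuous_id _)
  refine map_mem_closure (s := Set.range (MaxHom.ofAlg : AlgHom V₁ V₂ X X → _)) hc
    (MaxHom.dense_ofAlg a) ?_
  rintro _ ⟨t, rfl⟩
  induction t using AlgHom.induction with
  | h0 =>
    have : F.1.map (X := b.obj X) (Y := b.obj X)
        ⟨MaxHom.ofAlg (0 : AlgHom V₁ V₂ X X), rfl, rfl⟩ = 0 :=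
      (congrArg F.1.map (Subtype.ext (map_zero (MaxHom.ofAlg (X := X) (Y := X))))).trans (F.map_zero _ _)
    exact (congrArg (fun m => Mult.act m v ∈ K) this).mpr K.zero_mem
  | h1 f₁ f₂ => exact Submodule.subset_span ⟨(f₁, f₂), v, rfl⟩
  | h2 s t hs ht =>
    have : F.1.map (X := b.obj X) (Y := b.obj X) ⟨MaxHom.ofAlg (s + t), rfl, rfl⟩ =
        F.1.map (X := b.obj X) (Y := b.obj X) ⟨MaxHom.ofAlg s, rfl, rfl⟩ +
        F.1.map (X := b.obj X) (Y := b.obj X) ⟨MaxHom.ofAlg t, rfl, rfl⟩ :=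
      (congrArg F.1.map (Subtype.ext (map_add MaxHom.ofAlg s t))).trans (F.2.1.1 _ _)
    exact (congrArg (fun m => Mult.act m v ∈ K) this).mpr (K.add_mem hs ht)

/-- The linear `*`-functor `C*Lin(V₁ ⊠_max V₂, W) → C*Bilin(V₁, V₂; W)` given by composition with
the canonical bilinear functor `V₁ × V₂ → V₁ ⊠_max V₂`. -/
def precompBox (V₁ V₂ W : CStarCat.{u}) : UStarFunctor (Lin (boxMax V₁ V₂) W) (Bilin V₁ V₂ W) where
  obj F := ⟨F.1.precomp (boxFunctor V₁ V₂), isBilinear_precomp F, nondegenerate_precomp F⟩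
  map τ := Nat.precomp τ (boxFunctor V₁ V₂)
  map_comp _ _ := Nat.ext fun _ => rfl
  map_adj _ := Nat.ext fun _ => rfl
  map_add _ _ := Nat.ext fun _ => rfl
  map_smul _ _ := Nat.ext fun _ => rfl
  map_id _ := Nat.ext fun _ => rfl

end CStarCat

end

/-!
The tensor product `V₁ ⊠_max V₂` is the subobject completion of `V₁ ⊡_max V₂`, and both steps of
this construction have a universal property for functors into multiplier categories.

*The maximal norm.* A nondegenerate bilinear `*`-functor `b : V₁ × V₂ → M W` factors through the
algebraic tensor product, and the factorization is contractive for the maximal norm. Indeed, the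
norm of a multiplier `m : A → B` is the supremum of the `‖m w‖` over contractions `w : Z → A`, and
for each `w` some positive functional `φ` of norm at most one on `W(Z, Z)` satisfies
`φ((m w)* (m w)) = ‖m w‖²`. Applying `M W` to the Hilbert spaces obtained from the modules
`W(Z, Y)` with the inner product `φ(f* g)` turns `b` into one of the representations which define
the maximal norm (`IsBilinear.tensorRep`, `IsBilinear.norm_alg_le`). By continuity `b` extends to
a nondegenerate linear `*`-functor on `V₁ ⊡_max V₂` (`IsBilinear.maxFunctor`).

*The subobject completion.* A nondegenerate linear `*`-functor `H : V → M W` with `W` subobject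
complete extends to pairs `(X, p)`: choose a splitting `ι ι* = H(p)` and send `f` to `ι* H(f) ι`
(`LinFunctor.split`). Transformations are determined by, and extend from, their components at the
objects `(x, id)`, since `(X, p)` embeds isometrically into `(X, id)` by a multiplier and
transformations are natural for multipliers (`exists_nat_split`).

Together these facts say that composition with the canonical bilinear functor is fully faithful, and
surjective on objects up to unitary isomorphism (`precompBox_map_bijective`,
`exists_unitary_precompBox`), so it is an equivalence. It commutes strictly with composition with
functors `W → M W'`, which gives the pseudonatural transformation (`precompBoxStrongTrans`).

*Countable additivity.* Multipliers `m₁`, `m₂` have a tensor product `m₁ ⊗ m₂`, bounded because it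
is a pointwise limit of elementary tensors of morphisms (`AlgHom.norm_act_le`). Given countably many
objects `((x i, y i), p i)`, let `ι i` and `κ i` be the inclusions into the direct sums of the `x i`
and of the `y i`. The partial isometries `(ι i ⊗ κ i) ∘ p i` have orthogonal ranges, whose
projections are strictly summable because they are dominated by the summable `ι i ι i* ⊗ 1`; the sum
is a projection in the tensor product of the two direct sums, and the subobject it defines is the
required direct sum (`isCountablyAdditive_boxMax`).
-/

noncomputable section

/-! ### Adjointable families are multipliers -/

namespace CStarCat.Mult

variable {V : CStarCat.{u}} {X Y Z : V.Obj}

/-- An adjointable family of maps on the right modules `V(-, X) → V(-, Y)` is a multiplier: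
linearity and compatibility with composition follow from the adjointness relation. -/
def ofAdjointable (L : ∀ Z : V.Obj, V.Hom Z X → V.Hom Z Y) (L' : ∀ Z : V.Obj, V.Hom Z Y → V.Hom Z X)
    (C : ℝ) (hL : ∀ Z f, ‖L Z f‖ ≤ C * ‖f‖) (hL' : ∀ Z f, ‖L' Z f‖ ≤ C * ‖f‖)
    (h : ∀ (Z Z' : V.Obj) (w : V.Hom Z X) (v : V.Hom Z' Y),
      V.comp (V.adj v) (L Z w) = V.comp (V.adj (L' Z' v)) w) : V.Mult X Y :=
  have h' : ∀ (Z Z' : V.Obj) (w : V.Hom Z X) (g : V.Hom Y Z'),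
      V.comp g (L Z w) = V.comp (V.adj (L' Z' (V.adj g))) w := fun Z Z' w g => by
    simpa [V.adj_adj] using h Z Z' w (V.adj g)
  have hr : ∀ (Z Z' : V.Obj) (g : V.Hom Y Z') (w : V.Hom Z X),
      V.comp (V.adj (L' Z' (V.adj g))) w = V.comp g (L Z w) := fun Z Z' g w => (h' Z Z' w g).symm
  mk (fun Z =>
      { toFun := L Z
        map_add' := fun f g => V.ext_left fun T k => by
          simp only [V.comp_add, h']
        map_smul' := fun c f => V.ext_left fun T k => by
          simp only [V.comp_smul, h', RingHom.id_apply] })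
    (fun Z =>
      { toFun := fun g => V.adj (L' Z (V.adj g))
        map_add' := fun f g => V.ext_right fun T k => by
          simp only [V.add_comp, hr]
        map_smul' := fun c f => V.ext_right fun T k => by
          simp only [V.smul_comp, hr, RingHom.id_apply] })
    C hL
    (fun Z f => by
      change ‖V.adj (L' Z (V.adj f))‖ ≤ _
      rw [V.norm_adj, ← V.norm_adj f]; exact hL' _ _)
    (fun _ _ f g => V.ext_left fun T k => by
      change V.comp k (L _ _) = V.comp k (V.comp (L _ _) g)
      rw [h', ← V.comp_assoc, ← V.comp_assoc, h'])
    (fun _ _ f g => V.ext_right fun T k => by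
      change V.comp (V.adj (L' _ _)) k = V.comp (V.comp f (V.adj (L' _ _))) k
      rw [hr, V.comp_assoc, V.comp_assoc, hr])
    (fun _ _ f g => h' _ _ _ _)

section
variable (L : ∀ Z : V.Obj, V.Hom Z X → V.Hom Z Y) (L' : ∀ Z : V.Obj, V.Hom Z Y → V.Hom Z X)
    (C : ℝ) (hL : ∀ Z f, ‖L Z f‖ ≤ C * ‖f‖) (hL' : ∀ Z f, ‖L' Z f‖ ≤ C * ‖f‖)
    (h : ∀ (Z Z' : V.Obj) (w : V.Hom Z X) (v : V.Hom Z' Y),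
      V.comp (V.adj v) (L Z w) = V.comp (V.adj (L' Z' v)) w)

@[simp] lemma ofAdjointable_adj_act {T : V.Obj} (f : V.Hom T Y) :
    (adj (ofAdjointable L L' C hL hL' h)).act f = L' T f := by
  change V.adj (V.adj (L' T (V.adj (V.adj f)))) = _
  rw [V.adj_adj, V.adj_adj]

end

/-- A multiplier and its adjoint satisfy the adjointness relation `v* (F w) = (F* v)* w`. -/
lemma adj_comp_act_eq (F : V.Mult X Y) {T T' : V.Obj} (w : V.Hom T X) (v : V.Hom T' Y) :
    V.comp (V.adj v) (F.act w) = V.comp (V.adj ((adj F).act v)) w := by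
  rw [F.comp_act, adj_act, V.adj_adj]

lemma coact_eq_adj_act (F : V.Mult X Y) {T : V.Obj} (g : V.Hom Y T) :
    F.coact g = V.adj ((adj F).act (V.adj g)) := by
  rw [adj_act, V.adj_adj, V.adj_adj]

lemma comp_zero (G : V.Mult Y Z) : comp G (0 : V.Mult X Y) = 0 := (pre V).comp_zero (X := X) G

lemma zero_comp (F : V.Mult X Y) : comp (0 : V.Mult Y Z) F = 0 := (pre V).zero_comp (Z := Z) F

lemma adj_zero : adj (0 : V.Mult X Y) = 0 := (pre V).adj_zero (X := X) (Y := Y)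

lemma norm_adj (F : V.Mult X Y) : ‖adj F‖ = ‖F‖ := (pre V).norm_adj F

/-- Isometries have norm at most one. -/
lemma norm_le_one_of_adj_comp {F : V.Mult X Y} (h : comp (adj F) F = id X) : ‖F‖ ≤ 1 := by
  have h1 := norm_adj_comp F
  rw [h] at h1
  have h2 := norm_id_le (V := V) X
  nlinarith [norm_nonneg F]

lemma norm_le_one_of_proj {F : V.Mult X X} (h : V.IsProj F) : ‖F‖ ≤ 1 := by
  have h1 := norm_adj_comp F
  rw [h.2, h.1] at h1
  nlinarith [norm_nonneg F]

end CStarCat.Mult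

/-- An approximate unit acts as one through any nondegenerate functor. -/
lemma LinFunctor.exists_approx_unit {V W : CStarCat.{u}} (F : LinFunctor V W) (X : V.Obj) :
    ∃ l : Filter (V.Hom X X), l.NeBot ∧ ∀ (Z : W.Obj) (w : W.Hom Z (F.1.obj X)),
      Tendsto (fun e => (F.1.map e).act w) l (𝓝 w) := by
  obtain ⟨l, hl, hl1, hl2⟩ := V.exists_approx_unit X
  refine ⟨l, hl, fun Z w => ?_⟩
  refine (F.2.2.dense_act X Z).induction (P := fun w =>
    Tendsto (fun e => (F.1.map e).act w) l (𝓝 w)) ?_ ?_ w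
  · intro w hw
    refine Submodule.span_induction (p := fun w _ =>
      Tendsto (fun e => (F.1.map e).act w) l (𝓝 w)) ?_ ?_ ?_ ?_ hw
    · rintro _ ⟨f, v, rfl⟩
      have := ((F.continuous_map_act v).tendsto f).comp (hl2 X f)
      refine this.congr fun e => ?_
      simp only [Function.comp, F.1.map_comp, CStarCat.Mult.comp_act']
    · simpa only [CStarCat.Mult.act_zero] using tendsto_const_nhds
    · intro x y _ _ hx hy
      simpa only [CStarCat.Mult.act_add] using hx.add hy
    · intro c x _ hx
      simpa only [CStarCat.Mult.act_smul] using hx.const_smul c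
  · refine isClosed_of_closure_subset fun w hw => ?_
    rw [Metric.mem_closure_iff] at hw
    refine Metric.tendsto_nhds.2 fun r hr => ?_
    obtain ⟨v, hv, hwv⟩ := hw (r / 3) (by positivity)
    filter_upwards [hl1, Metric.tendsto_nhds.1 hv (r / 3) (by positivity)] with e he hev
    have h1 : dist ((F.1.map e).act w) ((F.1.map e).act v) ≤ dist w v := by
      rw [dist_eq_norm, dist_eq_norm, ← CStarCat.Mult.act_sub]
      refine (CStarCat.Mult.norm_act_le _ _).trans (mul_le_of_le_one_left (norm_nonneg _) ?_)
      exact (F.norm_map_le e).trans he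
    have := dist_triangle4 ((F.1.map e).act w) ((F.1.map e).act v) v w
    rw [dist_comm v w] at this
    linarith

/-! ### Norming positive functionals -/

section States

attribute [local instance] CStarAlgebra.spectralOrder CStarAlgebra.spectralOrderedRing

/-- A contractive functional on a unital `C*`-algebra with value `1` at the unit is positive. -/
lemma nonneg_of_norm_le_one_of_map_one {A : Type*} [CStarAlgebra A] (φ : A →L[ℂ] ℂ)
    (hφ : ‖φ‖ ≤ 1) (h1 : φ 1 = 1) (c : A) :
    0 ≤ (φ (star c * c)).re ∧ (φ (star c * c)).im = 0 := by
  have hle : ∀ x, ‖φ x‖ ≤ ‖x‖ := fun x => (φ.le_opNorm x).trans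
    (mul_le_of_le_one_left (norm_nonneg _) hφ)
  have him : ∀ a : A, IsSelfAdjoint a → (φ a).im = 0 := by
    intro a ha
    -- compare `|φ (a + i t)|²` with `‖a + i t‖² ≤ ‖a‖² + t²` for all real `t`
    have key : ∀ t : ℝ, ((φ a).im + t) ^ 2 ≤ ‖a‖ ^ 2 + t ^ 2 := by
      intro t
      have e1 : φ (a + (t * Complex.I : ℂ) • 1) = φ a + t * Complex.I := by
        rw [map_add, map_smul, h1, smul_eq_mul, mul_one]
      have e2 := hle (a + (t * Complex.I : ℂ) • 1)
      rw [e1] at e2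
      have e3 : star (a + (t * Complex.I : ℂ) • (1 : A)) * (a + (t * Complex.I : ℂ) • 1) =
          star a * a + ((t ^ 2 : ℝ) : ℂ) • 1 := by
        rw [star_add, star_smul, star_one, ha.star_eq]
        simp only [add_mul, mul_add, smul_mul_assoc, mul_smul_comm, one_mul, mul_one,
          RCLike.star_def, map_mul, Complex.conj_ofReal, Complex.conj_I]
        have : ((t ^ 2 : ℝ) : ℂ) = (t : ℂ) * -Complex.I * (t * Complex.I) := by
          push_cast; ring_nf; rw [Complex.I_sq]; ring
        rw [this]
        module
      have e4 : ‖a + (t * Complex.I : ℂ) • (1 : A)‖ ^ 2 ≤ ‖a‖ ^ 2 + t ^ 2 := by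
        rw [sq, ← CStarRing.norm_star_mul_self, e3]
        refine (norm_add_le _ _).trans ?_
        rw [CStarRing.norm_star_mul_self, ← sq, norm_smul, Complex.norm_real, Real.norm_eq_abs,
          abs_of_nonneg (sq_nonneg t)]
        gcongr
        refine mul_le_of_le_one_right (sq_nonneg t) ?_
        rcases subsingleton_or_nontrivial A with hA | hA
        · simp [Subsingleton.elim (1 : A) 0]
        · rw [CStarRing.norm_one]
      have e5 : |(φ a).im + t| ≤ ‖φ a + t * Complex.I‖ := by
        simpa using Complex.abs_im_le_norm (φ a + t * Complex.I)
      calc ((φ a).im + t) ^ 2 = |(φ a).im + t| ^ 2 := (sq_abs _).symm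
        _ ≤ ‖a + (t * Complex.I : ℂ) • (1 : A)‖ ^ 2 := by gcongr; exact e5.trans e2
        _ ≤ _ := e4
    by_contra hne
    have h3 := key ((‖a‖ ^ 2 + 1) / (2 * (φ a).im))
    have h4 : 2 * (φ a).im * ((‖a‖ ^ 2 + 1) / (2 * (φ a).im)) = ‖a‖ ^ 2 + 1 := by
      field_simp
    nlinarith [sq_nonneg (φ a).im]
  refine ⟨?_, him _ (IsSelfAdjoint.star_mul_self c)⟩
  set a := star c * c with ha
  have ha0 : 0 ≤ a := star_mul_self_nonneg c
  rcases eq_or_ne a 0 with h0 | h0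
  · simp [h0]
  have hn : 0 < ‖a‖ := norm_pos_iff.2 h0
  -- `‖ ‖a‖ - a ‖ ≤ ‖a‖`
  have e1 : ‖algebraMap ℝ A ‖a‖ - a‖ ≤ ‖a‖ := by
    have h2 : a ≤ algebraMap ℝ A ‖a‖ := IsSelfAdjoint.le_algebraMap_norm_self (.of_nonneg ha0)
    refine (CStarAlgebra.norm_le_iff_le_algebraMap _ hn.le (sub_nonneg.2 h2)).2 ?_
    exact sub_le_self _ ha0
  have e2 := (hle _).trans e1
  rw [map_sub, Algebra.algebraMap_eq_smul_one] at e2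
  have e3 : φ ((‖a‖ : ℝ) • (1 : A)) = (‖a‖ : ℂ) := by
    rw [← Complex.coe_smul, map_smul, h1, smul_eq_mul, mul_one]
  rw [e3] at e2
  have e4 := (Complex.re_le_norm _).trans e2
  rw [Complex.sub_re, Complex.ofReal_re] at e4
  linarith

/-- On a `C*`-algebra there is, for every `c`, a contractive positive functional with value
`‖c‖ ^ 2` at `star c * c`. -/
lemma exists_norming_functional {A : Type*} [NonUnitalCStarAlgebra A] (c : A) :
    ∃ φ : A →L[ℂ] ℂ, ‖φ‖ ≤ 1 ∧ (∀ x, 0 ≤ (φ (star x * x)).re ∧ (φ (star x * x)).im = 0) ∧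
      φ (star c * c) = ((‖c‖ ^ 2 : ℝ) : ℂ) := by
  let B := Unitization ℂ A
  let d : B := (c : Unitization ℂ A)
  have hd : ‖d‖ = ‖c‖ := Unitization.norm_inr (𝕜 := ℂ) c
  set a := star d * d with ha
  have ha0 : 0 ≤ a := star_mul_self_nonneg d
  have hna : ‖a‖ = ‖c‖ ^ 2 := by rw [ha, CStarRing.norm_star_mul_self, hd, sq]
  have h1a : 1 + ‖a‖ ≤ ‖1 + a‖ := by
    have h2 : ‖a‖ ∈ spectrum ℝ a := CStarAlgebra.norm_mem_spectrum_of_nonneg ha0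
    have h3 : 1 + ‖a‖ ∈ spectrum ℝ (1 + a) := by
      have := (spectrum.add_mem_add_iff (R := ℝ) (s := 1) (r := ‖a‖) (a := a)).2 h2
      rwa [map_one, add_comm ‖a‖] at this
    have h4 := spectrum.norm_le_norm_of_mem h3
    rwa [Real.norm_of_nonneg (by positivity)] at h4
  have hne : (1 + a) ≠ 0 := by
    intro h
    rw [h, norm_zero] at h1a
    linarith [norm_nonneg a]
  obtain ⟨g, hg, hga⟩ := exists_dual_vector ℂ (1 + a) (norm_ne_zero_iff.2 hne)
  have hle : ∀ x, ‖g x‖ ≤ ‖x‖ := fun x => (g.le_opNorm x).trans_eq (by rw [hg, one_mul])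
  have hg1 := (hle 1).trans_eq (CStarRing.norm_one (E := B))
  have hg2 := hle a
  rw [map_add] at hga
  have hre := congrArg Complex.re hga
  have him := congrArg Complex.im hga
  simp only [Complex.add_re, Complex.coe_algebraMap, Complex.ofReal_re] at hre
  have hr1 := Complex.re_le_norm (g 1)
  have hr2 := Complex.re_le_norm (g a)
  have eqof : ∀ (z : ℂ) (r : ℝ), ‖z‖ ≤ r → z.re = r → z = r := by
    intro z r h1 h2
    have h3 : z.re = ‖z‖ := le_antisymm (Complex.re_le_norm z) (h1.trans h2.ge)
    rw [Complex.re_eq_norm] at h3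
    refine Complex.ext (by simpa using h2) ?_
    simpa using (Complex.nonneg_iff.1 h3).2.symm
  have hg1' : g 1 = 1 := by
    simpa using eqof (g 1) 1 hg1 (by linarith)
  have hg2' : g a = (‖a‖ : ℝ) := eqof (g a) ‖a‖ hg2 (by linarith)
  let φ : A →ₗ[ℂ] ℂ := g.toLinearMap ∘ₗ (Unitization.inrHom ℂ ℂ A)
  refine ⟨φ.mkContinuous 1 fun x => ?_, φ.mkContinuous_norm_le zero_le_one _, fun x => ?_, ?_⟩
  · rw [one_mul]
    exact (hle _).trans_eq (Unitization.norm_inr (𝕜 := ℂ) x)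
  · have := nonneg_of_norm_le_one_of_map_one g hg.le hg1' (x : Unitization ℂ A)
    change 0 ≤ (g ((star x * x : A) : Unitization ℂ A)).re ∧
      (g ((star x * x : A) : Unitization ℂ A)).im = 0
    rwa [Unitization.inr_mul, Unitization.inr_star]
  · change g ((star c * c : A) : Unitization ℂ A) = _
    rw [Unitization.inr_mul, Unitization.inr_star, ← hna]
    exact hg2'

end States

/-! ### The Gelfand–Naimark–Segal construction for multiplier categories -/

namespace CStarCat

variable {W : CStarCat.{u}}

section
attribute [local instance] CStarAlgebra.spectralOrder CStarAlgebra.spectralOrderedRing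

/-- `‖m‖² - m* m` is positive in the multiplier algebra. -/
lemma Mult.exists_norm_sq_sub {X Y : W.Obj} (m : W.Mult X Y) : ∃ n : W.Mult X X,
    (((‖m‖ ^ 2 : ℝ) : ℂ)) • Mult.id X - Mult.comp (Mult.adj m) m = Mult.comp (Mult.adj n) n := by
  have key : ∃ n : W.Mult X X, ‖Mult.comp (Mult.adj m) m‖ • Mult.id X -
      Mult.comp (Mult.adj m) m = Mult.comp (Mult.adj n) n := by
    let _ : NonUnitalCStarAlgebra (W.Mult X X) := (Mult.pre W).endAlgebra X
    have h := CStarAlgebra.star_left_conjugate_le_norm_smul (a := Mult.id X)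
      (b := Mult.comp (Mult.adj m) m) (by
        change Mult.adj (Mult.comp (Mult.adj m) m) = _
        rw [Mult.adj_comp, Mult.adj_adj])
    obtain ⟨n, hn⟩ := CStarAlgebra.nonneg_iff_eq_star_mul_self.1 (sub_nonneg.2 h)
    refine ⟨n, Eq.trans ?_ hn⟩
    change _ = ‖Mult.comp (Mult.adj m) m‖ • Mult.comp (Mult.adj (Mult.id X)) (Mult.id X) -
      Mult.comp (Mult.comp (Mult.adj (Mult.id X)) (Mult.comp (Mult.adj m) m)) (Mult.id X)
    rw [Mult.adj_id, Mult.comp_id, Mult.comp_id, Mult.id_comp]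
    rfl
  rwa [Mult.norm_adj_comp, ← Complex.coe_smul] at key

end

/-- A positive functional on the `C*`-algebra of endomorphisms of `Z`. -/
structure PosFunctional (W : CStarCat.{u}) (Z : W.Obj) where
  toCLM : W.Hom Z Z →L[ℂ] ℂ
  nonneg' : ∀ x : W.Hom Z Z,
    0 ≤ (toCLM (W.comp (W.adj x) x)).re ∧ (toCLM (W.comp (W.adj x) x)).im = 0

namespace PosFunctional

variable {Z : W.Obj} (φ : W.PosFunctional Z)

lemma nonneg {Y : W.Obj} (f : W.Hom Z Y) : 0 ≤ (φ.toCLM (W.comp (W.adj f) f)).re ∧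
    (φ.toCLM (W.comp (W.adj f) f)).im = 0 := by
  obtain ⟨g, hg⟩ := W.pos f
  rw [hg]
  exact φ.nonneg' g

lemma conj_symm {Y : W.Obj} (f g : W.Hom Z Y) :
    star (φ.toCLM (W.comp (W.adj f) g)) = φ.toCLM (W.comp (W.adj g) f) := by
  -- polarization: the diagonal values at `f + g` and `f + i g` are real
  have h1 := (φ.nonneg (f + g)).2
  have h2 := (φ.nonneg (f + Complex.I • g)).2
  simp only [W.adj_add, W.add_comp, W.comp_add, W.adj_smul, W.smul_comp, W.comp_smul, map_add,
    map_smul, Complex.add_im, (φ.nonneg f).2, (φ.nonneg g).2, smul_eq_mul, Complex.mul_im,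
    Complex.mul_re, Complex.I_re, Complex.I_im, RCLike.star_def, Complex.conj_I, Complex.neg_re,
    Complex.neg_im] at h1 h2
  refine Complex.ext ?_ ?_
  · simp only [RCLike.star_def, Complex.conj_re]
    linarith
  · simp only [RCLike.star_def, Complex.conj_im]
    linarith

/-- The space `W(Z, Y)`, to be equipped with the inner product `⟨f, g⟩ = φ(f* g)`. -/
def PreGNS (_φ : W.PosFunctional Z) (Y : W.Obj) : Type u := W.Hom Z Y

instance (Y : W.Obj) : AddCommGroup (φ.PreGNS Y) := inferInstanceAs (AddCommGroup (W.Hom Z Y))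
instance (Y : W.Obj) : Module ℂ (φ.PreGNS Y) := inferInstanceAs (Module ℂ (W.Hom Z Y))

/-- The canonical map of `W(Z, Y)` to the pre-Hilbert space. -/
def toPre (Y : W.Obj) : W.Hom Z Y ≃ₗ[ℂ] φ.PreGNS Y := LinearEquiv.refl ℂ _

/-- The inner product `⟨f, g⟩ = φ(f* g)`. -/
abbrev preCore (Y : W.Obj) : PreInnerProductSpace.Core ℂ (φ.PreGNS Y) where
  inner f g := φ.toCLM (W.comp (W.adj ((φ.toPre Y).symm f)) ((φ.toPre Y).symm g))
  conj_inner_symm f g := φ.conj_symm _ _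
  re_inner_nonneg f := (φ.nonneg ((φ.toPre Y).symm f)).1
  add_left f g h := by rw [map_add, W.adj_add, W.add_comp, map_add]
  smul_left f g c := by rw [map_smul, W.adj_smul, W.smul_comp, map_smul]; rfl

instance (Y : W.Obj) : SeminormedAddCommGroup (φ.PreGNS Y) :=
  InnerProductSpace.Core.toSeminormedAddCommGroup (c := φ.preCore Y)
instance (Y : W.Obj) : InnerProductSpace ℂ (φ.PreGNS Y) :=
  InnerProductSpace.ofCore (φ.preCore Y)

lemma norm_toPre_sq {Y : W.Obj} (f : W.Hom Z Y) :
    ‖φ.toPre Y f‖ ^ 2 = (φ.toCLM (W.comp (W.adj f) f)).re := by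
  rw [← inner_self_eq_norm_sq (𝕜 := ℂ)]
  rfl

lemma norm_toPre_le (h : ‖φ.toCLM‖ ≤ 1) {Y : W.Obj} (f : W.Hom Z Y) : ‖φ.toPre Y f‖ ≤ ‖f‖ := by
  refine (sq_le_sq₀ (norm_nonneg _) (norm_nonneg _)).1 ?_
  rw [norm_toPre_sq, ← W.norm_adj_comp]
  refine (Complex.re_le_norm _).trans ((φ.toCLM.le_opNorm _).trans ?_)
  exact mul_le_of_le_one_left (norm_nonneg _) h

/-- The Hilbert space of the object `Y`. -/
abbrev GNS (Y : W.Obj) : Type u := UniformSpace.Completion (φ.PreGNS Y)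

variable {A B C : W.Obj}

/-- Multipliers act by composition. -/
def preOp (m : W.Mult A B) : φ.PreGNS A →L[ℂ] φ.PreGNS B :=
  LinearMap.mkContinuous
    { toFun := fun f => φ.toPre B (m.act ((φ.toPre A).symm f))
      map_add' := fun f g => by rw [map_add, m.act_add, map_add]
      map_smul' := fun c f => by rw [map_smul, m.act_smul, map_smul]; rfl } ‖m‖ fun f => by
    change ‖φ.toPre B (m.act ((φ.toPre A).symm f))‖ ≤ ‖m‖ * ‖φ.toPre A ((φ.toPre A).symm f)‖
    set g : W.Hom Z A := (φ.toPre A).symm f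
    obtain ⟨n, hn⟩ := m.exists_norm_sq_sub
    refine (sq_le_sq₀ (norm_nonneg _) (by positivity)).1 ?_
    rw [mul_pow, norm_toPre_sq, norm_toPre_sq, ← sub_nonneg]
    -- apply `φ` to `g* (‖m‖² - m* m) g = (n g)* (n g)`
    have h1 := congrArg (fun k => φ.toCLM (W.comp (W.adj g) (Mult.act k g))) hn
    simp only [Mult.adj_comp_act, Mult.sub_act, Mult.smul_act, Mult.id_act, W.comp_sub,
      W.comp_smul, map_sub, map_smul] at h1
    have h2 := (φ.nonneg (n.act g)).1
    rw [← h1] at h2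
    simpa [-Complex.ofReal_pow] using h2

/-- The bounded operator defined by a multiplier. -/
def op (m : W.Mult A B) : φ.GNS A →L[ℂ] φ.GNS B := (φ.preOp m).completion

/-- The canonical map of `W(Z, Y)` to the Hilbert space of `Y`. -/
def toGNS (Y : W.Obj) : W.Hom Z Y →ₗ[ℂ] φ.GNS Y :=
  (UniformSpace.Completion.toComplₗᵢ (𝕜 := ℂ) (E := φ.PreGNS Y)).toLinearMap ∘ₗ
    (φ.toPre Y).toLinearMap

lemma op_toGNS (m : W.Mult A B) (f : W.Hom Z A) :
    φ.op m (φ.toGNS A f) = φ.toGNS B (m.act f) :=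
  ContinuousLinearMap.completion_apply_coe _ _

lemma denseRange_toGNS (Y : W.Obj) : DenseRange (φ.toGNS Y) :=
  UniformSpace.Completion.denseRange_coe.comp (φ.toPre Y).surjective.denseRange
    (UniformSpace.Completion.continuous_coe _)

lemma norm_toGNS {Y : W.Obj} (f : W.Hom Z Y) : ‖φ.toGNS Y f‖ = ‖φ.toPre Y f‖ :=
  UniformSpace.Completion.norm_coe _

lemma op_ext {S T : φ.GNS A →L[ℂ] φ.GNS B}
    (h : ∀ f : W.Hom Z A, S (φ.toGNS A f) = T (φ.toGNS A f)) : S = T :=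
  ContinuousLinearMap.ext fun x => by
    refine (φ.denseRange_toGNS A).induction_on x (isClosed_eq S.continuous T.continuous) h

lemma op_add (m n : W.Mult A B) : φ.op (m + n) = φ.op m + φ.op n :=
  φ.op_ext fun f => by
    simp only [add_apply, op_toGNS, Mult.add_act, map_add]

lemma op_smul (c : ℂ) (m : W.Mult A B) : φ.op (c • m) = c • φ.op m :=
  φ.op_ext fun f => by
    simp only [smul_apply, op_toGNS, Mult.smul_act, map_smul]

lemma op_comp (n : W.Mult B C) (m : W.Mult A B) :
    φ.op (Mult.comp n m) = (φ.op n).comp (φ.op m) :=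
  φ.op_ext fun f => by
    simp only [ContinuousLinearMap.comp_apply, op_toGNS, Mult.comp_act']

lemma inner_toGNS {Y : W.Obj} (f g : W.Hom Z Y) :
    inner ℂ (φ.toGNS Y f) (φ.toGNS Y g) = φ.toCLM (W.comp (W.adj f) g) :=
  UniformSpace.Completion.inner_coe _ _

lemma op_adj (m : W.Mult A B) : φ.op (Mult.adj m) = ContinuousLinearMap.adjoint (φ.op m) := by
  refine (ContinuousLinearMap.eq_adjoint_iff _ _).2 fun x y => ?_
  refine (φ.denseRange_toGNS B).induction_on x
    (isClosed_eq (by fun_prop) (by fun_prop)) fun f => ?_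
  refine (φ.denseRange_toGNS A).induction_on y
    (isClosed_eq (by fun_prop) (by fun_prop)) fun g => ?_
  rw [op_toGNS, op_toGNS, inner_toGNS, inner_toGNS, Mult.adj_comp_act_eq]

lemma continuous_toGNS (h : ‖φ.toCLM‖ ≤ 1) (Y : W.Obj) : Continuous (φ.toGNS Y) :=
  AddMonoidHomClass.continuous_of_bound (φ.toGNS Y) 1 fun f => by
    rw [norm_toGNS, one_mul]; exact φ.norm_toPre_le h f

end PosFunctional

lemma exists_norming_posFunctional {Z Y : W.Obj} (f : W.Hom Z Y) :
    ∃ φ : W.PosFunctional Z, ‖φ.toCLM‖ ≤ 1 ∧ ‖φ.toGNS Y f‖ = ‖f‖ := by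
  let _ : NonUnitalCStarAlgebra (W.Hom Z Z) := W.endAlgebra Z
  obtain ⟨c, hc⟩ := W.pos f
  obtain ⟨φ, h1, h2, h3⟩ := exists_norming_functional c
  have hcf : ‖c‖ ^ 2 = ‖f‖ ^ 2 := by rw [← W.norm_adj_comp, ← W.norm_adj_comp, hc]
  let ψ : W.PosFunctional Z := ⟨φ, h2⟩
  refine ⟨ψ, h1, ?_⟩
  refine (sq_eq_sq₀ (norm_nonneg _) (norm_nonneg _)).1 ?_
  rw [PosFunctional.norm_toGNS, PosFunctional.norm_toPre_sq, hc, ← hcf]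
  have := congrArg Complex.re h3
  rwa [Complex.ofReal_re] at this

end CStarCat

/-! ### Bilinear functors extend to the maximal tensor product -/

namespace StarFunctor

open CStarCat

variable {V₁ V₂ W : CStarCat.{u}}

section Bifunctor

variable (b : StarFunctor (V₁.toStarSemicat.prod V₂.toStarSemicat) W) {X Y Z : V₁.Obj × V₂.Obj}

/-- The value of a functor of two variables at a pair of objects. -/
def biObj (X : V₁.Obj × V₂.Obj) : W.Obj := b.obj X

/-- The value of a functor of two variables at a pair of morphisms. -/
def biMap (f₁ : V₁.Hom X.1 Y.1) (f₂ : V₂.Hom X.2 Y.2) : W.Mult (b.biObj X) (b.biObj Y) :=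
  b.map (X := X) (Y := Y) (f₁, f₂)

lemma biMap_comp (g₁ : V₁.Hom Y.1 Z.1) (g₂ : V₂.Hom Y.2 Z.2) (f₁ : V₁.Hom X.1 Y.1)
    (f₂ : V₂.Hom X.2 Y.2) : b.biMap (X := X) (Y := Z) (V₁.comp g₁ f₁) (V₂.comp g₂ f₂) =
      Mult.comp (b.biMap (X := Y) g₁ g₂) (b.biMap f₁ f₂) :=
  b.map_comp (X := X) (Y := Y) (Z := Z) (g₁, g₂) (f₁, f₂)

lemma biMap_adj (f₁ : V₁.Hom X.1 Y.1) (f₂ : V₂.Hom X.2 Y.2) :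
    b.biMap (X := Y) (Y := X) (V₁.adj f₁) (V₂.adj f₂) = Mult.adj (b.biMap f₁ f₂) :=
  b.map_adj (X := X) (Y := Y) (f₁, f₂)

variable {b}

lemma Nondegenerate.dense_biMap (hn : b.Nondegenerate) (X : V₁.Obj × V₂.Obj) (T : W.Obj) :
    Dense (Submodule.span ℂ {w : W.Hom T (b.biObj X) |
      ∃ (f₁ : V₁.Hom X.1 X.1) (f₂ : V₂.Hom X.2 X.2) (v : W.Hom T (b.biObj X)),
        w = (b.biMap f₁ f₂).act v} : Set (W.Hom T (b.biObj X))) := by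
  refine (hn.dense_act X T).mono (Submodule.span_mono ?_)
  rintro _ ⟨f, v, rfl⟩
  exact ⟨f.1, f.2, v, rfl⟩

end Bifunctor

variable {b : StarFunctor (V₁.toStarSemicat.prod V₂.toStarSemicat) W}
  (hb : b.IsBilinear) {X Y Z : V₁.Obj × V₂.Obj}

/-- A bilinear functor on morphism spaces, as a bilinear map. -/
def IsBilinear.bilin (X Y : V₁.Obj × V₂.Obj) :
    V₁.Hom X.1 Y.1 →ₗ[ℂ] V₂.Hom X.2 Y.2 →ₗ[ℂ] W.Mult (b.biObj X) (b.biObj Y) :=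
  LinearMap.mk₂ ℂ (fun f₁ f₂ => b.biMap (X := X) (Y := Y) f₁ f₂)
    (fun f f' g => hb.1 f f' g)
    (fun c f g => hb.2.1 c f g)
    (fun f g g' => hb.2.2.1 f g g')
    (fun c f g => hb.2.2.2 c f g)

/-- The linear map on the algebraic tensor product defined by a bilinear functor. -/
def IsBilinear.alg (X Y : V₁.Obj × V₂.Obj) :
    AlgHom V₁ V₂ X Y →ₗ[ℂ] W.Mult (b.biObj X) (b.biObj Y) :=
  TensorProduct.lift (hb.bilin X Y)

lemma IsBilinear.alg_tmul (f₁ : V₁.Hom X.1 Y.1) (f₂ : V₂.Hom X.2 Y.2) :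
    hb.alg X Y (AlgHom.tmul f₁ f₂) = b.biMap (X := X) (Y := Y) f₁ f₂ := rfl

/-- Multipliers of `W` acting on the Hilbert spaces of a positive functional, as a linear map. -/
def _root_.CStarCat.PosFunctional.opL {T : W.Obj} (φ : W.PosFunctional T) (A B : W.Obj) :
    W.Mult A B →ₗ[ℂ] φ.GNS A →L[ℂ] φ.GNS B where
  toFun := φ.op
  map_add' := φ.op_add
  map_smul' := φ.op_smul

/-- A nondegenerate bilinear `*`-functor into `M W`, composed with the representation of `M W`
given by a positive functional. -/
def IsBilinear.tensorRep (hn : b.Nondegenerate) {T : W.Obj} (φ : W.PosFunctional T)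
    (hφ : ‖φ.toCLM‖ ≤ 1) : TensorRep V₁ V₂ where
  space X := φ.GNS (b.biObj X)
  normed X := inferInstance
  inner X := inferInstance
  complete X := inferInstance
  map {X Y} := (hb.bilin X Y).compr₂ (φ.opL _ _)
  map_comp {X Y Z} g₁ g₂ f₁ f₂ := by
    change φ.op (b.biMap (X := X) (Y := Z) _ _) =
      (φ.op (b.biMap (X := Y) (Y := Z) _ _)).comp (φ.op (b.biMap (X := X) (Y := Y) _ _))
    rw [← φ.op_comp, ← b.biMap_comp]
  map_adj {X Y} f₁ f₂ := by
    change φ.op (b.biMap (X := Y) (Y := X) _ _) =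
      ContinuousLinearMap.adjoint (φ.op (b.biMap (X := X) (Y := Y) _ _))
    rw [← φ.op_adj, ← b.biMap_adj]
  nondeg X := by
    rw [← dense_closure]
    refine (φ.denseRange_toGNS (b.biObj X)).mono ?_
    rintro _ ⟨w, rfl⟩
    refine map_mem_closure (φ.continuous_toGNS hφ _) (hn.dense_biMap X T w) fun v hv => ?_
    refine Submodule.span_induction (p := fun v _ => φ.toGNS (b.biObj X) v ∈ Submodule.span ℂ _)
      ?_ ?_ ?_ ?_ hv
    · rintro _ ⟨f₁, f₂, v, rfl⟩
      exact Submodule.subset_span ⟨f₁, f₂, φ.toGNS _ v, (φ.op_toGNS _ _).symm⟩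
    · rw [map_zero]; exact Submodule.zero_mem _
    · intro x y _ _ hx hy
      rw [map_add]; exact Submodule.add_mem _ hx hy
    · intro c x _ hx
      rw [map_smul]; exact Submodule.smul_mem _ _ hx

lemma IsBilinear.rep_tensorRep (hn : b.Nondegenerate) {T : W.Obj} {φ : W.PosFunctional T}
    (hφ : ‖φ.toCLM‖ ≤ 1) (t : AlgHom V₁ V₂ X Y) :
    AlgHom.rep (hb.tensorRep hn φ hφ) t = φ.op (hb.alg X Y t) := by
  refine AlgHom.induction t ?_ (fun _ _ => rfl) fun s t hs ht => ?_
  · rw [map_zero, map_zero]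
    exact (map_zero (φ.opL _ _)).symm
  · rw [map_add, map_add, φ.op_add, hs, ht]; rfl

/-- The maximal norm dominates the norm of every nondegenerate bilinear functor, since `M W` has
enough representations on Hilbert spaces. -/
lemma IsBilinear.norm_alg_le (hn : b.Nondegenerate) (t : AlgHom V₁ V₂ X Y) :
    ‖hb.alg X Y t‖ ≤ ‖t‖ := by
  refine Mult.norm_le _ (norm_nonneg _) fun Z w => ?_
  -- a functional whose representation norms `b(t) ∘ w`
  obtain ⟨φ, h1, h2⟩ := exists_norming_posFunctional ((hb.alg X Y t).act w)
  rw [← h2, ← φ.op_toGNS, ← hb.rep_tensorRep hn h1]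
  refine (ContinuousLinearMap.le_opNorm _ _).trans ?_
  refine mul_le_mul (AlgHom.norm_rep_le _ t) ?_ (norm_nonneg _) (norm_nonneg _)
  exact (φ.norm_toGNS w).trans_le (φ.norm_toPre_le h1 w)

lemma IsBilinear.alg_comp (g : AlgHom V₁ V₂ Y Z) (f : AlgHom V₁ V₂ X Y) :
    hb.alg X Z (CStarCat.AlgHom.comp g f) = Mult.comp (hb.alg Y Z g) (hb.alg X Y f) := by
  induction g using AlgHom.induction with
  | h0 => simp [Mult.zero_comp]
  | h2 s t hs ht => simp [Mult.add_comp, hs, ht]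
  | h1 g₁ g₂ =>
    induction f using AlgHom.induction with
    | h0 => simp [Mult.comp_zero]
    | h2 s t hs ht => simp [Mult.comp_add, hs, ht]
    | h1 f₁ f₂ =>
      rw [AlgHom.comp_tmul, hb.alg_tmul, hb.alg_tmul, hb.alg_tmul, b.biMap_comp]

lemma IsBilinear.alg_adj (f : AlgHom V₁ V₂ X Y) :
    hb.alg Y X (AlgHom.adj f) = Mult.adj (hb.alg X Y f) := by
  induction f using AlgHom.induction with
  | h0 => simp [Mult.adj_zero]
  | h2 s t hs ht => simp [Mult.adj_add, hs, ht]
  | h1 f₁ f₂ => rw [AlgHom.adj_tmul, hb.alg_tmul, hb.alg_tmul, b.biMap_adj]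

/-- The extension of a bilinear functor to the morphism spaces of the maximal tensor product. -/
def IsBilinear.max (X Y : V₁.Obj × V₂.Obj) :
    MaxHom V₁ V₂ X Y →L[ℂ] W.Mult (b.biObj X) (b.biObj Y) :=
  LinearMap.extendOfNorm (hb.alg X Y) MaxHom.ofAlg

lemma IsBilinear.max_ofAlg (hn : b.Nondegenerate) (t : AlgHom V₁ V₂ X Y) :
    hb.max X Y (MaxHom.ofAlg t) = hb.alg X Y t :=
  LinearMap.extendOfNorm_eq MaxHom.dense_ofAlg ⟨1, fun f => by
    rw [one_mul, MaxHom.norm_ofAlg]; exact hb.norm_alg_le hn f⟩ t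

lemma IsBilinear.max_comp (hn : b.Nondegenerate) (g : MaxHom V₁ V₂ Y Z) (f : MaxHom V₁ V₂ X Y) :
    hb.max X Z (MaxHom.compL g f) = Mult.comp (hb.max Y Z g) (hb.max X Y f) := by
  induction g using MaxHom.induction with
  | hp =>
    exact isClosed_eq ((hb.max X Z).continuous.comp
      (MaxHom.compL.continuous.clm_apply continuous_const))
      (Mult.continuous_comp.comp ((hb.max Y Z).continuous.prodMk continuous_const))
  | h g =>
    induction f using MaxHom.induction with
    | hp =>
      exact isClosed_eq ((hb.max X Z).continuous.comp (MaxHom.compL (MaxHom.ofAlg g)).continuous)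
        (Mult.continuous_comp.comp (continuous_const.prodMk (hb.max X Y).continuous))
    | h f =>
      rw [MaxHom.compL_ofAlg, hb.max_ofAlg hn, hb.max_ofAlg hn, hb.max_ofAlg hn, hb.alg_comp]

lemma IsBilinear.max_adj (hn : b.Nondegenerate) (f : MaxHom V₁ V₂ X Y) :
    hb.max Y X (MaxHom.adjL f) = Mult.adj (hb.max X Y f) := by
  induction f using MaxHom.induction with
  | hp =>
    exact isClosed_eq ((hb.max Y X).continuous.comp MaxHom.adjL.continuous)
      ((Mult.pre W).continuous_adj.comp (hb.max X Y).continuous)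
  | h f => rw [MaxHom.adjL_ofAlg, hb.max_ofAlg hn, hb.max_ofAlg hn, hb.alg_adj]

/-- The nondegenerate linear `*`-functor `V₁ ⊡_max V₂ → M W` extending a nondegenerate bilinear
`*`-functor. -/
def IsBilinear.maxFunctor (hn : b.Nondegenerate) : LinFunctor (maxTensor V₁ V₂) W :=
  ⟨{ obj := b.biObj
     map := fun f => hb.max _ _ f
     map_comp := fun g f => hb.max_comp hn g f
     map_adj := fun f => hb.max_adj hn f },
   ⟨fun f g => map_add (hb.max _ _) f g, fun c f => map_smul (hb.max _ _) c f⟩, by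
    refine Nondegenerate.of_act fun X T => ?_
    refine (hn.dense_biMap X T).mono (Submodule.span_mono ?_)
    rintro _ ⟨f₁, f₂, v, rfl⟩
    refine ⟨MaxHom.ofAlg (AlgHom.tmul f₁ f₂), v, ?_⟩
    exact congrArg (fun m => Mult.act m v)
      (hb.max_ofAlg hn (X := X) (Y := X) (AlgHom.tmul f₁ f₂)).symm⟩

lemma IsBilinear.maxFunctor_map_tmul (hn : b.Nondegenerate) (f₁ : V₁.Hom X.1 Y.1)
    (f₂ : V₂.Hom X.2 Y.2) :
    (hb.maxFunctor hn).1.map (X := X) (Y := Y) (MaxHom.ofAlg (AlgHom.tmul f₁ f₂)) =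
      b.biMap f₁ f₂ :=
  hb.max_ofAlg hn (AlgHom.tmul f₁ f₂)

end StarFunctor

/-! ### Multipliers of the subobject completion -/

namespace CStarCat

variable {V : CStarCat.{u}}

lemma Mult.coact_act {X Y Z T : V.Obj} (G : V.Mult Y Z) (f : V.Hom X Y) (F : V.Mult T X) :
    F.coact (G.act f) = G.act (F.coact f) :=
  of_inj (by rw [← of_comp, ← comp_of, ← comp_of, ← of_comp, comp_assoc])

namespace SplitObj

variable (X : V.SplitObj)

lemma proj_act_proj_act {T : V.Obj} (f : V.Hom T X.obj) :
    X.proj.act (X.proj.act f) = X.proj.act f :=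
  congrArg (fun m => Mult.act m f) X.isProj.1

lemma norm_proj_act_le {T : V.Obj} (f : V.Hom T X.obj) : ‖X.proj.act f‖ ≤ ‖f‖ :=
  (Mult.norm_act_le _ _).trans
    (mul_le_of_le_one_left (norm_nonneg _) (Mult.norm_le_one_of_proj X.isProj))

lemma adj_comp_proj_act {T T' : V.Obj} (f : V.Hom T X.obj) (g : V.Hom T' X.obj) :
    V.comp (V.adj g) (X.proj.act f) = V.comp (V.adj (X.proj.act g)) f := by
  have := Mult.adj_comp_act_eq X.proj f g
  rwa [X.isProj.2] at this

/-- The object `(x, id)` of the subobject completion. -/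
abbrev top (x : V.Obj) : V.SplitObj := ⟨x, Mult.id x, Mult.id_comp _, Mult.adj_id _⟩

end SplitObj

/-- A pair `(X, p)` as an object of the subobject completion. -/
def SplitObj.sp (X : V.SplitObj) : V.split.Obj := X

lemma SplitObj.exists_sp (Z : V.split.Obj) : ∃ X : V.SplitObj, X.sp = Z := ⟨Z, rfl⟩

/-- Morphisms of the subobject completion between `(X, p)` and `(Y, q)`. -/
abbrev SHom (X Y : V.SplitObj) : Type u := V.split.Hom X.sp Y.sp

/-- Multipliers of the subobject completion between `(X, p)` and `(Y, q)`. -/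
abbrev SMult (X Y : V.SplitObj) : Type u := V.split.Mult X.sp Y.sp

section
variable {X Y : V.SplitObj}

/-- A morphism of the subobject completion, from a morphism of `V` absorbing the projections. -/
def SHom.mk (f : V.Hom X.obj Y.obj) (h1 : X.proj.coact f = f) (h2 : Y.proj.act f = f) :
    SHom X Y := ⟨f, h1, h2⟩

/-- The underlying morphism of `V`. -/
def SHom.val (f : SHom X Y) : V.Hom X.obj Y.obj := Subtype.val f

lemma SHom.coact_val (f : SHom X Y) : X.proj.coact f.val = f.val := f.2.1
lemma SHom.act_val (f : SHom X Y) : Y.proj.act f.val = f.val := f.2.2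

lemma SHom.ext {f g : SHom X Y} (h : f.val = g.val) : f = g := Subtype.ext h

@[simp] lemma SHom.val_mk (f : V.Hom X.obj Y.obj) (h1 h2) : (SHom.mk f h1 h2).val = f := rfl

lemma SHom.val_comp {Z : V.SplitObj} (g : SHom Y Z) (f : SHom X Y) :
    SHom.val (V.split.comp g f) = V.comp g.val f.val := rfl

lemma SHom.val_adj (f : SHom X Y) : SHom.val (V.split.adj f) = V.adj f.val := rfl

/-- A morphism `(X, p) → (Y, q)` seen as a morphism `X → Y`. -/
def SHom.toTop (f : SHom X Y) : SHom (.top X.obj) (.top Y.obj) := SHom.mk f.val rfl rfl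

/-- A morphism `T → X` of `V`, cut down to a morphism `(T, id) → (X, p)`. -/
def cutTop {T : V.Obj} (X : V.SplitObj) (f : V.Hom T X.obj) : SHom (.top T) X :=
  SHom.mk (X.proj.act f) rfl (X.proj_act_proj_act f)

lemma val_cutTop {T : V.Obj} (X : V.SplitObj) (f : V.Hom T X.obj) :
    (cutTop X f).val = X.proj.act f := rfl

/-- The action of `q ∘ n` on morphisms into `(X, p)`. -/
def compressAct (n : V.Mult X.obj Y.obj) {Z : V.SplitObj} (f : SHom Z X) : SHom Z Y :=
  SHom.mk (Y.proj.act (n.act f.val))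
    (by rw [Mult.coact_act, Mult.coact_act, f.coact_val]) (Y.proj_act_proj_act _)

lemma norm_compressAct_le (n : V.Mult X.obj Y.obj) {Z : V.SplitObj} (f : SHom Z X) :
    ‖compressAct n f‖ ≤ ‖n‖ * ‖f‖ :=
  (Y.norm_proj_act_le _).trans (n.norm_act_le f.val)

lemma compressAct_adjoint (n : V.Mult X.obj Y.obj) {Z Z' : V.SplitObj} (w : SHom Z X)
    (v : SHom Z' Y) : V.split.comp (V.split.adj v) (compressAct n w) =
      V.split.comp (V.split.adj (compressAct (Mult.adj n) v)) w := by
  refine SHom.ext ?_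
  rw [SHom.val_comp, SHom.val_comp, SHom.val_adj, SHom.val_adj, compressAct, compressAct,
    SHom.val_mk, SHom.val_mk, Y.adj_comp_proj_act, SHom.act_val, Mult.adj_comp_act_eq,
    ← X.adj_comp_proj_act, SHom.act_val]

/-- The multiplier `(X, p) → (Y, q)` of the subobject completion given by `q ∘ n ∘ p`. -/
def compress (n : V.Mult X.obj Y.obj) : SMult X Y :=
  Mult.ofAdjointable (V := V.split)
    (fun Z f => compressAct (Z := Z) n f)
    (fun Z f => compressAct (Z := Z) (Mult.adj n) f)
    ‖n‖ (fun Z f => norm_compressAct_le (Z := Z) n f)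
    (fun Z f => by
      rw [← Mult.norm_adj n]; exact norm_compressAct_le (Z := Z) (Mult.adj n) f)
    (fun Z Z' w v => compressAct_adjoint (Z := Z) (Z' := Z') n w v)

lemma val_compress_act (n : V.Mult X.obj Y.obj) {Z : V.SplitObj} (f : SHom Z X) :
    SHom.val (Mult.act (compress n) f : SHom Z Y) = Y.proj.act (n.act f.val) := rfl

/-- Multipliers of the subobject completion agree if they agree on morphisms out of all `(Z, r)`. -/
lemma split_mult_ext {m n : SMult X Y}
    (h : ∀ (Z : V.SplitObj) (f : SHom Z X),
      SHom.val (Mult.act m f : SHom Z Y) = SHom.val (Mult.act n f : SHom Z Y)) : m = n :=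
  Mult.ext_act fun Z f => SHom.ext (X := Z) (h Z f)

lemma adj_compress (n : V.Mult X.obj Y.obj) :
    Mult.adj (compress n : SMult X Y) = (compress (Mult.adj n) : SMult Y X) :=
  Mult.ext_act fun _ f => Mult.ofAdjointable_adj_act (V := V.split) _ _ _ _ _ _ f

lemma compress_comp {Z : V.SplitObj} (m : V.Mult Y.obj Z.obj) (n : V.Mult X.obj Y.obj) :
    Mult.comp (compress m : SMult Y Z) (compress n : SMult X Y) =
      compress (Mult.comp m (Mult.comp Y.proj n)) :=
  split_mult_ext fun _ _ => rfl

lemma compress_proj : (compress X.proj : SMult X X) = Mult.id X.sp :=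
  split_mult_ext fun Z f => by
    rw [val_compress_act, SHom.act_val, SHom.act_val]; rfl

lemma compress_id : (compress (Mult.id X.obj) : SMult X X) = Mult.id X.sp :=
  split_mult_ext fun Z f => by
    rw [val_compress_act, Mult.id_act, SHom.act_val]; rfl

lemma compress_zero : (compress 0 : SMult X Y) = 0 :=
  split_mult_ext fun Z f => by
    rw [val_compress_act, Mult.zero_act, Mult.act_zero]; rfl

/-- The canonical isometry `(X, p) → (X, id)`. -/
def inclTop (X : V.SplitObj) : SMult X (.top X.obj) := compress (Mult.id X.obj)

lemma adj_inclTop_comp (X : V.SplitObj) :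
    Mult.comp (Mult.adj (inclTop X)) (inclTop X) = Mult.id X.sp := by
  rw [inclTop, adj_compress, compress_comp, Mult.adj_id, Mult.id_comp, Mult.id_comp, compress_id]

end

/-! ### The subobject completion is subobject complete -/

section
variable {X Y : V.SplitObj}

/-- A morphism out of `(Z, r)`, precomposed with `r`, as a morphism out of `(Z, id)`. -/
def SHom.fromTop {Z : V.SplitObj} (f : SHom Z X) : SHom (.top Z.obj) X :=
  SHom.mk f.val rfl f.act_val

lemma val_coact_adj_inclTop {Z : V.SplitObj} (f : SHom Z X) :
    SHom.val (Mult.coact (Mult.adj (inclTop Z)) f : SHom (.top Z.obj) X) = f.val := by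
  rw [Mult.adj_coact, SHom.val_adj]
  change V.adj (V.adj f.val) = f.val
  rw [V.adj_adj]

lemma val_act_fromTop {Z : V.SplitObj} (m : SMult X Y) (f : SHom Z X) :
    SHom.val (Mult.act m f.fromTop : SHom (.top Z.obj) Y) =
      SHom.val (Mult.act m f : SHom Z Y) := by
  have h1 : f.fromTop = (Mult.coact (Mult.adj (inclTop Z)) f : SHom (.top Z.obj) X) :=
    SHom.ext (val_coact_adj_inclTop f).symm
  rw [h1, ← Mult.coact_act, val_coact_adj_inclTop]

lemma norm_val_act_cutTop_le (m : SMult X Y) {T : V.Obj} (f : V.Hom T X.obj) :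
    ‖SHom.val (Mult.act m (cutTop X f) : SHom (.top _) Y)‖ ≤ ‖m‖ * ‖f‖ :=
  (m.norm_act_le (cutTop X f)).trans
    (mul_le_mul_of_nonneg_left (X.norm_proj_act_le f) (norm_nonneg _))

/-- A multiplier `(X, p) → (Y, q)` of the subobject completion, seen as a multiplier `X → Y`. -/
def dilate (m : SMult X Y) : V.Mult X.obj Y.obj :=
  Mult.ofAdjointable
    (fun _ f => SHom.val (Mult.act m (cutTop X f) : SHom (.top _) Y))
    (fun _ f => SHom.val (Mult.act (Mult.adj m) (cutTop Y f) : SHom (.top _) X))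
    ‖m‖
    (fun _ f => norm_val_act_cutTop_le m f)
    (fun _ f => (norm_val_act_cutTop_le (Mult.adj m) f).trans_eq (by rw [Mult.norm_adj]))
    (fun T T' w v => by
      have h := congrArg (SHom.val (X := .top T) (Y := .top T'))
        (Mult.adj_comp_act_eq m (cutTop X w) (cutTop Y v))
      rw [SHom.val_comp, SHom.val_comp, SHom.val_adj, SHom.val_adj, val_cutTop, val_cutTop,
        ← Y.adj_comp_proj_act, SHom.act_val, X.adj_comp_proj_act, SHom.act_val] at h
      exact h)

lemma dilate_act (m : SMult X Y) {T : V.Obj} (f : V.Hom T X.obj) :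
    (dilate m).act f = SHom.val (Mult.act m (cutTop X f) : SHom (.top _) Y) := rfl

lemma cutTop_val {T : V.Obj} (f : SHom (.top T) X) : cutTop X f.val = f := SHom.ext f.act_val

lemma dilate_comp {Z : V.SplitObj} (m : SMult Y Z) (n : SMult X Y) :
    dilate (Mult.comp m n) = Mult.comp (dilate m) (dilate n) :=
  Mult.ext_act fun T f => by
    rw [Mult.comp_act', dilate_act, dilate_act, dilate_act, Mult.comp_act']
    rw [cutTop_val (T := T)]

lemma dilate_adj (m : SMult X Y) : dilate (Mult.adj m) = Mult.adj (dilate m) :=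
  Mult.ext_act fun T f => by
    rw [dilate_act, dilate, Mult.ofAdjointable_adj_act]

lemma compress_dilate (m : SMult X Y) : compress (dilate m) = m :=
  split_mult_ext fun Z f => by
    have : cutTop X f.val = f.fromTop := SHom.ext f.act_val
    rw [val_compress_act, dilate_act, SHom.act_val, this, val_act_fromTop]

lemma proj_comp_dilate (m : SMult X Y) : Mult.comp Y.proj (dilate m) = dilate m :=
  Mult.ext_act fun T f => by rw [Mult.comp_act', dilate_act, SHom.act_val]

end

lemma isSubobjectComplete_split (V : CStarCat.{u}) : V.split.IsSubobjectComplete := by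
  intro X m hm
  obtain ⟨X, rfl⟩ := SplitObj.exists_sp X
  set n : V.Mult X.obj X.obj := dilate m with hnm
  have hn : V.IsProj n := ⟨by rw [hnm, ← dilate_comp, hm.1], by rw [hnm, ← dilate_adj, hm.2]⟩
  have hp : Mult.comp X.proj n = n := proj_comp_dilate m
  let U : V.SplitObj := ⟨X.obj, n, hn⟩
  refine ⟨U.sp, compress (X := U) (Y := X) n, ?_, ?_⟩
  · rw [adj_compress, compress_comp, hp, hn.2, hn.1]
    exact compress_proj (X := U)
  · rw [adj_compress, compress_comp, hn.2]
    refine Eq.trans ?_ (compress_dilate m)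
    exact congrArg compress ((congrArg _ hn.1).trans hn.1)

end CStarCat

/-! ### Direct sums in the subobject completion -/

namespace CStarCat

variable {V : CStarCat.{u}}

namespace Mult

variable {X Y Z : V.Obj} {I : Type*}

lemma sum_act (F : Finset I) (m : I → V.Mult X Y) (f : V.Hom Z X) :
    (∑ i ∈ F, m i).act f = ∑ i ∈ F, (m i).act f := by
  classical
  induction F using Finset.induction_on with
  | empty => rfl
  | insert i F hi ih => rw [Finset.sum_insert hi, Finset.sum_insert hi, add_act, ih]

lemma sum_comp (F : Finset I) (m : I → V.Mult Y Z) (n : V.Mult X Y) :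
    comp (∑ i ∈ F, m i) n = ∑ i ∈ F, comp (m i) n := by
  classical
  induction F using Finset.induction_on with
  | empty => exact zero_comp n
  | insert i F hi ih => rw [Finset.sum_insert hi, Finset.sum_insert hi, add_comp, ih]

lemma comp_sum (F : Finset I) (m : V.Mult Y Z) (n : I → V.Mult X Y) :
    comp m (∑ i ∈ F, n i) = ∑ i ∈ F, comp m (n i) := by
  classical
  induction F using Finset.induction_on with
  | empty => exact comp_zero m
  | insert i F hi ih => rw [Finset.sum_insert hi, Finset.sum_insert hi, comp_add, ih]

lemma adj_sum (F : Finset I) (m : I → V.Mult X Y) :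
    adj (∑ i ∈ F, m i) = ∑ i ∈ F, adj (m i) := by
  classical
  induction F using Finset.induction_on with
  | empty => exact adj_zero
  | insert i F hi ih => rw [Finset.sum_insert hi, Finset.sum_insert hi, adj_add, ih]

end Mult

/-- Finite sums of pairwise orthogonal projections are projections. -/
lemma isProj_sum {S : V.Obj} {I : Type*} {q : I → V.Mult S S} (hq : ∀ i, V.IsProj (q i))
    (ho : ∀ i j, i ≠ j → Mult.comp (q i) (q j) = 0) (F : Finset I) : V.IsProj (∑ i ∈ F, q i) := by
  refine ⟨?_, ?_⟩
  · rw [Mult.sum_comp]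
    refine Finset.sum_congr rfl fun i hi => ?_
    rw [Mult.comp_sum, Finset.sum_eq_single i (fun j _ hj => ho i j hj.symm)
      (fun h => absurd hi h), (hq i).1]
  · rw [Mult.adj_sum]
    exact Finset.sum_congr rfl fun i _ => (hq i).2

section SumProj

variable {S : V.Obj} {I : Type*} {q : I → V.Mult S S}

lemma norm_tsum_proj_le (hq : ∀ i, V.IsProj (q i))
    (ho : ∀ i j, i ≠ j → Mult.comp (q i) (q j) = 0)
    (hs : ∀ (Z : V.Obj) (f : V.Hom Z S), Summable fun i => (q i).act f)
    (Z : V.Obj) (f : V.Hom Z S) :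
    ‖∑' i, (q i).act f‖ ≤ 1 * ‖f‖ := by
  refine le_of_tendsto (hs Z f).hasSum.norm (Eventually.of_forall fun F => ?_)
  rw [← Mult.sum_act]
  refine (Mult.norm_act_le _ _).trans ?_
  exact mul_le_mul_of_nonneg_right (Mult.norm_le_one_of_proj (isProj_sum hq ho F)) (norm_nonneg _)

lemma tsum_proj_adjoint (hq : ∀ i, V.IsProj (q i))
    (hs : ∀ (Z : V.Obj) (f : V.Hom Z S), Summable fun i => (q i).act f)
    (Z Z' : V.Obj) (w : V.Hom Z S) (v : V.Hom Z' S) :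
    V.comp (V.adj v) (∑' i, (q i).act w) = V.comp (V.adj (∑' i, (q i).act v)) w := by
  have h1 : HasSum (fun i => V.comp (V.adj v) ((q i).act w))
      (V.comp (V.adj v) (∑' i, (q i).act w)) :=
    (V.compL _ _ _ (V.adj v)).hasSum (hs Z w).hasSum
  have h2 : HasSum (fun i => V.comp (V.adj ((q i).act v)) w)
      (V.comp (V.adj (∑' i, (q i).act v)) w) := by
    have h3 : HasSum (fun i => V.adj ((q i).act v)) (V.adj (∑' i, (q i).act v)) :=
      (hs Z' v).hasSum.map (V.adjL _ _).toAddMonoidHom V.continuous_adj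
    exact ((V.compL _ _ _).flip w).hasSum h3
  refine h1.unique (h2.congr_fun fun i => ?_)
  rw [Mult.adj_comp_act_eq, (hq i).2]

/-- The strict sum of pairwise orthogonal projections is a projection. -/
lemma exists_sum_proj (hq : ∀ i, V.IsProj (q i))
    (ho : ∀ i j, i ≠ j → Mult.comp (q i) (q j) = 0)
    (hs : ∀ (Z : V.Obj) (f : V.Hom Z S), Summable fun i => (q i).act f) :
    ∃ Q : V.Mult S S, V.IsProj Q ∧ (∀ i, Mult.comp Q (q i) = q i) ∧
      ∀ (Z : V.Obj) (f : V.Hom Z S), HasSum (fun i => (q i).act f) (Q.act f) := by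
  let Q : V.Mult S S := Mult.ofAdjointable (fun _ f => ∑' i, (q i).act f)
    (fun _ f => ∑' i, (q i).act f) 1 (norm_tsum_proj_le hq ho hs) (norm_tsum_proj_le hq ho hs)
    (tsum_proj_adjoint hq hs)
  have hQs : ∀ (Z : V.Obj) (f : V.Hom Z S), HasSum (fun i => (q i).act f) (Q.act f) :=
    fun Z f => (hs Z f).hasSum
  have hQq : ∀ i, Mult.comp Q (q i) = q i := fun i => Mult.ext_act fun Z f => by
    refine (hQs Z ((q i).act f)).unique ?_
    have h : ∀ j, j ≠ i → (q j).act ((q i).act f) = 0 := fun j hj => by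
      rw [← Mult.comp_act', ho j i hj, Mult.zero_act]
    have h2 := hasSum_single i h
    rwa [← Mult.comp_act', (hq i).1] at h2
  have hQa : Mult.adj Q = Q := Mult.ext_act fun Z f => Mult.ofAdjointable_adj_act _ _ _ _ _ _ f
  have hqQ : ∀ i, Mult.comp (q i) Q = q i := fun i => by
    rw [← Mult.adj_adj (Mult.comp (q i) Q), Mult.adj_comp, hQa, (hq i).2, hQq, (hq i).2]
  refine ⟨Q, ⟨Mult.ext_act fun Z f => ?_, hQa⟩, hQq, hQs⟩
  refine (hQs Z (Q.act f)).unique ((hQs Z f).congr_fun fun i => ?_)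
  rw [← Mult.comp_act', hqQ]

end SumProj

/-- Strictly summable orthogonal partial isometries `u i : X i → S` with initial projections the
`p i` exhibit a subobject of `S` as the direct sum of the `(X i, p i)`. -/
lemma exists_isDirectSum_split {S : V.Obj} {I : Type*} (X : I → V.SplitObj)
    (t : ∀ i, V.Mult (X i).obj S)
    (h1 : ∀ i, Mult.comp (Mult.adj (t i)) (t i) = (X i).proj)
    (h2 : ∀ i, Mult.comp (t i) (X i).proj = t i)
    (h3 : ∀ i j, i ≠ j → Mult.comp (Mult.adj (t i)) (t j) = 0)
    (hs : ∀ (Z : V.Obj) (f : V.Hom Z S),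
      Summable fun i => (Mult.comp (t i) (Mult.adj (t i))).act f) :
    ∃ (T : V.SplitObj) (ι : ∀ i, SMult (X i) T),
      V.split.IsDirectSum (fun i => (X i).sp) T.sp ι := by
  have hq : ∀ i, V.IsProj (Mult.comp (t i) (Mult.adj (t i))) := fun i =>
    ⟨by rw [Mult.comp_assoc, ← Mult.comp_assoc (Mult.adj (t i)), h1, ← Mult.comp_assoc, h2],
      by rw [Mult.adj_comp, Mult.adj_adj]⟩
  have ho : ∀ i j, i ≠ j → Mult.comp (Mult.comp (t i) (Mult.adj (t i)))
      (Mult.comp (t j) (Mult.adj (t j))) = 0 := fun i j hij => by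
    rw [Mult.comp_assoc, ← Mult.comp_assoc (Mult.adj (t i)), h3 i j hij, Mult.zero_comp,
      Mult.comp_zero]
  obtain ⟨Q, hQ, hQq, hQs⟩ := exists_sum_proj hq ho hs
  have hQt : ∀ i, Mult.comp Q (t i) = t i := fun i => by
    have := congrArg (fun m => Mult.comp m (t i)) (hQq i)
    simpa only [Mult.comp_assoc, h1, h2] using this
  let T : V.SplitObj := ⟨S, Q, hQ⟩
  have hsum : ∀ (Z : V.SplitObj) (f : SHom Z T), HasSum (fun i =>
      (Mult.comp (compress (t i) : SMult (X i) T)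
        (Mult.adj (compress (t i) : SMult (X i) T))).act f) f := by
    intro Z f
    refine (Topology.IsInducing.subtypeVal.hasSum_iff (g := (V.splitSub Z T).subtype) _ _).1 ?_
    have h := hQs Z.obj f.val
    have hf : Q.act f.val = f.val := f.act_val
    rw [hf] at h
    refine h.congr_fun fun i => ?_
    change SHom.val (Mult.act (Mult.comp (compress (t i) : SMult (X i) T)
        (Mult.adj (compress (t i) : SMult (X i) T))) f : SHom Z T) = _
    rw [adj_compress, compress_comp, val_compress_act, ← Mult.comp_act', ← Mult.comp_assoc (t i),
      h2, ← Mult.comp_assoc]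
    exact congrArg (fun m => Mult.act (Mult.comp m _) f.val) (hQt i)
  refine ⟨T, fun i => compress (t i), fun i => ?_, fun i j hij => ?_, fun Z f => hsum Z f,
    fun Z g => ?_⟩
  · rw [adj_compress, compress_comp]
    refine Eq.trans (congrArg compress ?_) compress_proj
    exact (congrArg _ (hQt i)).trans (h1 i)
  · rw [adj_compress, compress_comp]
    refine Eq.trans (congrArg compress ?_) compress_zero
    exact (congrArg _ (hQt j)).trans (h3 i j hij)
  · have h := (hsum Z (V.split.adj g)).map (V.split.adjL _ _).toAddMonoidHom V.split.continuous_adj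
    have hg : V.split.adjL _ _ (V.split.adj g) = g := V.split.adj_adj g
    refine HasSum.congr_fun (hg ▸ h) fun i => ?_
    refine (Mult.coact_eq_adj_act _ g).trans ?_
    rw [Mult.adj_comp, Mult.adj_adj]
    rfl

end CStarCat

/-! ### Tensor products of multipliers -/

namespace CStarCat

variable {V₁ V₂ : CStarCat.{u}} {X Y Z T : V₁.Obj × V₂.Obj}

namespace AlgHom

lemma norm_tmul_le (f₁ : V₁.Hom X.1 Y.1) (f₂ : V₂.Hom X.2 Y.2) :
    ‖(tmul f₁ f₂ : AlgHom V₁ V₂ X Y)‖ ≤ ‖f₁‖ * ‖f₂‖ :=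
  maxNorm_le (by positivity) fun π => π.norm_map_le f₁ f₂

/-- The elementary tensors as a bounded bilinear map. -/
def tmulL (X Y : V₁.Obj × V₂.Obj) :
    V₁.Hom X.1 Y.1 →L[ℂ] V₂.Hom X.2 Y.2 →L[ℂ] AlgHom V₁ V₂ X Y :=
  LinearMap.mkContinuous₂ (TensorProduct.mk ℂ (V₁.Hom X.1 Y.1) (V₂.Hom X.2 Y.2)) 1
    (fun f g => by rw [one_mul]; exact norm_tmul_le f g)

lemma tmulL_apply (f₁ : V₁.Hom X.1 Y.1) (f₂ : V₂.Hom X.2 Y.2) :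
    tmulL X Y f₁ f₂ = tmul f₁ f₂ := rfl

/-- The action of `m₁ ⊗ m₂` on the algebraic tensor product. -/
def act (m₁ : V₁.Mult X.1 Y.1) (m₂ : V₂.Mult X.2 Y.2) (Z : V₁.Obj × V₂.Obj) :
    AlgHom V₁ V₂ Z X →ₗ[ℂ] AlgHom V₁ V₂ Z Y :=
  TensorProduct.map (m₁.1.1.1 Z.1).toLinearMap (m₂.1.1.1 Z.2).toLinearMap

lemma act_tmul (m₁ : V₁.Mult X.1 Y.1) (m₂ : V₂.Mult X.2 Y.2) (f₁ : V₁.Hom Z.1 X.1)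
    (f₂ : V₂.Hom Z.2 X.2) : act m₁ m₂ Z (tmul f₁ f₂) = tmul (m₁.act f₁) (m₂.act f₂) := rfl

/-- The action of `m₁ ⊗ m₂` is bounded for the maximal norm, since it is a pointwise limit of
compositions with the elementary tensors `m₁ e ⊗ m₂ e'` for approximate units `e`, `e'`. -/
lemma norm_act_le (m₁ : V₁.Mult X.1 Y.1) (m₂ : V₂.Mult X.2 Y.2) (t : AlgHom V₁ V₂ Z X) :
    ‖act m₁ m₂ Z t‖ ≤ ‖m₁‖ * ‖m₂‖ * ‖t‖ := by
  obtain ⟨l₁, hl₁, h1, h1'⟩ := V₁.exists_approx_unit X.1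
  obtain ⟨l₂, hl₂, h2, h2'⟩ := V₂.exists_approx_unit X.2
  have key : Tendsto (fun e : V₁.Hom X.1 X.1 × V₂.Hom X.2 X.2 =>
      (comp (X := Z) (Y := X) (Z := Y) (tmul (m₁.act e.1) (m₂.act e.2)) t)) (l₁ ×ˢ l₂)
      (𝓝 (act m₁ m₂ Z t)) := by
    refine AlgHom.induction t ?_ (fun f₁ f₂ => ?_) fun s t hs ht => ?_
    · simp only [map_zero]; exact tendsto_const_nhds
    · have e1 := ((m₁.continuous_act.tendsto f₁).comp (h1' _ f₁)).comp
        (tendsto_fst (f := l₁) (g := l₂))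
      have e2 := ((m₂.continuous_act.tendsto f₂).comp (h2' _ f₂)).comp
        (tendsto_snd (f := l₁) (g := l₂))
      have e3 := ((tmulL Z Y).isBoundedBilinearMap.continuous.tendsto
        (m₁.act f₁, m₂.act f₂)).comp (e1.prodMk_nhds e2)
      refine e3.congr fun e => ?_
      simp only [Function.comp, tmulL_apply, comp_tmul, Mult.act_comp]
    · simp only [map_add]; exact hs.add ht
  refine le_of_tendsto key.norm ?_
  filter_upwards [h1.prod_mk h2] with e he
  refine (norm_comp_le _ _).trans ?_
  gcongr
  refine (norm_tmul_le _ _).trans ?_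
  gcongr
  · exact (m₁.norm_act_le _).trans (mul_le_of_le_one_right (norm_nonneg _) he.1)
  · exact (m₂.norm_act_le _).trans (mul_le_of_le_one_right (norm_nonneg _) he.2)

lemma comp_adj_act (m₁ : V₁.Mult X.1 Y.1) (m₂ : V₂.Mult X.2 Y.2) (w : AlgHom V₁ V₂ Z X)
    (v : AlgHom V₁ V₂ T Y) :
    comp (adj v) (act m₁ m₂ Z w) = comp (adj (act (Mult.adj m₁) (Mult.adj m₂) T v)) w := by
  induction v using AlgHom.induction with
  | h0 => simp
  | h2 s t hs ht => simp [hs, ht]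
  | h1 v₁ v₂ =>
    induction w using AlgHom.induction with
    | h0 => simp
    | h2 s t hs ht => rw [map_add, map_add, hs, ht, map_add]
    | h1 w₁ w₂ =>
      rw [adj_tmul, act_tmul, act_tmul, adj_tmul, comp_tmul, comp_tmul,
        Mult.adj_comp_act_eq, Mult.adj_comp_act_eq]

end AlgHom

namespace MaxHom

lemma exists_bound_act (m₁ : V₁.Mult X.1 Y.1) (m₂ : V₂.Mult X.2 Y.2) (f : AlgHom V₁ V₂ Z X) :
    ‖(ofAlg ∘ₗ AlgHom.act m₁ m₂ Z) f‖ ≤ ‖m₁‖ * ‖m₂‖ * ‖ofAlg f‖ := by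
  rw [LinearMap.comp_apply, norm_ofAlg, norm_ofAlg]
  exact AlgHom.norm_act_le m₁ m₂ f

/-- The action of `m₁ ⊗ m₂`, extended by continuity. -/
def act (m₁ : V₁.Mult X.1 Y.1) (m₂ : V₂.Mult X.2 Y.2) (Z : V₁.Obj × V₂.Obj) :
    MaxHom V₁ V₂ Z X →L[ℂ] MaxHom V₁ V₂ Z Y :=
  LinearMap.extendOfNorm (ofAlg ∘ₗ AlgHom.act m₁ m₂ Z) ofAlg

lemma act_ofAlg (m₁ : V₁.Mult X.1 Y.1) (m₂ : V₂.Mult X.2 Y.2) (f : AlgHom V₁ V₂ Z X) :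
    act m₁ m₂ Z (ofAlg f) = ofAlg (AlgHom.act m₁ m₂ Z f) :=
  LinearMap.extendOfNorm_eq dense_ofAlg ⟨_, exists_bound_act m₁ m₂⟩ f

lemma norm_act_le (m₁ : V₁.Mult X.1 Y.1) (m₂ : V₂.Mult X.2 Y.2) (f : MaxHom V₁ V₂ Z X) :
    ‖act m₁ m₂ Z f‖ ≤ ‖m₁‖ * ‖m₂‖ * ‖f‖ :=
  LinearMap.norm_extendOfNorm_apply_le dense_ofAlg _ (exists_bound_act m₁ m₂) f

lemma comp_adj_act (m₁ : V₁.Mult X.1 Y.1) (m₂ : V₂.Mult X.2 Y.2) (w : MaxHom V₁ V₂ Z X)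
    (v : MaxHom V₁ V₂ T Y) :
    compL (adjL v) (act m₁ m₂ Z w) = compL (adjL (act (Mult.adj m₁) (Mult.adj m₂) T v)) w := by
  induction v using MaxHom.induction with
  | hp =>
    exact isClosed_eq ((compL.continuous.comp adjL.continuous).clm_apply continuous_const)
      ((compL.continuous.comp (adjL.continuous.comp (act _ _ _).continuous)).clm_apply
        continuous_const)
  | h v =>
    induction w using MaxHom.induction with
    | hp =>
      exact isClosed_eq ((compL (adjL (ofAlg v))).continuous.comp (act m₁ m₂ Z).continuous)
        (compL _).continuous
    | h w =>
      rw [act_ofAlg, act_ofAlg, adjL_ofAlg, adjL_ofAlg, compL_ofAlg, compL_ofAlg,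
        AlgHom.comp_adj_act]

end MaxHom

/-- A pair of objects as an object of the maximal tensor product. -/
def tp (X : V₁.Obj × V₂.Obj) : (maxTensor V₁ V₂).Obj := X

/-- The elementary tensor of two morphisms, as a morphism of the maximal tensor product. -/
def tens (f₁ : V₁.Hom X.1 Y.1) (f₂ : V₂.Hom X.2 Y.2) : (maxTensor V₁ V₂).Hom (tp X) (tp Y) :=
  MaxHom.ofAlg (AlgHom.tmul f₁ f₂)

lemma norm_tens_le (f₁ : V₁.Hom X.1 Y.1) (f₂ : V₂.Hom X.2 Y.2) :
    ‖tens (X := X) (Y := Y) f₁ f₂‖ ≤ ‖f₁‖ * ‖f₂‖ :=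
  (MaxHom.norm_ofAlg _).trans_le (AlgHom.norm_tmul_le f₁ f₂)

lemma sum_tens {I : Type*} (F : Finset I) (g : I → V₁.Hom Z.1 X.1) (f₂ : V₂.Hom Z.2 X.2) :
    tens (X := Z) (Y := X) (∑ j ∈ F, g j) f₂ = ∑ j ∈ F, tens (X := Z) (Y := X) (g j) f₂ :=
  (congrArg MaxHom.ofAlg (TensorProduct.sum_tmul F g f₂ : (AlgHom.tmul (∑ j ∈ F, g j) f₂ :
    AlgHom V₁ V₂ Z X) = ∑ j ∈ F, AlgHom.tmul (g j) f₂)).trans (map_sum _ _ _)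

/-- Elementary tensors span a dense subspace. -/
lemma tens_induction {p : (maxTensor V₁ V₂).Hom (tp X) (tp Y) → Prop} (hp : IsClosed {f | p f})
    (h0 : p 0) (hadd : ∀ f g, p f → p g → p (f + g))
    (ht : ∀ f₁ f₂, p (tens (X := X) (Y := Y) f₁ f₂)) (f : (maxTensor V₁ V₂).Hom (tp X) (tp Y)) :
    p f := by
  refine MaxHom.induction (V₁ := V₁) (V₂ := V₂) (X := X) (Y := Y) (p := p) f hp fun t => ?_
  refine AlgHom.induction t ?_ ht fun s t hs ht => ?_
  · rw [map_zero]; exact h0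
  · rw [map_add]; exact hadd _ _ hs ht

/-- The tensor product `m₁ ⊗ m₂` of two multipliers. -/
def tensMult (m₁ : V₁.Mult X.1 Y.1) (m₂ : V₂.Mult X.2 Y.2) :
    (maxTensor V₁ V₂).Mult (tp X) (tp Y) :=
  Mult.ofAdjointable (V := maxTensor V₁ V₂)
    (fun Z f => MaxHom.act m₁ m₂ Z f) (fun Z f => MaxHom.act (Mult.adj m₁) (Mult.adj m₂) Z f)
    (‖m₁‖ * ‖m₂‖) (fun Z f => MaxHom.norm_act_le m₁ m₂ f)
    (fun Z f => by
      rw [← Mult.norm_adj m₁, ← Mult.norm_adj m₂]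
      exact MaxHom.norm_act_le (Mult.adj m₁) (Mult.adj m₂) f)
    (fun Z Z' w v => MaxHom.comp_adj_act m₁ m₂ w v)

lemma tensMult_act_tens (m₁ : V₁.Mult X.1 Y.1) (m₂ : V₂.Mult X.2 Y.2) (f₁ : V₁.Hom Z.1 X.1)
    (f₂ : V₂.Hom Z.2 X.2) : (tensMult m₁ m₂).act (tens (X := Z) f₁ f₂) =
      tens (X := Z) (Y := Y) (m₁.act f₁) (m₂.act f₂) :=
  MaxHom.act_ofAlg m₁ m₂ (AlgHom.tmul f₁ f₂)

lemma adj_tensMult (m₁ : V₁.Mult X.1 Y.1) (m₂ : V₂.Mult X.2 Y.2) :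
    Mult.adj (tensMult (X := X) (Y := Y) m₁ m₂) =
      tensMult (X := Y) (Y := X) (Mult.adj m₁) (Mult.adj m₂) :=
  Mult.ext_act fun _ f => Mult.ofAdjointable_adj_act (V := maxTensor V₁ V₂) _ _ _ _ _ _ f

lemma tens_mult_ext {m n : (maxTensor V₁ V₂).Mult (tp X) (tp Y)}
    (h : ∀ (Z : V₁.Obj × V₂.Obj) (f₁ : V₁.Hom Z.1 X.1) (f₂ : V₂.Hom Z.2 X.2),
      m.act (tens (X := Z) (Y := X) f₁ f₂) = n.act (tens (X := Z) (Y := X) f₁ f₂)) : m = n :=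
  Mult.ext_act fun Z f => by
    refine tens_induction (X := Z) (p := fun f => m.act f = n.act f)
      (isClosed_eq m.continuous_act n.continuous_act) ?_ ?_ (h Z) f
    · rw [Mult.act_zero, Mult.act_zero]
    · intro f g hf hg
      rw [Mult.act_add, Mult.act_add, hf, hg]

lemma tensMult_comp (n₁ : V₁.Mult Y.1 Z.1) (n₂ : V₂.Mult Y.2 Z.2) (m₁ : V₁.Mult X.1 Y.1)
    (m₂ : V₂.Mult X.2 Y.2) :
    Mult.comp (tensMult (X := Y) (Y := Z) n₁ n₂) (tensMult (X := X) (Y := Y) m₁ m₂) =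
      tensMult (X := X) (Y := Z) (Mult.comp n₁ m₁) (Mult.comp n₂ m₂) :=
  tens_mult_ext fun T f₁ f₂ => by
    rw [Mult.comp_act', tensMult_act_tens, tensMult_act_tens, tensMult_act_tens,
      Mult.comp_act', Mult.comp_act']

lemma tensMult_id : tensMult (Mult.id X.1) (Mult.id X.2) = Mult.id (tp X) :=
  tens_mult_ext fun T f₁ f₂ => by
    rw [tensMult_act_tens, Mult.id_act, Mult.id_act, Mult.id_act]

lemma zero_tensMult (m₂ : V₂.Mult X.2 Y.2) :
    tensMult (X := X) (Y := Y) (0 : V₁.Mult X.1 Y.1) m₂ = 0 :=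
  tens_mult_ext fun T f₁ f₂ => by
    rw [tensMult_act_tens, Mult.zero_act, Mult.zero_act]
    have : (AlgHom.tmul (0 : V₁.Hom T.1 Y.1) (m₂.act f₂) : AlgHom V₁ V₂ T Y) = 0 :=
      TensorProduct.zero_tmul _ _
    exact (congrArg MaxHom.ofAlg this).trans (map_zero _)

/-! ### Countable additivity of the maximal tensor product -/

/-- A family of pairwise orthogonal projections `q i`, dominated by `e i ⊗ 1` for strictly summable
orthogonal projections `e i` of the first factor, is strictly summable. -/
lemma summable_act_of_dominated {S : V₁.Obj × V₂.Obj} {I : Type*}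
    {q : I → (maxTensor V₁ V₂).Mult (tp S) (tp S)} (hq : ∀ i, (maxTensor V₁ V₂).IsProj (q i))
    (ho : ∀ i j, i ≠ j → Mult.comp (q i) (q j) = 0) (e : I → V₁.Mult S.1 S.1)
    (he : ∀ i j, i ≠ j → Mult.comp (e i) (e j) = 0)
    (hd : ∀ i, Mult.comp (q i) (tensMult (X := S) (Y := S) (e i) (Mult.id S.2)) = q i)
    (hs : ∀ (Z : V₁.Obj) (f : V₁.Hom Z S.1), Summable fun i => (e i).act f)
    (Z : (maxTensor V₁ V₂).Obj) (f : (maxTensor V₁ V₂).Hom Z (tp S)) :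
    Summable fun i => (q i).act f := by
  have hd' : ∀ i j, i ≠ j →
      Mult.comp (q i) (tensMult (X := S) (Y := S) (e j) (Mult.id S.2)) = 0 := fun i j hij => by
    rw [← hd i, Mult.comp_assoc, tensMult_comp, he i j hij, zero_tensMult, Mult.comp_zero]
  have hnorm : ∀ F : Finset I, ‖∑ i ∈ F, q i‖ ≤ 1 := fun F =>
    Mult.norm_le_one_of_proj (isProj_sum hq ho F)
  refine tens_induction (X := Z) (p := fun f => Summable fun i => (q i).act f) ?_ ?_ ?_ ?_ f
  · -- summability is a closed condition, the partial sums being uniformly bounded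
    refine isClosed_of_closure_subset fun f hf => ?_
    refine summable_iff_vanishing_norm.2 fun r hr => ?_
    obtain ⟨g, hg, hfg⟩ := Metric.mem_closure_iff.1 hf (r / 2) (by positivity)
    obtain ⟨s, hs⟩ := summable_iff_vanishing_norm.1 hg (r / 2) (by positivity)
    refine ⟨s, fun F hF => ?_⟩
    have h1 := hs F hF
    rw [← Mult.sum_act] at h1 ⊢
    have h2 : ‖(∑ i ∈ F, q i).act (f - g)‖ ≤ ‖f - g‖ :=
      (Mult.norm_act_le _ _).trans (mul_le_of_le_one_left (norm_nonneg _) (hnorm F))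
    rw [Mult.act_sub] at h2
    rw [dist_eq_norm] at hfg
    have h3 := norm_sub_norm_le ((∑ i ∈ F, q i).act f) ((∑ i ∈ F, q i).act g)
    linarith
  · simpa only [Mult.act_zero] using summable_zero
  · intro f g hf hg
    simpa only [Mult.act_add] using hf.add hg
  · intro f₁ f₂
    refine summable_iff_vanishing_norm.2 fun r hr => ?_
    obtain ⟨s, hs'⟩ := summable_iff_vanishing_norm.1 (hs _ f₁) (r / (‖f₂‖ + 1)) (by positivity)
    refine ⟨s, fun F hF => ?_⟩
    have h1 := hs' F hF
    -- `∑ q i = (∑ q i) ∘ (∑ e i ⊗ 1)`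
    have h2 : ∀ i ∈ F, (q i).act (tens (X := Z) (Y := S) f₁ f₂) =
        (q i).act (tens (X := Z) (Y := S) (∑ j ∈ F, (e j).act f₁) f₂) := fun i hi => by
      have h3 : tens (X := Z) (Y := S) (∑ j ∈ F, (e j).act f₁) f₂ =
          ∑ j ∈ F, (tensMult (X := S) (Y := S) (e j) (Mult.id S.2)).act
            (tens (X := Z) (Y := S) f₁ f₂) := by
        rw [sum_tens (Z := Z)]
        exact Finset.sum_congr rfl fun j _ => (tensMult_act_tens (X := S) (Y := S) (Z := Z)
          (e j) (Mult.id S.2) f₁ f₂).symm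
      rw [h3, ← Mult.sum_act, ← Mult.comp_act', Mult.comp_sum,
        Finset.sum_eq_single i (fun j _ hj => hd' i j hj.symm) (fun h => absurd hi h), hd]
    rw [Finset.sum_congr rfl h2, ← Mult.sum_act]
    calc _ ≤ ‖∑ i ∈ F, q i‖ * ‖tens (X := Z) (Y := S) (∑ j ∈ F, (e j).act f₁) f₂‖ :=
          Mult.norm_act_le _ _
      _ ≤ ‖tens (X := Z) (Y := S) (∑ j ∈ F, (e j).act f₁) f₂‖ :=
          mul_le_of_le_one_left (norm_nonneg _) (hnorm F)
      _ ≤ ‖∑ j ∈ F, (e j).act f₁‖ * ‖f₂‖ := norm_tens_le _ _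
      _ ≤ ‖∑ j ∈ F, (e j).act f₁‖ * (‖f₂‖ + 1) := by gcongr; linarith
      _ < r := (lt_div_iff₀ (by positivity)).1 h1

/-- The maximal tensor product of countably additive categories is countably additive. For a
countable family of pairs `(x i, y i)` with projections `p i`, the isometries `ι i ⊗ κ i` into the
tensor product of the sums of the `x i` and of the `y i` have orthogonal ranges. The projections onto
the ranges of the `(ι i ⊗ κ i) ∘ p i` sum to a projection, and the latter is the direct sum. -/
theorem isCountablyAdditive_boxMax (h₁ : V₁.IsCountablyAdditive) (h₂ : V₂.IsCountablyAdditive) :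
    (boxMax V₁ V₂).IsCountablyAdditive := by
  refine ⟨isSubobjectComplete_split _, fun I _ X => ?_⟩
  let X' : I → (maxTensor V₁ V₂).SplitObj := X
  let x : I → V₁.Obj × V₂.Obj := fun i => (X' i).obj
  let p : ∀ i, (maxTensor V₁ V₂).Mult (tp (x i)) (tp (x i)) := fun i => (X' i).proj
  have hp : ∀ i, Mult.comp (p i) (p i) = p i := fun i => (X' i).isProj.1
  have hpa : ∀ i, Mult.adj (p i) = p i := fun i => (X' i).isProj.2
  obtain ⟨S₁, ι, hι, hιo, hιs, -⟩ := h₁.2 I fun i => (x i).1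
  obtain ⟨S₂, κ, hκ, -, -, -⟩ := h₂.2 I fun i => (x i).2
  let S : V₁.Obj × V₂.Obj := (S₁, S₂)
  let j : ∀ i, (maxTensor V₁ V₂).Mult (tp (x i)) (tp S) := fun i =>
    tensMult (X := x i) (Y := S) (ι i) (κ i)
  have hj : ∀ i, Mult.comp (Mult.adj (j i)) (j i) = Mult.id (tp (x i)) := fun i => by
    rw [adj_tensMult, tensMult_comp]
    exact (congrArg₂ tensMult (hι i) (hκ i)).trans tensMult_id
  have hjo : ∀ i k, i ≠ k → Mult.comp (Mult.adj (j i)) (j k) = 0 := fun i k hik => by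
    rw [adj_tensMult, tensMult_comp]
    exact (congrArg (fun m => tensMult m _) (hιo i k hik)).trans (zero_tensMult _)
  let t : ∀ i, (maxTensor V₁ V₂).Mult (tp (x i)) (tp S) := fun i => Mult.comp (j i) (p i)
  have htd : ∀ i, Mult.adj (t i) = Mult.comp (p i) (Mult.adj (j i)) := fun i =>
    (Mult.adj_comp _ _).trans (by rw [hpa])
  have h1 : ∀ i, Mult.comp (Mult.adj (t i)) (t i) = p i := fun i => by
    rw [htd, Mult.comp_assoc, ← Mult.comp_assoc (Mult.adj (j i)), hj, Mult.id_comp, hp]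
  have h2 : ∀ i, Mult.comp (t i) (p i) = t i := fun i => by
    rw [Mult.comp_assoc, hp]
  have h3 : ∀ i k, i ≠ k → Mult.comp (Mult.adj (t i)) (t k) = 0 := fun i k hik => by
    rw [htd, Mult.comp_assoc, ← Mult.comp_assoc (Mult.adj (j i)), hjo i k hik, Mult.zero_comp,
      Mult.comp_zero]
  let e : I → V₁.Mult S.1 S.1 := fun i => Mult.comp (ι i) (Mult.adj (ι i))
  have hsum : ∀ (Z : (maxTensor V₁ V₂).Obj) (f : (maxTensor V₁ V₂).Hom Z (tp S)),
      Summable fun i => (Mult.comp (t i) (Mult.adj (t i))).act f := by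
    refine summable_act_of_dominated (fun i => ⟨?_, ?_⟩) (fun i k hik => ?_) e
      (fun i k hik => ?_) (fun i => ?_) (fun Z f => (hιs Z f).summable)
    · rw [Mult.comp_assoc, ← Mult.comp_assoc (Mult.adj (t i)), h1, ← Mult.comp_assoc, h2]
    · rw [Mult.adj_comp, Mult.adj_adj]
    · rw [Mult.comp_assoc, ← Mult.comp_assoc (Mult.adj (t i)), h3 i k hik, Mult.zero_comp,
        Mult.comp_zero]
    · change Mult.comp (Mult.comp (ι i) (Mult.adj (ι i))) (Mult.comp (ι k) (Mult.adj (ι k))) = 0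
      rw [Mult.comp_assoc, ← Mult.comp_assoc (Mult.adj (ι i)), hιo i k hik, Mult.zero_comp,
        Mult.comp_zero]
    · have h4 : Mult.comp (Mult.adj (j i)) (tensMult (X := S) (Y := S) (e i) (Mult.id S.2)) =
          Mult.adj (j i) := by
        rw [adj_tensMult, tensMult_comp, Mult.comp_id]
        refine congrArg (fun m => tensMult m _) ?_
        change Mult.comp (Mult.adj (ι i)) (Mult.comp (ι i) (Mult.adj (ι i))) = _
        rw [← Mult.comp_assoc, hι, Mult.id_comp]
      rw [Mult.comp_assoc (t i), htd, Mult.comp_assoc (p i), h4]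
  obtain ⟨T, ν, hν⟩ := exists_isDirectSum_split X' t h1 h2 h3 hsum
  exact ⟨T.sp, ν, hν⟩

end CStarCat

/-! ### Fully faithful, essentially surjective functors -/

namespace UStarFunctor

variable {A B : UCStarCat.{u}}

lemma norm_le_one_of_isometry {X Y : B.Obj} {w : B.Hom X Y}
    (h : B.comp (B.adj w) w = B.id X) : ‖w‖ ≤ 1 := by
  have h1 := B.norm_adj_comp w
  rw [h] at h1
  have h2 := B.norm_id_le X
  nlinarith [norm_nonneg w]

/-- A fully faithful functor, every object of the target being unitarily isomorphic to an object in
the image, is an equivalence. -/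
theorem isEquivalence_of_bijective (F : UStarFunctor A B)
    (hF : ∀ X Y : A.Obj, Function.Bijective (F.map : A.Hom X Y → B.Hom (F.obj X) (F.obj Y)))
    (hs : ∀ Y : B.Obj, ∃ (X : A.Obj) (w : B.Hom (F.obj X) Y),
      B.comp (B.adj w) w = B.id (F.obj X) ∧ B.comp w (B.adj w) = B.id Y) : F.IsEquivalence := by
  choose g w hw hw' using hs
  let s : ∀ X Y : A.Obj, B.Hom (F.obj X) (F.obj Y) → A.Hom X Y := fun X Y =>
    (Equiv.ofBijective _ (hF X Y)).symm
  have hFs : ∀ {X Y : A.Obj} (f : B.Hom (F.obj X) (F.obj Y)), F.map (s X Y f) = f := fun f =>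
    (Equiv.ofBijective _ (hF _ _)).apply_symm_apply f
  have inj : ∀ {X Y : A.Obj} {f f' : A.Hom X Y}, F.map f = F.map f' → f = f' := fun h =>
    (hF _ _).1 h
  have hcancel : ∀ {X Y : B.Obj} (f : B.Hom X (F.obj (g Y))),
      B.comp (B.adj (w Y)) (B.comp (w Y) f) = f := fun f => by
    rw [← B.comp_assoc, hw, B.id_comp]
  have hcancel' : ∀ {X Y : B.Obj} (f : B.Hom X Y),
      B.comp (w Y) (B.comp (B.adj (w Y)) f) = f := fun f => by
    rw [← B.comp_assoc, hw', B.id_comp]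
  let G : UStarFunctor B A :=
    { obj := g
      map := fun {X Y} f => s (g X) (g Y) (B.comp (B.adj (w Y)) (B.comp f (w X)))
      map_comp := fun f' f => inj (by
        simp only [F.map_comp, hFs, B.comp_assoc, hcancel'])
      map_adj := fun f => inj (by
        simp only [F.map_adj, hFs, B.adj_comp, B.adj_adj, B.comp_assoc])
      map_add := fun f f' => inj (by
        simp only [F.map_add, hFs, B.add_comp, B.comp_add])
      map_smul := fun c f => inj (by
        simp only [F.map_smul, hFs, B.smul_comp, B.comp_smul])
      map_id := fun X => inj (by
        rw [F.map_id, hFs, B.id_comp, hw]) }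
  have hG : ∀ {X Y : B.Obj} (f : B.Hom X Y),
      F.map (G.map f) = B.comp (B.adj (w Y)) (B.comp f (w X)) := fun f => hFs _
  have hnat : ∀ {X Y : B.Obj} (f : B.Hom X Y),
      B.comp (w Y) (F.map (G.map f)) = B.comp f (w X) := fun f => by
    rw [hG, hcancel']
  have hFw : ∀ X : A.Obj, F.map (s _ X (w (F.obj X))) = w (F.obj X) := fun X => hFs _
  have hbd : ∀ X : A.Obj, ‖s _ _ (w (F.obj X))‖ ≤ 1 := fun X =>
    norm_le_one_of_isometry (inj (by rw [F.map_comp, F.map_adj, hFs, F.map_id]; exact hw _))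
  have hnat' : ∀ {X Y : A.Obj} (f : A.Hom X Y),
      A.comp (s _ _ (w (F.obj Y))) (G.map (F.map f)) = A.comp f (s _ _ (w (F.obj X))) :=
    fun f => inj (by rw [F.map_comp, F.map_comp, hFw, hFw]; exact hnat (F.map f))
  let σ : Trans (G.comp F) (UStarFunctor.id A) :=
    { app := fun X => s _ _ (w (F.obj X))
      bounded := ⟨1, hbd⟩
      naturality := fun {X Y} f => hnat' f }
  let τ : Trans (F.comp G) (UStarFunctor.id B) :=
    { app := w
      bounded := ⟨1, fun X => norm_le_one_of_isometry (hw X)⟩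
      naturality := fun {X Y} f => hnat f }
  refine ⟨G, ⟨σ, fun X => ⟨inj ?_, inj ?_⟩⟩, ⟨τ, fun X => ⟨hw X, hw' X⟩⟩⟩
  · rw [F.map_comp, F.map_adj]
    exact (congrArg (fun v => B.comp (B.adj v) v) (hFw X)).trans <| (hw _).trans (F.map_id _).symm
  · rw [F.map_comp, F.map_adj]
    exact (congrArg (fun v => B.comp v (B.adj v)) (hFw X)).trans <| (hw' _).trans (F.map_id _).symm

end UStarFunctor

/-! ### Extension of functors to the subobject completion -/

namespace LinFunctor

open CStarCat

variable {V W : CStarCat.{u}}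

section Split

variable (H : LinFunctor V W) (U : V.SplitObj → W.Obj)
  (ι : ∀ X, W.Mult (U X) (H.1.obj X.obj))

/-- The value of the extended functor at a morphism: cut down by chosen splittings `ι` of the
images of projections. -/
def splitMap {X Y : V.SplitObj} (f : SHom X Y) : W.Mult (U X) (U Y) :=
  Mult.comp (Mult.adj (ι Y)) (Mult.comp (H.1.map f.val) (ι X))

lemma exists_splittings (hW : W.IsSubobjectComplete) :
    ∃ (U : V.SplitObj → W.Obj) (ι : ∀ X, W.Mult (U X) (H.1.obj X.obj)),
      (∀ X, Mult.comp (Mult.adj (ι X)) (ι X) = Mult.id _) ∧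
      (∀ X, Mult.comp (ι X) (Mult.adj (ι X)) = H.ext X.proj) := by
  have h : ∀ X : V.SplitObj, W.IsProj (H.ext X.proj) := fun X =>
    ⟨by rw [← H.ext_comp, X.isProj.1], by rw [← H.ext_adj, X.isProj.2]⟩
  choose U ι h1 h2 using fun X => hW _ _ (h X)
  exact ⟨U, ι, h1, h2⟩

variable {U ι}

lemma splitMap_comp (h2 : ∀ X, Mult.comp (ι X) (Mult.adj (ι X)) = H.ext X.proj)
    {X Y Z : V.SplitObj} (g : SHom Y Z) (f : SHom X Y) :
    H.splitMap U ι (V.split.comp g f) = Mult.comp (H.splitMap U ι g) (H.splitMap U ι f) := by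
  simp only [splitMap, Mult.comp_assoc]
  rw [← Mult.comp_assoc (ι Y), h2, ← Mult.comp_assoc (H.ext Y.proj), H.ext_comp_map, f.act_val,
    SHom.val_comp, H.1.map_comp, Mult.comp_assoc]

lemma splitMap_adj {X Y : V.SplitObj} (f : SHom X Y) :
    H.splitMap U ι (V.split.adj f) = Mult.adj (H.splitMap U ι f) := by
  simp only [splitMap, Mult.adj_comp, Mult.adj_adj, Mult.comp_assoc]
  rw [SHom.val_adj, H.1.map_adj]

lemma splitMap_add {X Y : V.SplitObj} (f g : SHom X Y) :
    H.splitMap U ι (f + g) = H.splitMap U ι f + H.splitMap U ι g := by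
  simp only [splitMap]
  rw [← Mult.comp_add, ← Mult.add_comp, ← H.2.1.1]
  rfl

lemma splitMap_smul {X Y : V.SplitObj} (c : ℂ) (f : SHom X Y) :
    H.splitMap U ι (c • f) = c • H.splitMap U ι f := by
  simp only [splitMap]
  rw [← Mult.comp_smul, ← Mult.smul_comp, ← H.2.1.2]
  rfl

/-- A morphism `e` of `V`, cut down to an endomorphism `p ∘ e ∘ p` of `(X, p)`. -/
def cut (X : V.SplitObj) (e : V.Hom X.obj X.obj) : SHom X X :=
  SHom.mk (X.proj.act (X.proj.coact e))
    (by rw [Mult.coact_act]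
        exact congrArg X.proj.act (congrArg (fun m => Mult.coact m e) X.isProj.1))
    (X.proj_act_proj_act _)

lemma map_val_cut (X : V.SplitObj) (e : V.Hom X.obj X.obj) :
    H.1.map (cut X e).val =
      Mult.comp (H.ext X.proj) (Mult.comp (H.1.map e) (H.ext X.proj)) := by
  rw [H.map_comp_ext, H.ext_comp_map]; rfl

lemma splitMap_cut (h1 : ∀ X, Mult.comp (Mult.adj (ι X)) (ι X) = Mult.id _)
    (h2 : ∀ X, Mult.comp (ι X) (Mult.adj (ι X)) = H.ext X.proj) (X : V.SplitObj)
    (e : V.Hom X.obj X.obj) :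
    H.splitMap U ι (cut X e) = Mult.comp (Mult.adj (ι X)) (Mult.comp (H.1.map e) (ι X)) := by
  rw [splitMap, map_val_cut, ← h2]
  simp only [Mult.comp_assoc, h1, Mult.comp_id]
  rw [← Mult.comp_assoc (Mult.adj (ι X)), h1, Mult.id_comp]

/-- Approximate units of `V`, cut down, approximate the identities of the `U X`. -/
lemma mem_closure_splitMap (h1 : ∀ X, Mult.comp (Mult.adj (ι X)) (ι X) = Mult.id _)
    (h2 : ∀ X, Mult.comp (ι X) (Mult.adj (ι X)) = H.ext X.proj) (X : V.SplitObj) (T : W.Obj)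
    (w : W.Hom T (U X)) :
    w ∈ closure {w' : W.Hom T (U X) | ∃ f : SHom X X, w' = (H.splitMap U ι f).act w} := by
  obtain ⟨l, hl, hl'⟩ := H.exists_approx_unit X.obj
  have ht := ((Mult.adj (ι X)).continuous_act.tendsto _).comp (hl' T ((ι X).act w))
  rw [← Mult.comp_act', h1, Mult.id_act] at ht
  refine mem_closure_of_tendsto ht (Eventually.of_forall fun e => ⟨cut X e, ?_⟩)
  exact (congrArg (fun m => Mult.act m w) (H.splitMap_cut h1 h2 X e)).symm

/-- The extension of a nondegenerate linear `*`-functor to the subobject completion, as a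
`*`-functor. -/
def splitStar (h2 : ∀ X, Mult.comp (ι X) (Mult.adj (ι X)) = H.ext X.proj) :
    StarFunctor V.split.toStarSemicat W where
  obj := U
  map {X Y} f := H.splitMap (X := X) (Y := Y) U ι f
  map_comp {X Y Z} g f := H.splitMap_comp (X := X) (Y := Y) (Z := Z) h2 g f
  map_adj {X Y} f := H.splitMap_adj (X := X) (Y := Y) f

lemma isLinear_splitStar (h2 : ∀ X, Mult.comp (ι X) (Mult.adj (ι X)) = H.ext X.proj) :
    (H.splitStar h2).IsLinear :=
  ⟨fun {X Y} f g => H.splitMap_add (X := X) (Y := Y) f g,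
    fun {X Y} c f => H.splitMap_smul (X := X) (Y := Y) c f⟩

lemma nondegenerate_splitStar (h1 : ∀ X, Mult.comp (Mult.adj (ι X)) (ι X) = Mult.id _)
    (h2 : ∀ X, Mult.comp (ι X) (Mult.adj (ι X)) = H.ext X.proj) :
    (H.splitStar h2).Nondegenerate :=
  StarFunctor.Nondegenerate.of_act fun X T w =>
    by
    refine closure_mono ?_ (H.mem_closure_splitMap h1 h2 X T w)
    rintro _ ⟨f, hf⟩
    exact Submodule.subset_span ⟨f, w, hf⟩

/-- The extension of a nondegenerate linear `*`-functor to the subobject completion. -/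
def split (h1 : ∀ X, Mult.comp (Mult.adj (ι X)) (ι X) = Mult.id _)
    (h2 : ∀ X, Mult.comp (ι X) (Mult.adj (ι X)) = H.ext X.proj) : LinFunctor V.split W :=
  ⟨H.splitStar h2, H.isLinear_splitStar h2, H.nondegenerate_splitStar h1 h2⟩

end Split

end LinFunctor

/-! ### Transformations of functors on the subobject completion -/

namespace StarFunctor

open CStarCat

variable {V W : CStarCat.{u}}

lemma ext_inclTop_isometry (F : LinFunctor V.split W) (X : V.SplitObj) :
    Mult.comp (Mult.adj (F.ext (inclTop X))) (F.ext (inclTop X)) = Mult.id (F.1.obj X.sp) := by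
  rw [← F.ext_adj, ← F.ext_comp, adj_inclTop_comp, F.ext_id]

/-- A transformation is determined by its components at the objects `(x, id)`. -/
lemma nat_app_eq {F G : LinFunctor V.split W} (τ : F.1.Nat G.1) (X : V.SplitObj) :
    τ.app X.sp = Mult.comp (Mult.adj (G.ext (inclTop X)))
      (Mult.comp (τ.app (SplitObj.top X.obj).sp) (F.ext (inclTop X))) := by
  rw [Nat.naturality_ext, ← Mult.comp_assoc, ext_inclTop_isometry, Mult.id_comp]

lemma nat_ext_top {F G : LinFunctor V.split W} {σ τ : F.1.Nat G.1}
    (h : ∀ x : V.Obj, σ.app (SplitObj.top x).sp = τ.app (SplitObj.top x).sp) : σ = τ := by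
  refine Nat.ext fun X => ?_
  obtain ⟨X, rfl⟩ := SplitObj.exists_sp X
  rw [nat_app_eq σ X, nat_app_eq τ X, h]

lemma inclTop_comp_of {X Y : V.SplitObj} (f : SHom X Y) :
    Mult.comp (inclTop Y) (Mult.of f) = Mult.comp (Mult.of f.toTop) (inclTop X) := by
  rw [inclTop, inclTop]
  refine split_mult_ext fun Z g => ?_
  change (Mult.id Y.obj).act ((Mult.id Y.obj).act (V.comp f.val g.val)) =
    V.comp f.val ((Mult.id X.obj).act ((Mult.id X.obj).act g.val))
  simp only [Mult.id_act]

lemma of_comp_adj_inclTop {X Y : V.SplitObj} (f : SHom X Y) :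
    Mult.comp (Mult.of f) (Mult.adj (inclTop X)) =
      Mult.comp (Mult.adj (inclTop Y)) (Mult.of f.toTop) := by
  rw [inclTop, inclTop, adj_compress, adj_compress]
  refine split_mult_ext fun Z g => ?_
  change V.comp f.val (X.proj.act ((Mult.adj (Mult.id X.obj)).act g.val)) =
    Y.proj.act ((Mult.adj (Mult.id Y.obj)).act (V.comp f.val g.val))
  rw [Mult.adj_id, Mult.adj_id, Mult.id_act, Mult.id_act, Mult.comp_act, f.coact_val,
    Mult.act_comp, f.act_val]

lemma inclTop_top (x : V.Obj) :
    inclTop (.top x : V.SplitObj) = Mult.id (SplitObj.top x).sp := compress_id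

section
variable {F G : LinFunctor V.split W}
  (θ : ∀ x : V.Obj, W.Mult (F.1.obj (SplitObj.top x).sp) (G.1.obj (SplitObj.top x).sp))

/-- The component at `(X, p)` of the extension of a family of components at the `(x, id)`. -/
def splitApp (X : V.SplitObj) : W.Mult (F.1.obj X.sp) (G.1.obj X.sp) :=
  Mult.comp (Mult.adj (G.ext (inclTop X))) (Mult.comp (θ X.obj) (F.ext (inclTop X)))

variable {θ}

lemma norm_splitApp_le {C : ℝ} (hC : ∀ x, ‖θ x‖ ≤ C) (X : V.SplitObj) : ‖splitApp θ X‖ ≤ C := by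
  refine (Mult.norm_comp_le _ _).trans ?_
  rw [Mult.norm_adj]
  refine (mul_le_of_le_one_left (norm_nonneg _)
    (Mult.norm_le_one_of_adj_comp (ext_inclTop_isometry G X))).trans ?_
  exact (Mult.norm_comp_le _ _).trans ((mul_le_of_le_one_right (norm_nonneg _)
    (Mult.norm_le_one_of_adj_comp (ext_inclTop_isometry F X))).trans (hC _))

lemma splitApp_naturality
    (hθ : ∀ (x y : V.Obj) (f : SHom (.top x) (.top y : V.SplitObj)),
      Mult.comp (θ y) (F.1.map f) = Mult.comp (G.1.map f) (θ x))
    {X Y : V.SplitObj} (f : SHom X Y) :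
    Mult.comp (splitApp θ Y) (F.1.map f) = Mult.comp (G.1.map f) (splitApp θ X) := by
  have e1 : Mult.comp (F.ext (inclTop Y)) (F.1.map f) =
      Mult.comp (F.1.map f.toTop) (F.ext (inclTop X)) := by
    rw [← F.ext_of, ← F.ext_of, ← F.ext_comp, ← F.ext_comp, inclTop_comp_of]
  have e2 : Mult.comp (G.1.map f) (Mult.adj (G.ext (inclTop X))) =
      Mult.comp (Mult.adj (G.ext (inclTop Y))) (G.1.map f.toTop) := by
    rw [← G.ext_of, ← G.ext_of, ← G.ext_adj, ← G.ext_adj, ← G.ext_comp, ← G.ext_comp,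
      of_comp_adj_inclTop]
  rw [splitApp, splitApp, Mult.comp_assoc, Mult.comp_assoc, e1, ← Mult.comp_assoc (θ Y.obj), hθ,
    ← Mult.comp_assoc (G.1.map f), e2, Mult.comp_assoc, Mult.comp_assoc]

lemma splitApp_top (x : V.Obj) : splitApp θ (.top x) = θ x := by
  rw [splitApp, inclTop_top, F.ext_id, G.ext_id, Mult.adj_id, Mult.id_comp, Mult.comp_id]

end

/-- A bounded family of multipliers `θ x` between the values at the `(x, id)`, natural for morphisms
of `V`, extends to a transformation on the subobject completion. -/
lemma exists_nat_split {F G : LinFunctor V.split W}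
    (θ : ∀ x : V.Obj, W.Mult (F.1.obj (SplitObj.top x).sp) (G.1.obj (SplitObj.top x).sp)) (C : ℝ)
    (hC : ∀ x, ‖θ x‖ ≤ C)
    (hθ : ∀ (x y : V.Obj) (f : SHom (.top x) (.top y : V.SplitObj)),
      Mult.comp (θ y) (F.1.map f) = Mult.comp (G.1.map f) (θ x)) :
    ∃ τ : F.1.Nat G.1, ∀ x, τ.app (SplitObj.top x).sp = θ x :=
  ⟨Nat.mk (fun X => splitApp θ X) C (fun X => norm_splitApp_le hC X) fun X Y f =>
    splitApp_naturality hθ (X := X) (Y := Y) f, splitApp_top⟩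

end StarFunctor

/-! ### The universal property of the maximal tensor product -/

namespace CStarCat

open StarFunctor

variable {V₁ V₂ W : CStarCat.{u}}

section Transformations

variable {F G : LinFunctor (maxTensor V₁ V₂).split W}

/-- Naturality on elementary tensors implies naturality on the maximal tensor product. -/
lemma naturality_of_tens {X Y : V₁.Obj × V₂.Obj}
    {m : W.Mult (F.1.obj (SplitObj.top (tp X)).sp) (G.1.obj (SplitObj.top (tp X)).sp)}
    {n : W.Mult (F.1.obj (SplitObj.top (tp Y)).sp) (G.1.obj (SplitObj.top (tp Y)).sp)}
    (h : ∀ (f₁ : V₁.Hom X.1 Y.1) (f₂ : V₂.Hom X.2 Y.2),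
      Mult.comp n (F.1.map (SHom.mk (X := .top (tp X)) (Y := .top (tp Y))
        (tens (X := X) (Y := Y) f₁ f₂) rfl rfl)) =
      Mult.comp (G.1.map (SHom.mk (X := .top (tp X)) (Y := .top (tp Y))
        (tens (X := X) (Y := Y) f₁ f₂) rfl rfl)) m)
    (f : SHom (.top (tp X)) (.top (tp Y) : (maxTensor V₁ V₂).SplitObj)) :
    Mult.comp n (F.1.map f) = Mult.comp (G.1.map f) m := by
  refine Mult.ext_act fun T v => ?_
  let j : (maxTensor V₁ V₂).Hom (tp X) (tp Y) →
      SHom (.top (tp X)) (.top (tp Y) : (maxTensor V₁ V₂).SplitObj) := fun g => SHom.mk g rfl rfl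
  have hj : Continuous j := Continuous.subtype_mk continuous_id _
  have hj0 : j 0 = 0 := rfl
  have hja : ∀ g g', j (g + g') = j g + j g' := fun _ _ => rfl
  suffices key : ∀ g : (maxTensor V₁ V₂).Hom (tp X) (tp Y),
      n.act ((F.1.map (j g)).act v) = (G.1.map (j g)).act (m.act v) from key f.val
  refine tens_induction ?_ ?_ ?_ fun f₁ f₂ => congrArg (fun k => Mult.act k v) (h f₁ f₂)
  · exact isClosed_eq (n.continuous_act.comp ((F.continuous_map_act v).comp hj))
      ((G.continuous_map_act (m.act v)).comp hj)
  · rw [hj0, F.map_zero, G.map_zero, Mult.zero_act, Mult.zero_act, Mult.act_zero]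
  · intro g g' hg hg'
    rw [hja, F.2.1.1, G.2.1.1, Mult.add_act, Mult.add_act, Mult.act_add, hg, hg']

end Transformations

/-- Composition with the canonical functor is fully faithful. Both halves reduce to the objects
`(x, id)`, where naturality need only be tested on elementary tensors. -/
lemma precompBox_map_bijective (F G : LinFunctor (boxMax V₁ V₂) W) :
    Function.Bijective ((precompBox V₁ V₂ W).map : (Lin (boxMax V₁ V₂) W).Hom F G →
      (Bilin V₁ V₂ W).Hom ((precompBox V₁ V₂ W).obj F) ((precompBox V₁ V₂ W).obj G)) := by
  constructor
  · intro σ τ h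
    have hx : ∀ x : V₁.Obj × V₂.Obj, Nat.app σ (SplitObj.top (tp x)).sp =
        Nat.app τ (SplitObj.top (tp x)).sp := fun x => congrArg (fun η => Nat.app η x) h
    exact nat_ext_top (V := maxTensor V₁ V₂) hx
  · intro θ
    obtain ⟨τ, hτ⟩ := exists_nat_split (V := maxTensor V₁ V₂) (F := F) (G := G)
      (fun x => Nat.app θ x) ‖θ‖ (fun x => Nat.norm_app_le θ x) fun x y =>
        naturality_of_tens (X := x) (Y := y) fun f₁ f₂ =>
          Nat.naturality θ (X := x) (Y := y) (f₁, f₂)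
    exact ⟨τ, Nat.ext fun x => hτ x⟩

/-- Every bilinear functor is unitarily equivalent to the composite with the canonical functor of
the extension of its linearization to the subobject completion. -/
lemma exists_unitary_precompBox (hW : W.IsSubobjectComplete) (b : (Bilin V₁ V₂ W).Obj) :
    ∃ (F : (Lin (boxMax V₁ V₂) W).Obj)
      (w : (Bilin V₁ V₂ W).Hom ((precompBox V₁ V₂ W).obj F) b),
      (Bilin V₁ V₂ W).comp ((Bilin V₁ V₂ W).adj w) w =
        (Bilin V₁ V₂ W).id ((precompBox V₁ V₂ W).obj F) ∧
      (Bilin V₁ V₂ W).comp w ((Bilin V₁ V₂ W).adj w) = (Bilin V₁ V₂ W).id b := by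
  obtain ⟨b, hb, hn⟩ := b
  obtain ⟨U, ι, h1, h2⟩ := (hb.maxFunctor hn).exists_splittings hW
  -- at `(x, id)` the splitting isometry is unitary
  have h3 : ∀ x : V₁.Obj × V₂.Obj, Mult.comp (ι (.top (tp x))) (Mult.adj (ι (.top (tp x)))) =
      Mult.id _ := fun x => (h2 _).trans ((hb.maxFunctor hn).ext_id _)
  have hmap : ∀ (x y : V₁.Obj × V₂.Obj) (f₁ : V₁.Hom x.1 y.1) (f₂ : V₂.Hom x.2 y.2),
      (hb.maxFunctor hn).splitMap U ι (X := .top (tp x)) (Y := .top (tp y))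
        (SHom.mk (tens (X := x) (Y := y) f₁ f₂) rfl rfl) =
      Mult.comp (Mult.adj (ι (.top (tp y)))) (Mult.comp (b.biMap f₁ f₂) (ι (.top (tp x)))) :=
    fun x y f₁ f₂ => congrArg
      (fun m => Mult.comp (Mult.adj (ι (.top (tp y)))) (Mult.comp m (ι (.top (tp x)))))
      (hb.maxFunctor_map_tmul hn f₁ f₂)
  have hnat : ∀ (x y : V₁.Obj × V₂.Obj) (f₁ : V₁.Hom x.1 y.1) (f₂ : V₂.Hom x.2 y.2),
      Mult.comp (ι (.top (tp y))) ((hb.maxFunctor hn).splitMap U ι (X := .top (tp x))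
        (Y := .top (tp y)) (SHom.mk (tens (X := x) (Y := y) f₁ f₂) rfl rfl)) =
      Mult.comp (b.biMap f₁ f₂) (ι (.top (tp x))) := fun x y f₁ f₂ => by
    rw [hmap, ← Mult.comp_assoc, h3]
    exact Mult.id_comp _
  let F : LinFunctor (boxMax V₁ V₂) W := (hb.maxFunctor hn).split h1 h2
  let w : (F.1.precomp (boxFunctor V₁ V₂)).Nat b :=
    Nat.mk (fun x => ι (.top (tp x))) 1 (fun x => Mult.norm_le_one_of_adj_comp (h1 _))
      fun x y f => hnat x y f.1 f.2
  exact ⟨F, w, Nat.ext fun x => h1 (.top (tp x)), Nat.ext fun x => h3 x⟩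

/-- The universal property of the maximal tensor product, for subobject complete targets. -/
theorem isEquivalence_precompBox (hW : W.IsSubobjectComplete) :
    (precompBox V₁ V₂ W).IsEquivalence :=
  UStarFunctor.isEquivalence_of_bijective _ precompBox_map_bijective (exists_unitary_precompBox hW)

/-! ### Pseudonaturality -/

section Pseudonatural

variable (V₁ V₂)

/-- Composition with `h : W → M W'` commutes strictly with composition with the canonical functor;
the structure transformation has identity components. -/
def precompBoxTrans {W W' : CStarLin.{u}} (h : W ⟶ W') :
    UStarFunctor.Trans
      ((precompBox V₁ V₂ W'.toCStarCat).comp ((linFrom (boxMax V₁ V₂)).map h))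
      (((bilinFrom V₁ V₂).map h).comp (precompBox V₁ V₂ W.toCStarCat)) :=
  UStarFunctor.Trans.id ((precompBox V₁ V₂ W'.toCStarCat).comp ((linFrom (boxMax V₁ V₂)).map h))

/-- The unit axiom of `precompBoxStrongTrans` at a component. -/
lemma unitor_precomp_aux (Y : W.Obj) : Mult.comp (Mult.id Y) (Mult.id Y) =
    Mult.comp (Mult.comp (Mult.id Y) (Mult.id Y)) (Mult.id Y) := by
  simp only [Mult.comp_id]

/-- The composition axiom of `precompBoxStrongTrans` at a component. -/
lemma assoc_precomp_aux {W' : CStarCat.{u}} (k : LinFunctor W W') (Y : W.Obj) :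
    Mult.comp (Mult.id (k.1.obj Y)) (Mult.id (k.1.obj Y)) =
      Mult.comp (Mult.comp (Mult.comp (Mult.comp (Mult.comp (Mult.id (k.1.obj Y))
        (k.ext (Mult.id Y))) (Mult.id (k.1.obj Y))) (Mult.id (k.1.obj Y))) (Mult.id (k.1.obj Y)))
          (Mult.id (k.1.obj Y)) := by
  rw [k.ext_id]
  simp only [Mult.comp_id]

lemma precompBoxTrans_isUnitary {W W' : CStarLin.{u}} (h : W ⟶ W') :
    (precompBoxTrans V₁ V₂ h).IsUnitary := fun F =>
  ⟨Nat.ext fun X => adj_comp_id (h.1.obj (F.1.obj ((boxFunctor V₁ V₂).obj X))),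
   Nat.ext fun X => comp_adj_id (h.1.obj (F.1.obj ((boxFunctor V₁ V₂).obj X)))⟩

/-- The pseudonatural transformation given by composition with the canonical functor. -/
def precompBoxStrongTrans :
    Pseudofunctor.StrongTrans (linFrom (boxMax V₁ V₂)) (bilinFrom V₁ V₂) where
  app W := precompBox V₁ V₂ W.toCStarCat
  naturality h := UStarFunctor.unitaryIso (precompBoxTrans V₁ V₂ h)
    (precompBoxTrans_isUnitary V₁ V₂ h)
  naturality_naturality η := UStarFunctor.Trans.ext (funext fun F => Nat.ext fun X =>
    (Mult.id_comp (Nat.app η (F.1.obj ((boxFunctor V₁ V₂).obj X)))).trans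
      (Mult.comp_id (Nat.app η (F.1.obj ((boxFunctor V₁ V₂).obj X)))).symm)
  naturality_id _ := UStarFunctor.Trans.ext (funext fun F => Nat.ext fun X =>
    unitor_precomp_aux (F.1.obj ((boxFunctor V₁ V₂).obj X)))
  naturality_comp h k := UStarFunctor.Trans.ext (funext fun F => Nat.ext fun X =>
    assoc_precomp_aux k (h.1.obj (F.1.obj ((boxFunctor V₁ V₂).obj X))))

end Pseudonatural

end CStarCat

end

theorem mainTheorem5 (V₁ V₂ : CStarLin.{u}) :
    (CStarCat.boxMax V₁.toCStarCat V₂.toCStarCat).IsCountablyAdditive ∧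
    (∀ W : CStarLin.{u},
      (CStarCat.precompBox V₁.toCStarCat V₂.toCStarCat W.toCStarCat).IsEquivalence) ∧
    ∃ Φ : Pseudofunctor.StrongTrans
        (CStarCat.linFrom (CStarCat.boxMax V₁.toCStarCat V₂.toCStarCat))
        (CStarCat.bilinFrom V₁.toCStarCat V₂.toCStarCat),
      (∀ W : CStarLin.{u},
        Φ.app W = CStarCat.precompBox V₁.toCStarCat V₂.toCStarCat W.toCStarCat) ∧
      ∀ {W W' : CStarLin.{u}} (h : W ⟶ W'),
        UStarFunctor.Trans.IsUnitary (Φ.naturality h).hom := by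
  refine ⟨CStarCat.isCountablyAdditive_boxMax V₁.additive V₂.additive,
    fun W => CStarCat.isEquivalence_precompBox W.additive.1,
    CStarCat.precompBoxStrongTrans V₁.toCStarCat V₂.toCStarCat, fun _ => rfl, fun h => ?_⟩
  exact CStarCat.precompBoxTrans_isUnitary V₁.toCStarCat V₂.toCStarCat h
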